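/- Let $m=m_1+m_2$ and $0<l<\infty$. A function on $[0,l]$ is called boundedly differentiable if it is absolutely continuous on $[0,l]$ and its derivative is (essentially) bounded. Let $\gamma=[\gamma_1\ \ \gamma_2]$ be a boundedly differentiable $m_2\times m$ matrix function on $[0,l]$, with blocks $\gamma_k$ of size $m_2\times m_k$, such that $\gamma(x)\gamma(x)^*=I_{m_2}$ for all $x\in[0,l]$ and $\det\gamma_2(0)\neq 0$. On $L^2_{m_2}(0,l)$ (the space of square-integrable $\mathbb C^{m_2}$-valued functions) put $$ (Af)(x)=-\mathrm i\int_0^x f(t)\,dt,\qquad (Kf)(x)=-\mathrm i\,\gamma(x)\int_0^x\gamma(t)^*f(t)\,dt .$$ Consider bounded, boundedly invertible operators $E$ on $L^2_{m_2}(0,l)$ with the following properties: $K=EAE^{-1}$; $E$ is triangular with bounded measurable kernel, $$(Ef)(x)=\rho(x)f(x)+\int_0^xE(x,t)f(t)\,dt,$$ where $\rho$ is absolutely continuous, $\rho'=\gamma'\gamma^*\rho$ almost everywhere and $\det\rho(0)\ne0$; $E^{-1}$ is triangular of the same form, with diagonal part $\rho^{-1}$ and a bounded measurable kernel; $E$ and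 $E^{-1}$ map boundedly differentiable functions to boundedly differentiable functions; and $E^{-1}\gamma_2\equiv I_{m_2}$ ($E^{-1}$ being applied columnwise). Then such an operator $E$ exists. For every $z\in\mathbb C$ the system $w'(x,z)=-\mathrm i z\,\gamma(x)^*\gamma(x)w(x,z)$ $(0\le x\le l)$, $w(0,z)=I_m$, has a solution on $[0,l]$. Moreover, for every such $E$, put $S=E^{-1}(E^*)^{-1}$ and let $\Pi:\mathbb C^{m}\to L^2_{m_2}(0,l)$ be given by $\Pi\begin{bmatrix}g_1\\ g_2\end{bmatrix}=\Phi_1(x)g_1+g_2$, where $\Phi_1=E^{-1}\gamma_1$ (columnwise). Then $(A,S,\Pi)$ is an $S$-node, that is, $AS-SA^*=-\mathrm i\,\Pi\Pi^*$. For $0<r\le l$ let $P_r:L^2_{m_2}(0,l)\to L^2_{m_2}(0,r)$ be the restriction operator, $A_r=P_rAP_r^*$ and $S_r=P_rSP_r^*$. Then, for all $0<r\le l$ and $z\in\mathbb C$, the operators $S_r$ and $I-zA_r$ are invertible and every solution $w$ of the above system satisfies $$ w(r,z)=w_A(r,z):=I_m-\mathrm i z\,\Pi^*P_r^*S_r^{-1}(I-zA_r)^{-1}P_r\Pi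 .$$ -/

import Mathlib

open MeasureTheory Set
open scoped Matrix ENNReal
-- The space of matrices carries the operator norm induced by the `l²`-norms.
open scoped Matrix.Norms.L2Operator

noncomputable section

namespace SkewDirac

/-- Lebesgue measure on the interval `(0, l)` (the endpoint `l` is a null set). -/
abbrev vol (l : ℝ) : Measure ℝ := volume.restrict (Ioc 0 l)

/-- The Hilbert space `L²_n(0, l)` of square-integrable `ℂⁿ`-valued functions. -/
abbrev L2 (l : ℝ) (n : ℕ) : Type := Lp (EuclideanSpace ℂ (Fin n)) 2 (vol l)

/-- `f` is boundedly differentiable on `[0, l]`: it is absolutely continuous there and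
`sup ‖f'‖ < ∞`. -/
def BoundedlyDifferentiableOn {X : Type*} [NormedAddCommGroup X] [NormedSpace ℝ X]
    (l : ℝ) (f : ℝ → X) : Prop :=
  AbsolutelyContinuousOnInterval f 0 l ∧ ∃ C : ℝ, ∀ᵐ x ∂vol l, ‖deriv f x‖ ≤ C

/-- The class in `L²_n(0, l)` of a function that is continuous on the closed interval. -/
def ofContinuousOn {l : ℝ} {n : ℕ} (f : ℝ → EuclideanSpace ℂ (Fin n))
    (hf : ContinuousOn f (uIcc 0 l)) : L2 l n :=
  MemLp.toLp f (by
    have hsub : Ioc 0 l ⊆ uIcc 0 l := Ioc_subset_Icc_self.trans Icc_subset_uIcc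
    obtain ⟨C, hC⟩ := isCompact_uIcc.exists_bound_of_continuousOn hf
    refine MemLp.of_bound ((hf.mono hsub).aestronglyMeasurable measurableSet_Ioc) C ?_
    exact (ae_restrict_iff' measurableSet_Ioc).2 (ae_of_all _ fun x hx => hC x (hsub hx)))

/-- The `j`-th column of a boundedly differentiable `n × κ` matrix function, as an element
of `L²_n(0, l)`. -/
def column {l : ℝ} {n : ℕ} {κ : Type*} [Fintype κ] [DecidableEq κ]
    (γ : ℝ → Matrix (Fin n) κ ℂ) (hγ : BoundedlyDifferentiableOn l γ) (j : κ) : L2 l n :=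
  ofContinuousOn (fun x => WithLp.toLp 2 fun i => γ x i j) (by
    have h := hγ.1.continuousOn
    have h2 : Continuous fun M : Matrix (Fin n) κ ℂ =>
        (WithLp.toLp 2 fun i => M i j : EuclideanSpace ℂ (Fin n)) :=
      (PiLp.continuous_toLp 2 _).comp
        (continuous_pi fun i => continuous_id.matrix_elem i j)
    exact h2.comp_continuousOn h)

/-- The constant function with value `v`, as an element of `L²_n(0, l)`. -/
def const (l : ℝ) {n : ℕ} (v : EuclideanSpace ℂ (Fin n)) : L2 l n := Lp.const 2 (vol l) v

lemma integrableOn_coeFn {l : ℝ} {n : ℕ} (f : L2 l n) : IntegrableOn f (Ioc 0 l) :=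
  (Lp.memLp f).integrable one_le_two

lemma intervalIntegrable_coeFn {l x : ℝ} {n : ℕ} (f : L2 l n) (hx : x ∈ Ioc 0 l) :
    IntervalIntegrable f volume 0 x :=
  (intervalIntegrable_iff_integrableOn_Ioc_of_le hx.1.le).2
    ((integrableOn_coeFn f).mono_set (Ioc_subset_Ioc_right hx.2))

/-- `f ↦ ∫₀ˣ f(t) dt` is bounded from `L²` to `L^∞`. -/
lemma norm_primitive_le {l x : ℝ} {n : ℕ} (f : L2 l n) (hx : x ∈ Ioc 0 l) :
    ‖∫ t in (0 : ℝ)..x, f t‖ ≤ ‖f‖ * ((vol l univ) ^ (1 / 2 : ℝ)).toReal := by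
  have h1 : ‖∫ t in (0 : ℝ)..x, f t‖ ≤ ∫ t in Ioc 0 l, ‖f t‖ := by
    rw [intervalIntegral.integral_of_le hx.1.le]
    refine (norm_integral_le_integral_norm _).trans ?_
    exact setIntegral_mono_set (integrableOn_coeFn f).norm
      (ae_of_all _ fun _ => norm_nonneg _) (Ioc_subset_Ioc_right hx.2).eventuallyLE
  refine h1.trans ?_
  rw [integral_norm_eq_lintegral_enorm (integrableOn_coeFn f).aestronglyMeasurable,
    ← eLpNorm_one_eq_lintegral_enorm, Lp.norm_def, ← ENNReal.toReal_mul]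
  have h2 := eLpNorm_le_eLpNorm_mul_rpow_measure_univ (μ := vol l) (p := 1) (q := 2)
    (by norm_num) (Lp.memLp f).1
  have e : (1 / (1 : ℝ≥0∞).toReal - 1 / (2 : ℝ≥0∞).toReal : ℝ) = 1 / 2 := by norm_num
  rw [e] at h2
  refine ENNReal.toReal_mono ?_ h2
  exact ENNReal.mul_ne_top (Lp.eLpNorm_ne_top f)
    (ENNReal.rpow_ne_top_of_nonneg (by norm_num) (measure_ne_top _ _))

lemma memLp_primitive {l : ℝ} {n : ℕ} (f : L2 l n) :
    MemLp (fun x => -Complex.I • ∫ t in (0 : ℝ)..x, f t) 2 (vol l) := by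
  refine MemLp.const_smul (f := fun x => ∫ t in (0 : ℝ)..x, f t) ?_ (-Complex.I)
  have hc : ContinuousOn (fun x => ∫ t in Ioc 0 x, f t) (Icc 0 l) :=
    intervalIntegral.continuousOn_primitive
      ((integrableOn_Icc_iff_integrableOn_Ioc).2 (integrableOn_coeFn f))
  have hc' : ContinuousOn (fun x => ∫ t in (0 : ℝ)..x, f t) (Ioc 0 l) :=
    (hc.mono Ioc_subset_Icc_self).congr fun x hx => intervalIntegral.integral_of_le hx.1.le
  exact MemLp.of_bound (hc'.aestronglyMeasurable measurableSet_Ioc) _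
    ((ae_restrict_iff' measurableSet_Ioc).2 (ae_of_all _ fun x hx => norm_primitive_le f hx))

/-- The operator `A f = -i ∫₀ˣ f(t) dt` on `L²_n(0, l)`. -/
def opA (l : ℝ) (n : ℕ) : L2 l n →L[ℂ] L2 l n :=
  LinearMap.mkContinuousOfExistsBound
    { toFun := fun f => (memLp_primitive f).toLp _
      map_add' := fun f g => by
        rw [← MemLp.toLp_add]
        refine MemLp.toLp_congr _ _ ((ae_restrict_iff' measurableSet_Ioc).2
          (ae_of_all _ fun x hx => ?_))
        have h : ∫ t in (0 : ℝ)..x, (f + g : L2 l n) t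
            = ∫ t in (0 : ℝ)..x, (f t + g t) := by
          rw [intervalIntegral.integral_of_le hx.1.le, intervalIntegral.integral_of_le hx.1.le]
          refine integral_congr_ae ?_
          exact ae_restrict_of_ae_restrict_of_subset (Ioc_subset_Ioc_right hx.2)
            (Lp.coeFn_add f g)
        simp only [Pi.add_apply]
        rw [h, intervalIntegral.integral_add (intervalIntegrable_coeFn f hx)
          (intervalIntegrable_coeFn g hx), smul_add]
      map_smul' := fun c f => by
        rw [RingHom.id_apply, ← MemLp.toLp_const_smul]
        refine MemLp.toLp_congr _ _ ((ae_restrict_iff' measurableSet_Ioc).2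
          (ae_of_all _ fun x hx => ?_))
        have h : ∫ t in (0 : ℝ)..x, (c • f : L2 l n) t = ∫ t in (0 : ℝ)..x, c • f t := by
          rw [intervalIntegral.integral_of_le hx.1.le, intervalIntegral.integral_of_le hx.1.le]
          refine integral_congr_ae ?_
          exact ae_restrict_of_ae_restrict_of_subset (Ioc_subset_Ioc_right hx.2)
            (Lp.coeFn_smul c f)
        simp only [Pi.smul_apply]
        rw [h, intervalIntegral.integral_smul, smul_comm] }
    ⟨_, fun f => by
      refine (Lp.norm_le_of_ae_bound (C := ‖f‖ * ((vol l univ) ^ (1 / 2 : ℝ)).toReal)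
        (by positivity) ?_).trans (le_of_eq (mul_left_comm _ _ _ |>.trans (mul_comm _ _)))
      filter_upwards [(memLp_primitive f).coeFn_toLp,
        ae_restrict_mem (μ := volume) (s := Ioc 0 l) measurableSet_Ioc] with x hx hxl
      change ‖((memLp_primitive f).toLp _ : L2 l n) x‖ ≤ _
      rw [hx, norm_smul, norm_neg, Complex.norm_I, one_mul]
      exact norm_primitive_le f hxl⟩

/-- `T` is a triangular operator `(T f)(x) = ρ(x) f(x) + ∫₀ˣ k(x, t) f(t) dt` with diagonal
part `ρ` and a bounded kernel `k`. -/
def IsTriangular {l : ℝ} {n : ℕ} (T : L2 l n →L[ℂ] L2 l n)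
    (ρ : ℝ → Matrix (Fin n) (Fin n) ℂ) : Prop :=
  ∃ k : ℝ → ℝ → Matrix (Fin n) (Fin n) ℂ,
    (∀ i j, Measurable fun p : ℝ × ℝ => k p.1 p.2 i j) ∧
    (∃ C : ℝ, ∀ x t, ‖k x t‖ ≤ C) ∧
    ∀ f : L2 l n, T f =ᵐ[vol l] fun x =>
      WithLp.toLp 2 (ρ x *ᵥ f x + ∫ t in (0 : ℝ)..x, k x t *ᵥ f t)

/-- An element of `L²_n(0, l)` has a boundedly differentiable representative. -/
def HasBoundedDerivative {l : ℝ} {n : ℕ} (f : L2 l n) : Prop :=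
  ∃ g : ℝ → EuclideanSpace ℂ (Fin n), BoundedlyDifferentiableOn l g ∧ f =ᵐ[vol l] g

/-- `E` is a (boundedly invertible, triangular) similarity operator between the Volterra operator
`(K f)(x) = F(x) ∫₀ˣ G(t) f(t) dt` and the operator `A`, that is `K = E A E⁻¹`. -/
structure IsSimilarity {l : ℝ} {n : ℕ} {κ : Type*} [Fintype κ] [DecidableEq κ]
    (F : ℝ → Matrix (Fin n) κ ℂ) (G : ℝ → Matrix κ (Fin n) ℂ)
    (E : (L2 l n →L[ℂ] L2 l n)ˣ) : Prop where
  similar : ∀ f : L2 l n, (E.val * opA l n * E⁻¹.val) f =ᵐ[vol l] fun x =>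
    WithLp.toLp 2 (F x *ᵥ ∫ t in (0 : ℝ)..x, G t *ᵥ f t)
  triangular : ∃ ρ : ℝ → Matrix (Fin n) (Fin n) ℂ,
    AbsolutelyContinuousOnInterval ρ 0 l ∧ (ρ 0).det ≠ 0 ∧
    (∀ᵐ x ∂vol l, HasDerivAt ρ (Complex.I • (deriv F x * G x * ρ x)) x) ∧
    IsTriangular E.val ρ ∧ IsTriangular E⁻¹.val fun x => (ρ x)⁻¹
  map_bounded_derivative : ∀ f : L2 l n, HasBoundedDerivative f → HasBoundedDerivative (E.val f)
  map_bounded_derivative_inv :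
    ∀ f : L2 l n, HasBoundedDerivative f → HasBoundedDerivative (E⁻¹.val f)

/-- `E` is a similarity operator for `F = γ`, `G = -i γ*` which is normalized by
`E⁻¹ γ₂ ≡ I` (columnwise), where `γ = [γ₁ γ₂]`. -/
structure IsNormalizedSimilarity {l : ℝ} {m₁ m₂ : ℕ}
    (γ : ℝ → Matrix (Fin m₂) (Fin m₁ ⊕ Fin m₂) ℂ) (hγ : BoundedlyDifferentiableOn l γ)
    (E : (L2 l m₂ →L[ℂ] L2 l m₂)ˣ) : Prop extends
    IsSimilarity γ (fun x => -Complex.I • (γ x)ᴴ) E where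
  normalized : ∀ j : Fin m₂,
    E⁻¹.val (column γ hγ (Sum.inr j)) = const l (EuclideanSpace.single j 1)

/-- `S = E⁻¹ (E*)⁻¹`. -/
def opS {l : ℝ} {n : ℕ} (E : (L2 l n →L[ℂ] L2 l n)ˣ) : L2 l n →L[ℂ] L2 l n :=
  (E⁻¹ * (star E)⁻¹).val

/-- `Π = [Φ₁ Φ₂]`, that is `Π g = Φ₁ g₁ + Φ₂ g₂` for `g = (g₁, g₂)`, where `Φ₁ g₁ = Φ₁(x) g₁`,
`Φ₁(x) = (E⁻¹ γ₁)(x)` (columnwise), and `Φ₂ g₂` is the constant function `g₂`. -/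
def opPi {l : ℝ} {m₁ m₂ : ℕ}
    (γ : ℝ → Matrix (Fin m₂) (Fin m₁ ⊕ Fin m₂) ℂ) (hγ : BoundedlyDifferentiableOn l γ)
    (E : (L2 l m₂ →L[ℂ] L2 l m₂)ˣ) :
    EuclideanSpace ℂ (Fin m₁ ⊕ Fin m₂) →L[ℂ] L2 l m₂ :=
  LinearMap.toContinuousLinearMap
    { toFun := fun g =>
        (∑ j : Fin m₁, g (Sum.inl j) • E⁻¹.val (column γ hγ (Sum.inl j))) +
          const l (WithLp.toLp 2 fun i => g (Sum.inr i))
      map_add' := fun g h => by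
        have e : (WithLp.toLp 2 fun i => (g + h) (Sum.inr i) : EuclideanSpace ℂ (Fin m₂)) =
            (WithLp.toLp 2 fun i => g (Sum.inr i)) + WithLp.toLp 2 fun i => h (Sum.inr i) := rfl
        rw [e]
        simp only [PiLp.add_apply, add_smul, Finset.sum_add_distrib, const, map_add]
        abel
      map_smul' := fun c g => by
        have e : (WithLp.toLp 2 fun i => (c • g) (Sum.inr i) : EuclideanSpace ℂ (Fin m₂)) =
            c • (WithLp.toLp 2 fun i => g (Sum.inr i)) := rfl
        rw [e]
        simp only [PiLp.smul_apply, smul_eq_mul, mul_smul, RingHom.id_apply, smul_add,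
          Finset.smul_sum, const]
        congr 1 }

/-- The operator identity `A S - S A* = -i Π Π*`, that is, `(A, S, Π)` is an `S`-node. -/
def IsSNode {H : Type*} [NormedAddCommGroup H] [InnerProductSpace ℂ H] [CompleteSpace H]
    {κ : Type*} [Fintype κ] (A S : H →L[ℂ] H) (P : EuclideanSpace ℂ κ →L[ℂ] H) : Prop :=
  A ∘L S - S ∘L A.adjoint = -Complex.I • (P ∘L P.adjoint)

/-- The operator `P_r` from `L²_n(0, l)` onto `L²_n(0, r)` restricting functions to `(0, r)`. -/
def restr {r l : ℝ} (n : ℕ) (h : r ≤ l) : L2 l n →L[ℂ] L2 r n :=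
  have hμ : vol r ≤ vol l := Measure.restrict_mono (Ioc_subset_Ioc_right h) le_rfl
  LinearMap.mkContinuous
    { toFun := fun f => ((Lp.memLp f).mono_measure hμ).toLp f
      map_add' := fun f g => by
        rw [← MemLp.toLp_add]
        exact MemLp.toLp_congr _ _ (ae_mono hμ (Lp.coeFn_add f g))
      map_smul' := fun c f => by
        rw [RingHom.id_apply, ← MemLp.toLp_const_smul]
        exact MemLp.toLp_congr _ _ (ae_mono hμ (Lp.coeFn_smul c f)) }
    1 fun f => by
      rw [one_mul]
      change ‖((Lp.memLp f).mono_measure hμ).toLp f‖ ≤ ‖f‖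
      rw [Lp.norm_toLp, Lp.norm_def]
      exact ENNReal.toReal_mono (Lp.eLpNorm_ne_top f) (eLpNorm_mono_measure f hμ)

/-- The compression `T_r = P_r T P_r*` of an operator to `L²_n(0, r)`. -/
def compr {r l : ℝ} {n : ℕ} (h : r ≤ l) (T : L2 l n →L[ℂ] L2 l n) : L2 r n →L[ℂ] L2 r n :=
  restr n h ∘L T ∘L (restr n h).adjoint

/-- The transfer matrix function
`w_A(r, z) = I - i z Π* S_r⁻¹ (I - z A_r)⁻¹ P_r Π`, as a matrix; here `Π*` acts on `L²_n(0, r)`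
as `Π* P_r* = (P_r Π)*`. `Ring.inverse` is the inverse of an invertible operator. -/
def transferMatrix {r l : ℝ} {n : ℕ} {κ : Type*} [Fintype κ] [DecidableEq κ] (h : r ≤ l)
    (A S : L2 l n →L[ℂ] L2 l n) (P : EuclideanSpace ℂ κ →L[ℂ] L2 l n) (z : ℂ) :
    Matrix κ κ ℂ :=
  (Matrix.toEuclideanCLM (n := κ) (𝕜 := ℂ)).symm
    (1 - (Complex.I * z) • (P.adjoint ∘L (restr n h).adjoint ∘L Ring.inverse (compr h S) ∘L
      Ring.inverse (1 - z • compr h A) ∘L restr n h ∘L P))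

/-- `w` is the fundamental solution on `[0, l]` of `w' = -i z γ* γ w`, `w(0) = I`. -/
def IsFundamentalSolution {n : ℕ} {κ : Type*} [Fintype κ] [DecidableEq κ] (l : ℝ)
    (γ : ℝ → Matrix (Fin n) κ ℂ) (z : ℂ) (w : ℝ → Matrix κ κ ℂ) : Prop :=
  w 0 = 1 ∧ ∀ x ∈ Icc 0 l,
    HasDerivWithinAt w (-(Complex.I * z) • ((γ x)ᴴ * γ x * w x)) (Icc 0 l) x

end SkewDirac

end

open SkewDirac

namespace SkewDirac

/-! Write G for γ on [0, l], a for its derivative and (Γg)(x) = G(x)g. The operator K has kernel -i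
G(x)G(t)*, so K - K* = -i ΓΓ* (`IsFrame.adjoint_opK`). All three claims follow from a triangular
similarity between K and A.

Existence of E. Comparing kernels (`HasKernel.comp`), KE = EA means M(x,t) = G(x)v(x,t), where
M(x,t) = ρ(x) + ∫_t^x e(x,s) ds and v(x,t) = G(t)*ρ(t) + ∫_t^x G(s)*e(s,t) ds. With the extra
unknown ζ = v - G*M, written as ∫_t^x z(x,s) ds, this becomes a linear hyperbolic system: e_x + e_t
= a(G*e + z) along diagonals and z_x = -(a* + G*aG*)e - G*az along the lines t = const, with z(t,t)
= -(a* + G*aG*)ρ(t). It is solved as a Volterra equation (`exists_volterra_solution`,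
`exists_goursat_solution`), and `IsFrame.kernel_identity` leads back from the system to M = Gv. The
datum e(x,0) is still free. Taking it to be aτ with τ' = -G*aτ, where τ(0) is the part of J in the
kernel of G(0) and J selects the columns of γ₂, yields E v = γ₂v for constants v
(`IsFrame.exists_kernel`). Then ρ(0) = γ₂(0), which is invertible by hypothesis; hence ρ(x) is
invertible for all x and E has a triangular inverse (`HasKernel.exists_unit`). Since restrictions to
lines and diagonals are restrictions to null sets, kernels are honest functions satisfying their
equations at every point of the triangle, not classes modulo null sets.

S-node. The normalization gives EΠ = Γ. Conjugating K - K* = -i ΓΓ* by E⁻¹ gives the operator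
identity (`isSNode_of_similar`).

Transfer function. Triangular operators satisfy P_r T = T_r P_r, so S_r = F⁻¹(F*)⁻¹ with F = E_r. If
w is a solution and Y = γwg, the integrated equation says (I - zK)Y = Γg; after E⁻¹ and restriction,
(I - zA_r)⁻¹P_rΠg = F⁻¹P_rY. Now S_r⁻¹ turns F⁻¹ into F*, and Π*P_r*F* = (P_rΓ)*, so w_A(r,z)g = g -
iz ∫_0^r γ*γwg = w(r)g (`IsFrame.isUnit_and_transferMatrix`). -/

/-- Strongly measurable and globally bounded functions. -/
structure BoundedMeasurable {α V : Type*} [MeasurableSpace α] [NormedAddCommGroup V]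
    (f : α → V) : Prop where
  sm : StronglyMeasurable f
  bdd : ∃ C : ℝ, 0 ≤ C ∧ ∀ x, ‖f x‖ ≤ C

/-! ### Calculus of bounded measurable functions; Fubini on triangles. -/

section BoundedMeasurable

variable {α β V W U : Type*} [MeasurableSpace α] [MeasurableSpace β]
  [NormedAddCommGroup V] [NormedAddCommGroup W] [NormedAddCommGroup U]

lemma BoundedMeasurable.const (v : V) : BoundedMeasurable fun _ : α => v :=
  ⟨stronglyMeasurable_const, ‖v‖, norm_nonneg _, fun _ => le_rfl⟩

lemma BoundedMeasurable.add {f g : α → V} (hf : BoundedMeasurable f)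
    (hg : BoundedMeasurable g) : BoundedMeasurable fun x => f x + g x := by
  obtain ⟨C, hC0, hC⟩ := hf.bdd
  obtain ⟨D, hD0, hD⟩ := hg.bdd
  exact ⟨hf.sm.add hg.sm, C + D, by positivity,
    fun x => (norm_add_le _ _).trans (add_le_add (hC x) (hD x))⟩

lemma BoundedMeasurable.neg {f : α → V} (hf : BoundedMeasurable f) :
    BoundedMeasurable fun x => -f x := by
  obtain ⟨C, hC0, hC⟩ := hf.bdd
  exact ⟨hf.sm.neg, C, hC0, fun x => by simpa using hC x⟩

lemma BoundedMeasurable.comp {f : β → V} (hf : BoundedMeasurable f) {g : α → β}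
    (hg : Measurable g) : BoundedMeasurable fun x => f (g x) := by
  obtain ⟨C, hC0, hC⟩ := hf.bdd
  exact ⟨hf.sm.comp_measurable hg, C, hC0, fun x => hC _⟩

lemma BoundedMeasurable.integrable {f : α → V} (hf : BoundedMeasurable f)
    (μ : Measure α) [IsFiniteMeasure μ] : Integrable f μ := by
  obtain ⟨C, hC0, hC⟩ := hf.bdd
  exact Integrable.of_bound hf.sm.aestronglyMeasurable C (ae_of_all _ hC)

lemma BoundedMeasurable.intervalIntegrable {f : ℝ → V} (hf : BoundedMeasurable f) (a b : ℝ) :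
    IntervalIntegrable f volume a b :=
  ⟨hf.integrable _, hf.integrable _⟩

variable [NormedSpace ℝ V] [NormedSpace ℝ W] [NormedSpace ℝ U]

lemma BoundedMeasurable.clm (L : V →L[ℝ] W) {f : α → V} (hf : BoundedMeasurable f) :
    BoundedMeasurable fun x => L (f x) := by
  obtain ⟨C, hC0, hC⟩ := hf.bdd
  exact ⟨L.continuous.comp_stronglyMeasurable hf.sm, ‖L‖ * C, by positivity,
    fun x => (L.le_opNorm _).trans (by gcongr; exact hC x)⟩

lemma BoundedMeasurable.bilin (B : U →L[ℝ] V →L[ℝ] W) {f : α → U} {g : α → V}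
    (hf : BoundedMeasurable f) (hg : BoundedMeasurable g) :
    BoundedMeasurable fun x => B (f x) (g x) := by
  obtain ⟨C, hC0, hC⟩ := hf.bdd
  obtain ⟨D, hD0, hD⟩ := hg.bdd
  refine ⟨B.continuous₂.comp_stronglyMeasurable (hf.sm.prodMk hg.sm), ‖B‖ * C * D,
    by positivity, fun x => (B.le_opNorm₂ _ _).trans ?_⟩
  gcongr
  exacts [hC x, hD x]

/-- Integrals over intervals depending measurably on a parameter are measurable. -/
lemma stronglyMeasurable_setIntegral_Ioc {H : α × ℝ → V} (hH : StronglyMeasurable H)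
    {a b : α → ℝ} (ha : Measurable a) (hb : Measurable b) :
    StronglyMeasurable fun p => ∫ s in Ioc (a p) (b p), H (p, s) := by
  have hS : MeasurableSet {q : α × ℝ | q.2 ∈ Ioc (a q.1) (b q.1)} :=
    (measurableSet_lt (ha.comp measurable_fst) measurable_snd).inter
      (measurableSet_le measurable_snd (hb.comp measurable_fst))
  have h := (hH.indicator hS).integral_prod_right' (ν := volume)
  convert h using 2 with p
  rw [← integral_indicator measurableSet_Ioc]
  rfl

/-- Fubini's theorem on a triangle. -/
lemma integral_triangle_swap {H : ℝ → ℝ → V} {a b : ℝ} (hab : a ≤ b)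
    (hH : Integrable (Function.uncurry H)
      ((volume.restrict (Ioc a b)).prod (volume.restrict (Ioc a b)))) :
    ∫ s in a..b, ∫ t in a..s, H s t = ∫ t in a..b, ∫ s in t..b, H s t := by
  have hS : MeasurableSet {q : ℝ × ℝ | q.2 ≤ q.1} := measurableSet_le measurable_snd measurable_fst
  have h := integral_integral_swap (f := fun s t => {q : ℝ × ℝ | q.2 ≤ q.1}.indicator
    (Function.uncurry H) (s, t)) (hH.indicator hS)
  rw [intervalIntegral.integral_of_le hab, intervalIntegral.integral_of_le hab]
  convert h using 1
  · refine setIntegral_congr_fun measurableSet_Ioc fun s hs => ?_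
    rw [intervalIntegral.integral_of_le hs.1.le]
    have e : (fun t => {q : ℝ × ℝ | q.2 ≤ q.1}.indicator (Function.uncurry H) (s, t))
        = (Iic s).indicator (H s) := by
      ext t; by_cases ht : t ≤ s <;> simp [Function.uncurry, ht]
    rw [e, setIntegral_indicator measurableSet_Iic]
    congr 2
    ext t; simp only [mem_Ioc, mem_inter_iff, mem_Iic] at hs ⊢; grind
  · refine setIntegral_congr_fun measurableSet_Ioc fun t ht => ?_
    rw [intervalIntegral.integral_of_le ht.2]
    have e : (fun s => {q : ℝ × ℝ | q.2 ≤ q.1}.indicator (Function.uncurry H) (s, t))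
        = (Ici t).indicator (fun s => H s t) := by
      ext s; by_cases hs : t ≤ s <;> simp [Function.uncurry, hs]
    rw [e, setIntegral_indicator measurableSet_Ici, ← integral_Icc_eq_integral_Ioc]
    congr 2
    ext s; simp only [mem_Ioc, mem_inter_iff, mem_Ici, mem_Icc] at ht ⊢; grind

lemma BoundedMeasurable.integral_triangle_swap {H : ℝ × ℝ → V} (hH : BoundedMeasurable H)
    {a b : ℝ} (hab : a ≤ b) :
    ∫ s in a..b, ∫ t in a..s, H (s, t) = ∫ t in a..b, ∫ s in t..b, H (s, t) :=
  SkewDirac.integral_triangle_swap (H := fun s t => H (s, t)) hab (hH.integrable _)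

/-- Integrating an exponential of rate r gains the factor 1/r; this gain makes Picard iteration
contract in a weighted sup norm. -/
lemma norm_setIntegral_le_exp {h : ℝ → V} {a b c D r : ℝ} (hr : 0 < r) (hD : 0 ≤ D)
    (hh : ∀ s ∈ Ioc a b, ‖h s‖ ≤ D * Real.exp (r * (s + c))) :
    ‖∫ s in Ioc a b, h s‖ ≤ D / r * Real.exp (r * (b + c)) := by
  rcases le_or_gt b a with hba | hab
  · rw [Ioc_eq_empty (not_lt.2 hba)]
    simp only [Measure.restrict_empty, integral_zero_measure, norm_zero]
    positivity
  have hi : IntervalIntegrable (fun s => D * Real.exp (r * (s + c))) volume a b :=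
    Continuous.intervalIntegrable (by fun_prop) _ _
  have h1 := intervalIntegral.norm_integral_le_of_norm_le hab.le (ae_of_all _ hh) hi
  rw [← intervalIntegral.integral_of_le hab.le]
  refine h1.trans ?_
  have hd : ∀ s ∈ uIcc a b, HasDerivAt (fun s => D / r * Real.exp (r * (s + c)))
      (D * Real.exp (r * (s + c))) s := fun s _ => by
    have h2 : HasDerivAt (fun s => r * (s + c)) (r * 1) s :=
      ((hasDerivAt_id' s).add_const c).const_mul r
    have h3 := h2.exp.const_mul (D / r)
    have e : D / r * (Real.exp (r * (s + c)) * (r * 1)) = D * Real.exp (r * (s + c)) := by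
      have := hr.ne'
      field_simp
    rwa [e] at h3
  rw [intervalIntegral.integral_eq_sub_of_hasDerivAt hd hi]
  have : 0 ≤ D / r * Real.exp (r * (a + c)) := by positivity
  linarith

end BoundedMeasurable

/-! ### Volterra equations along paths. -/

/-- Linear Volterra equations with finitely many integral terms along paths on which the height `h`
decreases at unit speed have a measurable solution of exponential growth. -/
theorem exists_volterra_solution {ι V J : Type*} [MeasurableSpace ι] [NormedAddCommGroup V]
    [NormedSpace ℝ V] [CompleteSpace V] [Fintype J] (h : ι → ℝ) (hh : ∀ p, 0 ≤ h p)
    {a b : J → ι → ℝ} (ha : ∀ j, Measurable (a j)) (hb : ∀ j, Measurable (b j))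
    {φ : J → ι × ℝ → ι} (hφ : ∀ j, Measurable (φ j))
    (hφh : ∀ j p, ∀ s ∈ Ioc (a j p) (b j p), h (φ j (p, s)) ≤ h p - (b j p - s))
    {C : J → ι × ℝ → V →L[ℝ] V} (hC : ∀ j, BoundedMeasurable (C j))
    {g : ι → V} (hg : BoundedMeasurable g) :
    ∃ f : ι → V, StronglyMeasurable f ∧
      (∃ A r : ℝ, 0 ≤ A ∧ 0 < r ∧ ∀ p, ‖f p‖ ≤ A * Real.exp (r * h p)) ∧
      ∀ p, f p = g p + ∑ j, ∫ s in Ioc (a j p) (b j p), C j (p, s) (f (φ j (p, s))) := by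
  choose K hK0 hK using fun j => (hC j).bdd
  obtain ⟨G, hG0, hG⟩ := hg.bdd
  -- In the norm weighted by exp(r h) the integral operator has norm at most (∑ K j)/r, which this r
  -- makes at most 1/2. The +1 keeps r positive when all K j vanish.
  set r : ℝ := 2 * (∑ j, K j) + 1 with hr_def
  have hKs : 0 ≤ ∑ j, K j := Finset.sum_nonneg fun j _ => hK0 j
  have hr : 0 < r := by positivity
  let w : ι → ℝ := fun p => Real.exp (r * h p)
  let L : (ι → V) → ι → V := fun f p =>
    ∑ j, ∫ s in Ioc (a j p) (b j p), C j (p, s) (f (φ j (p, s)))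
  have hpt : ∀ (d : ι → V) (A : ℝ), 0 ≤ A → (∀ p, ‖d p‖ ≤ A * w p) → ∀ j p,
      ∀ s ∈ Ioc (a j p) (b j p), ‖C j (p, s) (d (φ j (p, s)))‖ ≤
        K j * A * Real.exp (r * (s + (h p - b j p))) := by
    intro d A hA hd j p s hs
    refine ((C j (p, s)).le_opNorm _).trans ?_
    rw [mul_assoc]
    refine mul_le_mul (hK j _) ((hd _).trans ?_) (norm_nonneg _) (hK0 j)
    refine mul_le_mul_of_nonneg_left (Real.exp_le_exp.2 ?_) hA
    refine mul_le_mul_of_nonneg_left ?_ hr.le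
    linarith [hφh j p s hs]
  have hLbound : ∀ (d : ι → V) (A : ℝ), 0 ≤ A → (∀ p, ‖d p‖ ≤ A * w p) →
      ∀ p, ‖L d p‖ ≤ A / 2 * w p := by
    intro d A hA hd p
    have h1 : ∀ j ∈ Finset.univ, ‖∫ s in Ioc (a j p) (b j p), C j (p, s) (d (φ j (p, s)))‖ ≤
        K j * (A / r * w p) := fun j _ => by
      have := norm_setIntegral_le_exp hr (mul_nonneg (hK0 j) hA) (hpt d A hA hd j p)
      refine this.trans (le_of_eq ?_)
      rw [show b j p + (h p - b j p) = h p by ring]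
      simp only [w]
      ring
    refine (norm_sum_le_of_le _ h1).trans ?_
    rw [← Finset.sum_mul, ← mul_assoc]
    refine mul_le_mul_of_nonneg_right ?_ (Real.exp_pos _).le
    rw [mul_div_assoc', div_le_div_iff₀ hr two_pos]
    nlinarith
  have hsm : ∀ f : ι → V, StronglyMeasurable f → ∀ j, StronglyMeasurable
      fun q : ι × ℝ => C j q (f (φ j q)) := fun f hf j =>
    isBoundedBilinearMap_apply.continuous.comp_stronglyMeasurable
      ((hC j).sm.prodMk (hf.comp_measurable (hφ j)))
  have hLsm : ∀ f : ι → V, StronglyMeasurable f → StronglyMeasurable (L f) := fun f hf =>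
    Finset.stronglyMeasurable_fun_sum _ fun j _ =>
      stronglyMeasurable_setIntegral_Ioc (hsm f hf j) (ha j) (hb j)
  have hint : ∀ f : ι → V, StronglyMeasurable f → (∃ A, 0 ≤ A ∧ ∀ p, ‖f p‖ ≤ A * w p) →
      ∀ j p, IntegrableOn (fun s => C j (p, s) (f (φ j (p, s)))) (Ioc (a j p) (b j p)) := by
    rintro f hf ⟨A, hA, hfA⟩ j p
    refine Measure.integrableOn_of_bounded (M := K j * A * Real.exp (r * h p))
      (by simp) ((hsm f hf j).comp_measurable measurable_prodMk_left).aestronglyMeasurable ?_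
    refine (ae_restrict_iff' measurableSet_Ioc).2 (ae_of_all _ fun s hs => ?_)
    refine (hpt f A hA hfA j p s hs).trans ?_
    refine mul_le_mul_of_nonneg_left (Real.exp_le_exp.2 ?_) (mul_nonneg (hK0 j) hA)
    refine mul_le_mul_of_nonneg_left ?_ hr.le
    linarith [hs.2]
  have hLsub : ∀ f₁ f₂ : ι → V, StronglyMeasurable f₁ → (∃ A, 0 ≤ A ∧ ∀ p, ‖f₁ p‖ ≤ A * w p) →
      StronglyMeasurable f₂ → (∃ A, 0 ≤ A ∧ ∀ p, ‖f₂ p‖ ≤ A * w p) →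
      ∀ p, L (fun p => f₁ p - f₂ p) p = L f₁ p - L f₂ p := by
    intro f₁ f₂ h1 h1' h2 h2' p
    simp only [L, map_sub, ← Finset.sum_sub_distrib]
    exact Finset.sum_congr rfl fun j _ => integral_sub (hint f₁ h1 h1' j p) (hint f₂ h2 h2' j p)
  have hw : ∀ p, 1 ≤ w p := fun p => Real.one_le_exp (mul_nonneg hr.le (hh p))
  -- The Picard iterates converge at every point, so the limit is measurable and solves the equation
  -- everywhere.
  let S : ℕ → ι → V := fun n => Nat.rec 0 (fun _ f p => g p + L f p) n
  have hS0 : S 0 = 0 := rfl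
  have hSs : ∀ n p, S (n + 1) p = g p + L (S n) p := fun n p => rfl
  have hSsm : ∀ n, StronglyMeasurable (S n) := by
    intro n
    induction n with
    | zero => exact stronglyMeasurable_const
    | succ n ih => exact hg.sm.add (hLsm _ ih)
  have hSb : ∀ n, ∃ A, 0 ≤ A ∧ ∀ p, ‖S n p‖ ≤ A * w p := by
    intro n
    induction n with
    | zero => exact ⟨0, le_rfl, fun p => by simp [hS0]⟩
    | succ n ih =>
      obtain ⟨A, hA, hAp⟩ := ih
      refine ⟨G + A / 2, by positivity, fun p => ?_⟩
      rw [hSs, add_mul]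
      refine (norm_add_le _ _).trans (add_le_add ((hG p).trans ?_) (hLbound _ A hA hAp p))
      exact le_mul_of_one_le_right hG0 (hw p)
  have hSd : ∀ n p, ‖S n p - S (n + 1) p‖ ≤ G * (1 / 2) ^ n * w p := by
    intro n
    induction n with
    | zero =>
      intro p
      have : L 0 p = 0 := by simp [L]
      rw [hSs, hS0, this]
      simpa using (hG p).trans (le_mul_of_one_le_right hG0 (hw p))
    | succ n ih =>
      intro p
      rw [hSs n, hSs (n + 1), add_sub_add_left_eq_sub,
        ← hLsub _ _ (hSsm n) (hSb n) (hSsm (n + 1)) (hSb (n + 1))]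
      refine (hLbound _ _ (by positivity) ih p).trans (le_of_eq ?_)
      ring
  have hcauchy : ∀ p n, dist (S n p) (S (n + 1) p) ≤ G * w p * (1 / 2) ^ n := fun p n => by
    rw [dist_eq_norm]
    exact (hSd n p).trans (le_of_eq (by ring))
  choose f hf using fun p => cauchySeq_tendsto_of_complete
    (cauchySeq_of_le_geometric (1 / 2) (G * w p) (by norm_num) (hcauchy p))
  have hfd : ∀ n p, ‖S n p - f p‖ ≤ 2 * G * (1 / 2) ^ n * w p := fun n p => by
    have := dist_le_of_le_geometric_of_tendsto (1 / 2) (G * w p) (by norm_num) (hcauchy p)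
      (hf p) n
    rw [dist_eq_norm] at this
    refine this.trans (le_of_eq ?_)
    ring
  have hfsm : StronglyMeasurable f :=
    stronglyMeasurable_of_tendsto Filter.atTop hSsm (tendsto_pi_nhds.2 hf)
  have hfb : ∀ p, ‖f p‖ ≤ 2 * G * w p := fun p => by
    have := hfd 0 p
    simpa [hS0] using this
  refine ⟨f, hfsm, ⟨2 * G, r, by positivity, hr, hfb⟩, fun p => ?_⟩
  refine tendsto_nhds_unique ((Filter.tendsto_add_atTop_iff_nat 1).2 (hf p)) ?_
  rw [tendsto_iff_norm_sub_tendsto_zero]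
  have hlim : Filter.Tendsto (fun n : ℕ => G * w p * (1 / 2 : ℝ) ^ n) Filter.atTop (nhds 0) := by
    simpa using (tendsto_pow_atTop_nhds_zero_of_lt_one (r := (1 / 2 : ℝ)) (by norm_num)
      (by norm_num)).const_mul (G * w p)
  refine squeeze_zero (fun n => norm_nonneg _) (fun n => ?_) hlim
  change ‖S (n + 1) p - (g p + L f p)‖ ≤ _
  rw [hSs, add_sub_add_left_eq_sub, ← hLsub _ _ (hSsm n) (hSb n) hfsm
    ⟨2 * G, by positivity, hfb⟩]
  refine (hLbound _ _ (by positivity) (hfd n) p).trans (le_of_eq ?_)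
  ring

/-! ### Primitives of bounded measurable functions and the product rule. -/

section Primitives

variable {V W U : Type*} [NormedAddCommGroup V] [NormedAddCommGroup W] [NormedAddCommGroup U]
  [NormedSpace ℝ V] [NormedSpace ℝ W] [NormedSpace ℝ U]

lemma BoundedMeasurable.ae_hasDerivAt_integral [CompleteSpace V] {f : ℝ → V}
    (hf : BoundedMeasurable f) :
    ∀ᵐ x, ∀ c, HasDerivAt (fun x => ∫ t in c..x, f t) (f x) x :=
  _root_.LocallyIntegrable.ae_hasDerivAt_integral fun x =>
    ⟨Icc (x - 1) (x + 1), Icc_mem_nhds (by linarith) (by linarith), hf.integrable _⟩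

lemma BoundedMeasurable.exists_lipschitzWith_integral {f : ℝ → V} (hf : BoundedMeasurable f)
    (c : ℝ) : ∃ K, LipschitzWith K fun x => ∫ t in c..x, f t := by
  obtain ⟨C, hC0, hC⟩ := hf.bdd
  refine ⟨⟨C, hC0⟩, LipschitzWith.of_dist_le_mul fun x y => ?_⟩
  rw [dist_eq_norm, intervalIntegral.integral_interval_sub_left (hf.intervalIntegrable _ _)
    (hf.intervalIntegrable _ _), Real.dist_eq]
  exact intervalIntegral.norm_integral_le_of_norm_le_const fun t _ => hC t

lemma BoundedMeasurable.continuous_integral {f : ℝ → V} (hf : BoundedMeasurable f)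
    (c : ℝ) : Continuous fun x => ∫ t in c..x, f t :=
  let ⟨_, hK⟩ := hf.exists_lipschitzWith_integral c
  hK.continuous

lemma exists_lipschitzOnWith_bilin (B : U →L[ℝ] V →L[ℝ] W) {u : ℝ → U} {v : ℝ → V} {s : Set ℝ}
    {K L : NNReal} (hu : LipschitzOnWith K u s) (hv : LipschitzOnWith L v s) {C D : ℝ}
    (hC : ∀ x ∈ s, ‖u x‖ ≤ C) (hD : ∀ x ∈ s, ‖v x‖ ≤ D) :
    ∃ M, LipschitzOnWith M (fun x => B (u x) (v x)) s := by
  refine ⟨Real.toNNReal (‖B‖ * (K * |D| + |C| * L)), LipschitzOnWith.of_dist_le_mul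
    fun x hx y hy => ?_⟩
  rw [Real.coe_toNNReal _ (by positivity), dist_eq_norm]
  have e : B (u x) (v x) - B (u y) (v y) = B (u x - u y) (v x) + B (u y) (v x - v y) := by
    simp
  rw [e]
  have h1 : ‖u x - u y‖ ≤ K * dist x y := by simpa [dist_eq_norm] using hu.dist_le_mul x hx y hy
  have h2 : ‖v x - v y‖ ≤ L * dist x y := by simpa [dist_eq_norm] using hv.dist_le_mul x hx y hy
  have hC' := (hC y hy).trans (le_abs_self C)
  have hD' := (hD x hx).trans (le_abs_self D)
  calc _ ≤ ‖B‖ * ‖u x - u y‖ * ‖v x‖ + ‖B‖ * ‖u y‖ * ‖v x - v y‖ :=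
        norm_add_le_of_le (B.le_opNorm₂ _ _) (B.le_opNorm₂ _ _)
    _ ≤ ‖B‖ * (K * dist x y) * |D| + ‖B‖ * |C| * (L * dist x y) := by gcongr
    _ = _ := by ring

/-- The product rule for primitives of bounded measurable functions, in integrated form. -/
lemma bilin_eq_add_integral [CompleteSpace U] [CompleteSpace V] [CompleteSpace W]
    (B : U →L[ℝ] V →L[ℝ] W) {u α : ℝ → U} {v β : ℝ → V} {a b : ℝ} (hab : a ≤ b)
    (hα : BoundedMeasurable α) (hβ : BoundedMeasurable β)
    (hu : ∀ x ∈ Icc a b, u x = u a + ∫ s in a..x, α s)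
    (hv : ∀ x ∈ Icc a b, v x = v a + ∫ s in a..x, β s) :
    B (u b) (v b) = B (u a) (v a) + ∫ s in a..b, (B (α s) (v s) + B (u s) (β s)) := by
  -- Clamping to [a, b] makes the primitives globally bounded without changing them on the interval.
  set p : ℝ → ℝ := fun x => max a (min x b) with hp
  have hpm : ∀ x, p x ∈ Icc a b := fun x => ⟨le_max_left _ _, max_le hab (min_le_right _ _)⟩
  have hpe : ∀ x ∈ Icc a b, p x = x := fun x hx => by
    simp only [hp, min_eq_left hx.2, max_eq_right hx.1]
  have hpc : Continuous p := by fun_prop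
  set U' : ℝ → U := fun x => u a + ∫ s in a..x, α s
  set V' : ℝ → V := fun x => v a + ∫ s in a..x, β s
  obtain ⟨K, hK⟩ := hα.exists_lipschitzWith_integral a
  obtain ⟨L, hL⟩ := hβ.exists_lipschitzWith_integral a
  have hU : LipschitzWith K U' := by
    simpa using (LipschitzWith.const (u a)).add hK
  have hV : LipschitzWith L V' := by
    simpa using (LipschitzWith.const (v a)).add hL
  obtain ⟨C, hC⟩ := isCompact_Icc.exists_bound_of_continuousOn
    (hU.continuous.continuousOn (s := Icc a b))
  obtain ⟨D, hD⟩ := isCompact_Icc.exists_bound_of_continuousOn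
    (hV.continuous.continuousOn (s := Icc a b))
  have hUp : BoundedMeasurable fun x => U' (p x) :=
    ⟨(hU.continuous.comp hpc).stronglyMeasurable, |C|, abs_nonneg _,
      fun x => (hC _ (hpm x)).trans (le_abs_self _)⟩
  have hVp : BoundedMeasurable fun x => V' (p x) :=
    ⟨(hV.continuous.comp hpc).stronglyMeasurable, |D|, abs_nonneg _,
      fun x => (hD _ (hpm x)).trans (le_abs_self _)⟩
  set F : ℝ → W := fun s => B (α s) (V' (p s)) + B (U' (p s)) (β s) with hF_def
  have hF : BoundedMeasurable F := (hα.bilin B hVp).add (hUp.bilin B hβ)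
  obtain ⟨M, hM⟩ := exists_lipschitzOnWith_bilin B (hU.lipschitzOnWith (s := uIcc a b))
    (hV.lipschitzOnWith (s := uIcc a b)) (C := C) (D := D)
    (by rwa [uIcc_of_le hab]) (by rwa [uIcc_of_le hab])
  obtain ⟨N, hN⟩ := hF.exists_lipschitzWith_integral a
  -- The difference of the two sides is absolutely continuous with derivative zero almost
  -- everywhere, hence constant.
  have hac := hM.absolutelyContinuousOnInterval.sub
    (hN.lipschitzOnWith (s := uIcc a b)).absolutelyContinuousOnInterval
  have hder : ∀ᵐ x, x ∈ uIcc a b →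
      HasDerivAt ((fun x => B (U' x) (V' x)) - fun x => ∫ t in a..x, F t) 0 x := by
    filter_upwards [hα.ae_hasDerivAt_integral,
      hβ.ae_hasDerivAt_integral,
      hF.ae_hasDerivAt_integral] with x h1 h2 h3 hx
    rw [uIcc_of_le hab] at hx
    have h := (B.hasDerivAt_of_bilinear (u := U') (v := V')
      (fun _ => (h1 a).const_add (u a)) (fun _ => (h2 a).const_add (v a))).sub (h3 a)
    have e : B (U' x) (β x) + B (α x) (V' x) - F x = 0 := by
      simp only [hF_def, hpe x hx]
      abel
    rwa [e] at h
  obtain ⟨c, hc⟩ := hac.const_of_ae_hasDerivAt_zero hder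
  have ha := hc a left_mem_uIcc
  have hb := hc b right_mem_uIcc
  have hua : U' a = u a := by simp [U']
  have hva : V' a = v a := by simp [V']
  simp only [Pi.sub_apply, intervalIntegral.integral_same, sub_zero, hua, hva] at ha hb
  rw [hu b ⟨hab, le_rfl⟩, hv b ⟨hab, le_rfl⟩]
  change B (U' b) (V' b) = _
  rw [ha, ← hb]
  have : ∫ s in a..b, (B (α s) (v s) + B (u s) (β s)) = ∫ s in a..b, F s := by
    refine intervalIntegral.integral_congr fun s hs => ?_
    rw [uIcc_of_le hab] at hs
    simp only [F, hpe s hs, hu s hs, hv s hs, U', V']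
  rw [this]
  abel

/-- A boundedly differentiable function is the primitive of a bounded measurable function. -/
lemma BoundedlyDifferentiableOn.exists_primitive [FiniteDimensional ℝ V] {l : ℝ} (hl : 0 ≤ l)
    {f : ℝ → V} (hf : BoundedlyDifferentiableOn l f) :
    ∃ g : ℝ → V, BoundedMeasurable g ∧ (∀ x ∈ Icc 0 l, f x = f 0 + ∫ t in (0 : ℝ)..x, g t) ∧
      ∀ᵐ x ∂vol l, HasDerivAt f (g x) x := by
  have : CompleteSpace V := FiniteDimensional.complete ℝ V
  obtain ⟨hac, C, hC⟩ := hf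
  have hm : StronglyMeasurable (deriv f) := stronglyMeasurable_deriv f
  -- The derivative is bounded only almost everywhere on (0, l]; cutting it off where it exceeds C
  -- gives a bound at every point and alters it only on a null set there.
  set s : Set ℝ := {x | ‖deriv f x‖ ≤ C}
  have hs : MeasurableSet s := hm.norm.measurable measurableSet_Iic
  have hg : BoundedMeasurable (s.indicator (deriv f)) := by
    refine ⟨hm.indicator hs, |C|, abs_nonneg _, fun x => ?_⟩
    by_cases hx : x ∈ s
    · rw [indicator_of_mem hx]
      exact le_trans hx (le_abs_self _)
    · simp [indicator_of_notMem hx]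
  have hd : ∀ᵐ x, x ∈ Ioc 0 l → HasDerivAt f (s.indicator (deriv f) x) x := by
    filter_upwards [hac.boundedVariationOn.ae_differentiableAt_of_mem_uIcc,
      (ae_restrict_iff' measurableSet_Ioc).1 hC] with x h1 h2 hx
    rw [indicator_of_mem (show x ∈ s from h2 hx)]
    exact (h1 (Icc_subset_uIcc (Ioc_subset_Icc_self hx))).hasDerivAt
  refine ⟨_, hg, ?_, (ae_restrict_iff' measurableSet_Ioc).2 hd⟩
  obtain ⟨K, hK⟩ := hg.exists_lipschitzWith_integral 0
  have hac' := hac.sub (hK.lipschitzOnWith (s := uIcc 0 l)).absolutelyContinuousOnInterval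
  have h0 : ∀ᵐ x : ℝ, x ≠ 0 := by simp [ae_iff, measure_singleton]
  obtain ⟨c, hc⟩ := hac'.const_of_ae_hasDerivAt_zero (by
    filter_upwards [hd, hg.ae_hasDerivAt_integral, h0] with x h1 h2 h3 hx
    rw [uIcc_of_le hl] at hx
    simpa using (h1 ⟨lt_of_le_of_ne hx.1 h3.symm, hx.2⟩).sub (h2 0))
  intro x hx
  have e0 := hc 0 left_mem_uIcc
  have ex := hc x (Icc_subset_uIcc hx)
  simp only [Pi.sub_apply, intervalIntegral.integral_same, sub_zero] at e0 ex
  rw [e0, ← ex]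
  abel

lemma boundedlyDifferentiableOn_of_lipschitzOnWith {l : ℝ} (hl : 0 ≤ l) {f : ℝ → V}
    {K : NNReal} (hf : LipschitzOnWith K f (Icc 0 l)) : BoundedlyDifferentiableOn l f := by
  refine ⟨LipschitzOnWith.absolutelyContinuousOnInterval (K := K) (by rwa [uIcc_of_le hl]), K, ?_⟩
  -- At l the two-sided derivative depends on values of f outside the interval.
  have h0 : ∀ᵐ x : ℝ, x ≠ l := by simp [ae_iff, measure_singleton]
  refine (ae_restrict_iff' measurableSet_Ioc).2 ?_
  filter_upwards [h0] with x hx hxl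
  exact norm_deriv_le_of_lipschitzOn
    (Icc_mem_nhds hxl.1 (lt_of_le_of_ne hxl.2 hx)) hf

end Primitives

/-! ### Matrix operations as continuous real-linear maps. -/

/-- Continuous bilinear maps, with the topologies given by the norms. -/
abbrev BilinearCLM (U V W : Type*) [NormedAddCommGroup U] [NormedAddCommGroup V]
    [NormedAddCommGroup W] [NormedSpace ℝ U] [NormedSpace ℝ V] [NormedSpace ℝ W] : Type _ :=
  U →L[ℝ] V →L[ℝ] W

/-- Continuous linear maps, with the topologies given by the norms. -/
abbrev LinearCLM (U V : Type*) [NormedAddCommGroup U] [NormedAddCommGroup V]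
    [NormedSpace ℝ U] [NormedSpace ℝ V] : Type _ :=
  U →L[ℝ] V

section MatrixMaps

variable {a b c : Type*} [Fintype a] [Fintype b] [Fintype c] [DecidableEq b]
  [DecidableEq c]

/-- Matrix multiplication as a continuous bilinear map. -/
noncomputable def mulL : BilinearCLM (Matrix a b ℂ) (Matrix b c ℂ) (Matrix a c ℂ) :=
  LinearMap.mkContinuous₂
    (LinearMap.mk₂ ℝ (fun M N => M * N) Matrix.add_mul (fun r M N => Matrix.smul_mul r M N)
      Matrix.mul_add (fun r M N => Matrix.mul_smul M r N))
    1 fun M N => by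
      rw [one_mul]
      exact Matrix.l2_opNorm_mul M N

/-- The action of matrices on vectors as a continuous bilinear map. -/
noncomputable def mulVecL :
    BilinearCLM (Matrix a b ℂ) (EuclideanSpace ℂ b) (EuclideanSpace ℂ a) :=
  LinearMap.mkContinuous₂
    (LinearMap.mk₂ ℝ (fun M v => WithLp.toLp 2 (M *ᵥ v.ofLp))
      (fun M N v => by simp [Matrix.add_mulVec])
      (fun r M v => by simp [Matrix.smul_mulVec])
      (fun M v w => by simp [Matrix.mulVec_add])
      (fun r M v => by simp [Matrix.mulVec_smul]))
    1 fun M v => by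
      rw [one_mul]
      exact Matrix.l2_opNorm_mulVec M v

lemma mulVecL_apply (M : Matrix a b ℂ) (v : EuclideanSpace ℂ b) :
    mulVecL M v = WithLp.toLp 2 (M *ᵥ v.ofLp) := rfl

@[simp] lemma mulVecL_mul (M : Matrix a b ℂ) (N : Matrix b c ℂ) (v : EuclideanSpace ℂ c) :
    mulVecL (M * N) v = mulVecL M (mulVecL N v) := by
  simp [mulVecL_apply, Matrix.mulVec_mulVec]

@[simp] lemma mulVecL_one (v : EuclideanSpace ℂ b) :
    mulVecL (1 : Matrix b b ℂ) v = v := by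
  simp [mulVecL_apply]

lemma mulVecL_smul (z : ℂ) (M : Matrix a b ℂ) (v : EuclideanSpace ℂ b) :
    mulVecL (z • M) v = z • mulVecL M v := by
  simp [mulVecL_apply, Matrix.smul_mulVec]

lemma mulVecL_smul_right (z : ℂ) (M : Matrix a b ℂ) (v : EuclideanSpace ℂ b) :
    mulVecL M (z • v) = z • mulVecL M v := by
  simp [mulVecL_apply, Matrix.mulVec_smul]

/-- Conjugate transposition as a continuous linear map. -/
noncomputable def conjTransposeL [DecidableEq a] : LinearCLM (Matrix a b ℂ) (Matrix b a ℂ) :=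
  LinearMap.mkContinuous
    { toFun := fun M => Mᴴ
      map_add' := Matrix.conjTranspose_add
      map_smul' := fun r M => by simp }
    1 fun M => by
      rw [one_mul]
      exact (Matrix.l2_opNorm_conjTranspose M).le

instance : CompleteSpace (Matrix a b ℂ) := FiniteDimensional.complete ℂ _

lemma BoundedMeasurable.matrix_mul {α : Type*} [MeasurableSpace α] {f : α → Matrix a b ℂ}
    {g : α → Matrix b c ℂ} (hf : BoundedMeasurable f) (hg : BoundedMeasurable g) :
    BoundedMeasurable fun x => f x * g x :=
  hf.bilin mulL hg

lemma BoundedMeasurable.conjTranspose [DecidableEq a] {α : Type*} [MeasurableSpace α]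
    {f : α → Matrix a b ℂ}
    (hf : BoundedMeasurable f) : BoundedMeasurable fun x => (f x)ᴴ :=
  hf.clm conjTransposeL

lemma BoundedMeasurable.smul {α : Type*} [MeasurableSpace α] {f : α → Matrix a b ℂ}
    (z : ℂ) (hf : BoundedMeasurable f) : BoundedMeasurable fun x => z • f x := by
  obtain ⟨C, hC0, hC⟩ := hf.bdd
  exact ⟨hf.sm.const_smul z, ‖z‖ * C, by positivity,
    fun x => by rw [norm_smul]; gcongr; exact hC x⟩

end MatrixMaps

lemma BoundedMeasurable.integrable_bilin {α U V W : Type*} [MeasurableSpace α]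
    [NormedAddCommGroup U] [NormedAddCommGroup V] [NormedAddCommGroup W]
    [NormedSpace ℝ V] [NormedSpace ℝ W] [NormedSpace ℝ U] (B : U →L[ℝ] V →L[ℝ] W) {μ : Measure α}
    {K : α → U} {f : α → V} (hK : BoundedMeasurable K) (hf : Integrable f μ) :
    Integrable (fun x => B (K x) (f x)) μ := by
  obtain ⟨C, hC0, hC⟩ := hK.bdd
  refine (hf.norm.const_mul (‖B‖ * C)).mono'
    (B.continuous₂.comp_aestronglyMeasurable
      (hK.sm.aestronglyMeasurable.prodMk hf.aestronglyMeasurable)) (ae_of_all _ fun x => ?_)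
  refine (B.le_opNorm₂ _ _).trans ?_
  gcongr
  exact hC x

/-! ### Operators with diagonal part and Volterra kernel. -/

section Triangular

variable {l : ℝ} {n : ℕ}

lemma integral_norm_coeFn_le (f : L2 l n) :
    ∫ t in Ioc 0 l, ‖f t‖ ≤ ‖f‖ * ((vol l univ) ^ (1 / 2 : ℝ)).toReal := by
  rw [integral_norm_eq_lintegral_enorm (integrableOn_coeFn f).aestronglyMeasurable,
    ← eLpNorm_one_eq_lintegral_enorm, Lp.norm_def, ← ENNReal.toReal_mul]
  have h2 := eLpNorm_le_eLpNorm_mul_rpow_measure_univ (μ := vol l) (p := 1) (q := 2)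
    (by norm_num) (Lp.memLp f).1
  have e : (1 / (1 : ℝ≥0∞).toReal - 1 / (2 : ℝ≥0∞).toReal : ℝ) = 1 / 2 := by norm_num
  rw [e] at h2
  refine ENNReal.toReal_mono ?_ h2
  exact ENNReal.mul_ne_top (Lp.eLpNorm_ne_top f)
    (ENNReal.rpow_ne_top_of_nonneg (by norm_num) (measure_ne_top _ _))

lemma exists_clm_of_eLpNorm_le {m : ℕ} (Φ : L2 l n → ℝ → EuclideanSpace ℂ (Fin m))
    (hm : ∀ f, AEStronglyMeasurable (Φ f) (vol l))
    (hadd : ∀ f g, Φ (f + g) =ᵐ[vol l] Φ f + Φ g)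
    (hsmul : ∀ (c : ℂ) f, Φ (c • f) =ᵐ[vol l] c • Φ f) {C : ℝ} (hC : 0 ≤ C)
    (hΦ : ∀ f, eLpNorm (Φ f) 2 (vol l) ≤ ENNReal.ofReal (C * ‖f‖)) :
    ∃ T : L2 l n →L[ℂ] L2 l m, ∀ f, T f =ᵐ[vol l] Φ f := by
  have hL : ∀ f, MemLp (Φ f) 2 (vol l) := fun f =>
    ⟨hm f, (hΦ f).trans_lt ENNReal.ofReal_lt_top⟩
  refine ⟨LinearMap.mkContinuous
    { toFun := fun f => (hL f).toLp
      map_add' := fun f g => by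
        rw [← MemLp.toLp_add]
        exact MemLp.toLp_congr _ _ (hadd f g)
      map_smul' := fun c f => by
        rw [RingHom.id_apply, ← MemLp.toLp_const_smul]
        exact MemLp.toLp_congr _ _ (hsmul c f) } C fun f => ?_, fun f => (hL f).coeFn_toLp⟩
  change ‖(hL f).toLp‖ ≤ _
  rw [Lp.norm_toLp]
  exact ENNReal.toReal_le_of_le_ofReal (by positivity) (hΦ f)

/-- `T` acts as `(T f)(x) = ρ(x) f(x) + ∫₀ˣ k(x, t) f(t) dt`. -/
def HasKernel (T : L2 l n →L[ℂ] L2 l n) (ρ : ℝ → Matrix (Fin n) (Fin n) ℂ)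
    (k : ℝ × ℝ → Matrix (Fin n) (Fin n) ℂ) : Prop :=
  ∀ f : L2 l n, T f =ᵐ[vol l] fun x =>
    mulVecL (ρ x) (f x) + ∫ t in (0 : ℝ)..x, mulVecL (k (x, t)) (f t)

lemma ae_vol_of_forall {p : ℝ → Prop} (h : ∀ x ∈ Ioc 0 l, p x) : ∀ᵐ x ∂vol l, p x :=
  (ae_restrict_iff' measurableSet_Ioc).2 (ae_of_all _ h)

lemma ae_vol_mem : ∀ᵐ x ∂vol l, x ∈ Ioc 0 l := ae_restrict_mem measurableSet_Ioc

lemma integral_congr_ae_vol {V : Type*} [NormedAddCommGroup V] [NormedSpace ℝ V] {f g : ℝ → V}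
    (h : f =ᵐ[vol l] g) {x : ℝ} (hx : x ∈ Icc 0 l) :
    ∫ t in (0 : ℝ)..x, f t = ∫ t in (0 : ℝ)..x, g t := by
  rw [intervalIntegral.integral_of_le hx.1, intervalIntegral.integral_of_le hx.1]
  exact integral_congr_ae (ae_restrict_of_ae_restrict_of_subset (Ioc_subset_Ioc_right hx.2) h)

lemma intervalIntegrable_of_integrable_vol {V : Type*} [NormedAddCommGroup V] {f : ℝ → V}
    (hf : Integrable f (vol l)) {x : ℝ} (hx : x ∈ Icc 0 l) :
    IntervalIntegrable f volume 0 x :=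
  (intervalIntegrable_iff_integrableOn_Ioc_of_le hx.1).2
    (IntegrableOn.mono_set hf (Ioc_subset_Ioc_right hx.2))

variable {ρ σ : ℝ → Matrix (Fin n) (Fin n) ℂ} {k j c : ℝ × ℝ → Matrix (Fin n) (Fin n) ℂ}

lemma integrable_mulVecL {K : ℝ → Matrix (Fin n) (Fin n) ℂ} (hK : BoundedMeasurable K)
    {f : ℝ → EuclideanSpace ℂ (Fin n)} {μ : Measure ℝ} (hf : Integrable f μ) :
    Integrable (fun t => mulVecL (K t) (f t)) μ :=
  BoundedMeasurable.integrable_bilin (K := K) (f := f) mulVecL hK hf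

lemma intervalIntegrable_mulVecL {K : ℝ → Matrix (Fin n) (Fin n) ℂ} (hK : BoundedMeasurable K)
    (f : L2 l n) {x : ℝ} (hx : x ∈ Icc 0 l) :
    IntervalIntegrable (fun t => mulVecL (K t) (f t)) volume 0 x :=
  intervalIntegrable_of_integrable_vol (f := fun t => mulVecL (K t) (f t))
    (integrable_mulVecL hK (integrableOn_coeFn f)) hx

lemma intervalIntegrable_kernel (hk : BoundedMeasurable k) (f : L2 l n) {x : ℝ}
    (hx : x ∈ Icc 0 l) (y : ℝ) :
    IntervalIntegrable (fun t => mulVecL (k (y, t)) (f t)) volume 0 x :=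
  intervalIntegrable_mulVecL (K := fun t => k (y, t)) (hk.comp measurable_prodMk_left) f hx

/-- The two parts are bounded for different reasons: multiplication by ρ pointwise, and the Volterra
part because it maps L² into L^∞ on an interval of finite length. -/
theorem exists_hasKernel (l : ℝ) (hρ : BoundedMeasurable ρ) (hk : BoundedMeasurable k) :
    ∃ T : L2 l n →L[ℂ] L2 l n, HasKernel T ρ k := by
  obtain ⟨C, hC0, hC⟩ := hρ.bdd
  obtain ⟨D, hD0, hD⟩ := hk.bdd
  obtain ⟨M, hM⟩ : ∃ M : L2 l n →L[ℂ] L2 l n, ∀ f, M f =ᵐ[vol l] fun x =>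
      mulVecL (ρ x) (f x) := by
    refine exists_clm_of_eLpNorm_le (C := C) (fun f x => mulVecL (ρ x) (f x)) ?_ ?_ ?_ hC0 ?_
    · exact fun f => ((mulVecL (a := Fin n) (b := Fin n)).continuous₂.comp_stronglyMeasurable
        (hρ.sm.prodMk (Lp.stronglyMeasurable f))).aestronglyMeasurable
    · intro f g
      filter_upwards [Lp.coeFn_add f g] with x hx
      rw [hx, Pi.add_apply, Pi.add_apply, map_add]
    · intro c f
      filter_upwards [Lp.coeFn_smul c f] with x hx
      rw [hx, Pi.smul_apply, Pi.smul_apply, mulVecL_smul_right]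
    · intro f
      rw [ENNReal.ofReal_mul hC0, Lp.norm_def, ENNReal.ofReal_toReal (Lp.eLpNorm_ne_top f)]
      refine eLpNorm_le_mul_eLpNorm_of_ae_le_mul (ae_of_all _ fun x => ?_) 2
      refine (Matrix.l2_opNorm_mulVec (ρ x) (f x)).trans ?_
      gcongr
      exact hC x
  obtain ⟨N, hN⟩ : ∃ N : L2 l n →L[ℂ] L2 l n, ∀ f, N f =ᵐ[vol l] fun x =>
      ∫ t in (0 : ℝ)..x, mulVecL (k (x, t)) (f t) := by
    set κ := ((vol l univ) ^ (1 / 2 : ℝ)).toReal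
    refine exists_clm_of_eLpNorm_le (C := κ * (D * κ))
      (fun f x => ∫ t in (0 : ℝ)..x, mulVecL (k (x, t)) (f t)) ?_ ?_ ?_ (by positivity) ?_
    · intro f
      have h := stronglyMeasurable_setIntegral_Ioc
        (H := fun p : ℝ × ℝ => mulVecL (k p) (f p.2))
        ((mulVecL (a := Fin n) (b := Fin n)).continuous₂.comp_stronglyMeasurable
          (hk.sm.prodMk ((Lp.stronglyMeasurable f).comp_measurable measurable_snd)))
        (measurable_const (a := (0 : ℝ))) measurable_id
      refine h.aestronglyMeasurable.congr (ae_vol_of_forall fun x hx => ?_)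
      exact (intervalIntegral.integral_of_le hx.1.le).symm
    · intro f g
      refine ae_vol_of_forall fun x hx => ?_
      have hx' := Ioc_subset_Icc_self hx
      rw [Pi.add_apply, ← intervalIntegral.integral_add (intervalIntegrable_kernel hk f hx' x)
        (intervalIntegrable_kernel hk g hx' x)]
      refine integral_congr_ae_vol ?_ hx'
      filter_upwards [Lp.coeFn_add f g] with t ht
      rw [ht, Pi.add_apply, map_add]
    · intro c f
      refine ae_vol_of_forall fun x hx => ?_
      rw [Pi.smul_apply, ← intervalIntegral.integral_smul]
      refine integral_congr_ae_vol ?_ (Ioc_subset_Icc_self hx)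
      filter_upwards [Lp.coeFn_smul c f] with t ht
      rw [ht, Pi.smul_apply, mulVecL_smul_right]
    · intro f
      have hb : ∀ᵐ x ∂vol l, ‖∫ t in (0 : ℝ)..x, mulVecL (k (x, t)) (f t)‖ ≤
          D * κ * ‖f‖ := by
        refine ae_vol_of_forall fun x hx => ?_
        rw [intervalIntegral.integral_of_le hx.1.le]
        refine (norm_integral_le_integral_norm _).trans ?_
        calc ∫ t in Ioc 0 x, ‖mulVecL (k (x, t)) (f t)‖
            ≤ ∫ t in Ioc 0 x, D * ‖f t‖ := by
              refine integral_mono_of_nonneg (ae_of_all _ fun _ => norm_nonneg _)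
                (((integrableOn_coeFn f).mono_set (Ioc_subset_Ioc_right hx.2)).norm.const_mul D)
                (ae_of_all _ fun t => ?_)
              refine (Matrix.l2_opNorm_mulVec (k (x, t)) (f t)).trans ?_
              simp only
              gcongr
              exact hD _
          _ ≤ ∫ t in Ioc 0 l, D * ‖f t‖ :=
              setIntegral_mono_set ((integrableOn_coeFn f).norm.const_mul D)
                (ae_of_all _ fun _ => by positivity) (Ioc_subset_Ioc_right hx.2).eventuallyLE
          _ = D * ∫ t in Ioc 0 l, ‖f t‖ := integral_const_mul _ _
          _ ≤ D * (‖f‖ * κ) := by gcongr; exact integral_norm_coeFn_le f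
          _ = _ := by ring
      refine (eLpNorm_le_of_ae_bound hb).trans (le_of_eq ?_)
      have hκ : (vol l univ) ^ ((2 : ℝ≥0∞).toReal⁻¹) = ENNReal.ofReal κ := by
        rw [ENNReal.ofReal_toReal (ENNReal.rpow_ne_top_of_nonneg (by norm_num)
          (measure_ne_top _ _))]
        norm_num
      rw [hκ, ← ENNReal.ofReal_mul ENNReal.toReal_nonneg]
      congr 1
      ring
  refine ⟨M + N, fun f => ?_⟩
  filter_upwards [hM f, hN f, Lp.coeFn_add (M f) (N f)] with x h1 h2 h3
  rw [add_apply, h3, Pi.add_apply, h1, h2]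

lemma HasKernel.congr {T : L2 l n →L[ℂ] L2 l n} (hT : HasKernel T ρ k)
    (hρ : ∀ x ∈ Ioc 0 l, σ x = ρ x) (hk : ∀ x t, 0 ≤ t → t ≤ x → x ≤ l → j (x, t) = k (x, t)) :
    HasKernel T σ j := by
  intro f
  filter_upwards [hT f, ae_vol_mem] with x hx hxl
  rw [hx, hρ x hxl]
  congr 1
  refine intervalIntegral.integral_congr fun t ht => ?_
  rw [uIcc_of_le hxl.1.le] at ht
  simp only [hk x t ht.1 ht.2 hxl.2]

lemma HasKernel.unique {T S : L2 l n →L[ℂ] L2 l n} (hT : HasKernel T ρ k)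
    (hS : HasKernel S ρ k) : T = S :=
  ContinuousLinearMap.ext fun f => Lp.ext ((hT f).trans (hS f).symm)

/-- The composition of triangular operators. -/
lemma HasKernel.comp {T S : L2 l n →L[ℂ] L2 l n} (hT : HasKernel T ρ k) (hS : HasKernel S σ j)
    (hσ : BoundedMeasurable σ) (hk : BoundedMeasurable k) (hj : BoundedMeasurable j) :
    HasKernel (T * S) (fun x => ρ x * σ x) (fun p => ρ p.1 * j p + k p * σ p.2 +
      ∫ s in p.2..p.1, k (p.1, s) * j (s, p.2)) := by
  intro f
  filter_upwards [hT (S f), hS f, ae_vol_mem] with x h1 h2 hx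
  have hx' := Ioc_subset_Icc_self hx
  rw [mul_apply_eq_comp, h1, h2, map_add, add_assoc, mulVecL_mul]
  congr 1
  have hfi := integrableOn_coeFn f
  have hkx : BoundedMeasurable fun t => k (x, t) := hk.comp measurable_prodMk_left
  have hji := intervalIntegrable_kernel hj f hx' x
  have i1 : IntervalIntegrable (fun t => mulVecL (ρ x * j (x, t)) (f t)) volume 0 x :=
    intervalIntegrable_mulVecL (K := fun t => ρ x * j (x, t))
      ((BoundedMeasurable.const (ρ x)).matrix_mul (hj.comp measurable_prodMk_left)) f hx'
  have i2 : IntervalIntegrable (fun t => mulVecL (k (x, t) * σ t) (f t)) volume 0 x :=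
    intervalIntegrable_mulVecL (K := fun t => k (x, t) * σ t) (hkx.matrix_mul hσ) f hx'
  have hprod : Integrable (Function.uncurry fun s t => mulVecL (k (x, s) * j (s, t)) (f t))
      ((volume.restrict (Ioc 0 x)).prod (volume.restrict (Ioc 0 x))) := by
    have hb : BoundedMeasurable fun p : ℝ × ℝ => k (x, p.1) * j p :=
      (hkx.comp measurable_fst).matrix_mul hj
    exact BoundedMeasurable.integrable_bilin (K := fun p : ℝ × ℝ => k (x, p.1) * j p)
      (f := fun p : ℝ × ℝ => f p.2) mulVecL hb
      ((hfi.mono_set (Ioc_subset_Ioc_right hx.2)).comp_snd (volume.restrict (Ioc 0 x)))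
  have hswap := integral_triangle_swap hx.1.le hprod
  have e3 : ∀ t, ∫ s in t..x, mulVecL (k (x, s) * j (s, t)) (f t) =
      mulVecL (∫ s in t..x, k (x, s) * j (s, t)) (f t) := fun t =>
    ContinuousLinearMap.intervalIntegral_comp_comm (mulVecL.flip (f t))
      ((hkx.matrix_mul (hj.comp measurable_prodMk_right)).intervalIntegrable t x)
  have i3 : IntervalIntegrable (fun t => mulVecL (∫ s in t..x, k (x, s) * j (s, t)) (f t))
      volume 0 x := by
    rw [intervalIntegrable_iff_integrableOn_Ioc_of_le hx.1.le]
    have hS : MeasurableSet {q : ℝ × ℝ | q.2 ≤ q.1} :=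
      measurableSet_le measurable_snd measurable_fst
    have h := (hprod.indicator hS).integral_prod_right
    refine h.congr ((ae_restrict_iff' measurableSet_Ioc).2 (ae_of_all _ fun t ht => ?_))
    simp only
    rw [← e3, intervalIntegral.integral_of_le ht.2]
    have e : (fun s => {q : ℝ × ℝ | q.2 ≤ q.1}.indicator (Function.uncurry fun s t =>
          mulVecL (k (x, s) * j (s, t)) (f t)) (s, t))
        = (Ici t).indicator (fun s => mulVecL (k (x, s) * j (s, t)) (f t)) := by
      ext s; by_cases hs : t ≤ s <;> simp [Function.uncurry, hs]
    rw [e, setIntegral_indicator measurableSet_Ici, ← integral_Icc_eq_integral_Ioc]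
    congr 2
    ext s; simp only [mem_Ioc, mem_inter_iff, mem_Ici, mem_Icc] at ht ⊢; grind
  have hSf : ∫ s in (0 : ℝ)..x, mulVecL (k (x, s)) (S f s) =
      (∫ s in (0 : ℝ)..x, mulVecL (k (x, s) * σ s) (f s)) +
        ∫ s in (0 : ℝ)..x, ∫ t in (0 : ℝ)..s, mulVecL (k (x, s) * j (s, t)) (f t) := by
    -- Integrability of the inner integral comes by subtraction: almost everywhere it is
    -- k(x,s)(Sf)(s) minus the diagonal contribution, and both of these are integrable.
    have i4 : IntervalIntegrable (fun s => ∫ t in (0 : ℝ)..s, mulVecL (k (x, s) * j (s, t)) (f t))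
        volume 0 x := by
      have h := (intervalIntegrable_kernel hk (S f) hx' x).sub i2
      refine h.congr_ae ?_
      rw [uIoc_of_le hx.1.le]
      filter_upwards [ae_restrict_of_ae_restrict_of_subset (Ioc_subset_Ioc_right hx.2) (hS f),
        ae_restrict_mem measurableSet_Ioc] with s hs hs'
      rw [hs, map_add, mulVecL_mul, add_sub_cancel_left]
      rw [← ContinuousLinearMap.intervalIntegral_comp_comm (mulVecL (k (x, s)))
        (intervalIntegrable_kernel hj f ⟨hs'.1.le, hs'.2.trans hx.2⟩ s)]
      simp only [mulVecL_mul]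
    rw [← intervalIntegral.integral_add i2 i4]
    refine integral_congr_ae_vol ?_ hx'
    filter_upwards [hS f, ae_vol_mem] with s hs hs'
    rw [hs, map_add, mulVecL_mul]
    rw [← ContinuousLinearMap.intervalIntegral_comp_comm (mulVecL (k (x, s)))
      (intervalIntegrable_kernel hj f (Ioc_subset_Icc_self hs') s)]
    simp only [mulVecL_mul]
  rw [hSf, hswap, ← ContinuousLinearMap.intervalIntegral_comp_comm (mulVecL (ρ x)) hji]
  simp only [e3, map_add, add_apply]
  rw [intervalIntegral.integral_add (i1.add i2) i3, intervalIntegral.integral_add i1 i2]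
  simp only [mulVecL_mul]
  abel

lemma HasKernel.add {T S : L2 l n →L[ℂ] L2 l n} (hT : HasKernel T ρ k) (hS : HasKernel S σ j)
    (hk : BoundedMeasurable k) (hj : BoundedMeasurable j) :
    HasKernel (T + S) (fun x => ρ x + σ x) (fun p => k p + j p) := by
  intro f
  filter_upwards [hT f, hS f, Lp.coeFn_add (T f) (S f), ae_vol_mem] with x h1 h2 h3 hx
  have hx' := Ioc_subset_Icc_self hx
  rw [add_apply, h3, Pi.add_apply, h1, h2]
  simp only [map_add, add_apply]
  rw [intervalIntegral.integral_add (intervalIntegrable_kernel hk f hx' x)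
    (intervalIntegrable_kernel hj f hx' x)]
  abel

lemma HasKernel.smul {T : L2 l n →L[ℂ] L2 l n} (hT : HasKernel T ρ k) (z : ℂ) :
    HasKernel (z • T) (fun x => z • ρ x) (fun p => z • k p) := by
  intro f
  filter_upwards [hT f, Lp.coeFn_smul z (T f)] with x h1 h2
  rw [smul_apply, h2, Pi.smul_apply, h1]
  simp only [mulVecL_smul, smul_add, intervalIntegral.integral_smul]

lemma hasKernel_one : HasKernel (1 : L2 l n →L[ℂ] L2 l n) (fun _ => 1) (fun _ => 0) := by
  intro f
  simp

lemma hasKernel_opA : HasKernel (opA l n) (fun _ => 0) (fun _ => -Complex.I • 1) := by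
  intro f
  filter_upwards [(memLp_primitive f).coeFn_toLp] with x hx
  change ((memLp_primitive f).toLp _ : L2 l n) x = _
  rw [hx]
  simp only [map_zero, zero_apply, zero_add, mulVecL_smul, mulVecL_one,
    intervalIntegral.integral_smul]

end Triangular

/-- A bounded version of `exists_volterra_solution`, on a set of bounded height. -/
theorem exists_bounded_volterra_solution {ι V J : Type*} [MeasurableSpace ι]
    [NormedAddCommGroup V] [NormedSpace ℝ V] [CompleteSpace V] [Fintype J] (h : ι → ℝ)
    (hm : Measurable h) (hh : ∀ p, 0 ≤ h p)
    {a b : J → ι → ℝ} (ha : ∀ j, Measurable (a j)) (hb : ∀ j, Measurable (b j))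
    {φ : J → ι × ℝ → ι} (hφ : ∀ j, Measurable (φ j))
    (hφh : ∀ j p, ∀ s ∈ Ioc (a j p) (b j p), h (φ j (p, s)) ≤ h p - (b j p - s))
    {C : J → ι × ℝ → V →L[ℝ] V} (hC : ∀ j, BoundedMeasurable (C j))
    {g : ι → V} (hg : BoundedMeasurable g) (L : ℝ) :
    ∃ f : ι → V, BoundedMeasurable f ∧ ∀ p, h p ≤ L →
      f p = g p + ∑ j, ∫ s in Ioc (a j p) (b j p), C j (p, s) (f (φ j (p, s))) := by
  obtain ⟨f, hf, ⟨A, r, hA, hr, hfA⟩, hfe⟩ := exists_volterra_solution h hh ha hb hφ hφh hC hg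
  have hS : MeasurableSet {p | h p ≤ L} := hm measurableSet_Iic
  refine ⟨{p | h p ≤ L}.indicator f, ⟨hf.indicator hS, A * Real.exp (r * L), by positivity,
    fun p => ?_⟩, fun p hp => ?_⟩
  · by_cases hp : h p ≤ L
    · rw [indicator_of_mem (show p ∈ {p | h p ≤ L} from hp)]
      refine (hfA p).trans ?_
      gcongr
    · rw [indicator_of_notMem (show p ∉ {p | h p ≤ L} from hp), norm_zero]
      positivity
  · rw [indicator_of_mem (show p ∈ {p | h p ≤ L} from hp), hfe p]
    congr 1
    refine Finset.sum_congr rfl fun j _ => setIntegral_congr_fun measurableSet_Ioc fun s hs => ?_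
    -- Paths starting below height L stay below it, so the cut-off is not seen by the equation.
    have h1 : φ j (p, s) ∈ {p | h p ≤ L} := by
      have := hφh j p s hs
      have := hs.2
      simp only [mem_ofPred_eq]
      linarith
    simp only [indicator_of_mem h1]

/-! ### Inverses of triangular operators. -/

section Triangular

variable {l : ℝ} {n : ℕ} {ρ σ : ℝ → Matrix (Fin n) (Fin n) ℂ}
  {k j : ℝ × ℝ → Matrix (Fin n) (Fin n) ℂ}

/-- Multiplying by σ(x) = ρ(x)⁻¹ turns the vanishing of the kernel of T S off the diagonal into a
Volterra equation for j(·, t) at each fixed t, with x as height. -/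
lemma exists_resolvent (l : ℝ) (hσ : BoundedMeasurable σ)
    (hk : BoundedMeasurable k) (hρσ : ∀ x ∈ Icc 0 l, ρ x * σ x = 1) :
    ∃ j : ℝ × ℝ → Matrix (Fin n) (Fin n) ℂ, BoundedMeasurable j ∧
      ∀ x t, 0 ≤ t → t ≤ x → x ≤ l →
        ρ x * j (x, t) + k (x, t) * σ t + ∫ s in t..x, k (x, s) * j (s, t) = 0 := by
  let V := Matrix (Fin n) (Fin n) ℂ
  let Lm : LinearCLM V (LinearCLM V V) := mulL
  have h11 : Measurable fun q : (ℝ × ℝ) × ℝ => q.1.1 := by fun_prop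
  have h1s : Measurable fun q : (ℝ × ℝ) × ℝ => (q.1.1, q.2) := by fun_prop
  have hg : BoundedMeasurable fun p : ℝ × ℝ => -(σ p.1 * (k p * σ p.2)) :=
    ((hσ.comp measurable_fst).matrix_mul (hk.matrix_mul (hσ.comp measurable_snd))).neg
  have hC : BoundedMeasurable fun q : (ℝ × ℝ) × ℝ => Lm (-(σ q.1.1 * k (q.1.1, q.2))) :=
    ((hσ.comp h11).matrix_mul (hk.comp h1s)).neg.clm Lm
  obtain ⟨j, hj, hje⟩ := exists_bounded_volterra_solution (ι := ℝ × ℝ) (V := V) (J := Unit)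
    (fun p => max p.1 0) (by fun_prop) (fun p => le_max_right _ _)
    (a := fun _ p => max p.2 0) (b := fun _ p => p.1) (by fun_prop) (by fun_prop)
    (φ := fun _ q => (q.2, q.1.2)) (by fun_prop)
    (fun _ p s hs => by
      have h1 := hs.1; have h2 := hs.2
      have h3 : 0 < s := lt_of_le_of_lt (le_max_right _ _) h1
      simp only [max_eq_left h3.le, max_eq_left (h3.le.trans h2)]
      linarith)
    (C := fun _ q => Lm (-(σ q.1.1 * k (q.1.1, q.2)))) (fun _ => hC) hg l
  refine ⟨j, hj, fun x t ht htx hxl => ?_⟩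
  have h0x := ht.trans htx
  have e := hje (x, t) (by simpa [h0x] using hxl)
  simp only [Finset.univ_unique, Finset.sum_singleton, max_eq_left ht] at e
  have hi : IntervalIntegrable (fun s => k (x, s) * j (s, t)) volume t x :=
    ((hk.comp (g := fun s => (x, s)) (by fun_prop)).matrix_mul
      (hj.comp (g := fun s => (s, t)) (by fun_prop))).intervalIntegrable t x
  have e1 : ∫ s in Ioc t x, Lm (-(σ x * k (x, s))) (j (s, t)) =
      -(σ x * ∫ s in t..x, k (x, s) * j (s, t)) := by
    have h1 := ContinuousLinearMap.intervalIntegral_comp_comm (Lm (-(σ x))) hi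
    change ∫ s in t..x, -(σ x) * (k (x, s) * j (s, t)) =
      -(σ x) * ∫ s in t..x, k (x, s) * j (s, t) at h1
    rw [← neg_mul, ← h1, intervalIntegral.integral_of_le htx]
    refine integral_congr_ae (ae_of_all _ fun s => ?_)
    change -(σ x * k (x, s)) * j (s, t) = _
    noncomm_ring
  rw [e1] at e
  have h2 : ρ x * j (x, t) = -(ρ x * σ x * (k (x, t) * σ t)) -
      ρ x * σ x * ∫ s in t..x, k (x, s) * j (s, t) := by
    rw [e]
    noncomm_ring
  rw [h2, hρσ x ⟨h0x, hxl⟩]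
  noncomm_ring

lemma HasKernel.exists_right_inverse {T : L2 l n →L[ℂ] L2 l n} (hT : HasKernel T ρ k)
    (hσ : BoundedMeasurable σ) (hk : BoundedMeasurable k)
    (hρσ : ∀ x ∈ Icc 0 l, ρ x * σ x = 1) :
    ∃ (S : L2 l n →L[ℂ] L2 l n) (j : ℝ × ℝ → Matrix (Fin n) (Fin n) ℂ),
      BoundedMeasurable j ∧ HasKernel S σ j ∧ T * S = 1 := by
  obtain ⟨j, hj, hje⟩ := exists_resolvent l hσ hk hρσ
  obtain ⟨S, hS⟩ := exists_hasKernel l hσ hj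
  refine ⟨S, j, hj, hS, HasKernel.unique ((hT.comp hS hσ hk hj).congr ?_ ?_) hasKernel_one⟩
  · exact fun x hx => (hρσ x (Ioc_subset_Icc_self hx)).symm
  · exact fun x t h0 htx hxl => (hje x t h0 htx hxl).symm

/-- A triangular operator with invertible diagonal part is invertible, and its inverse is
triangular. -/
theorem HasKernel.exists_unit {T : L2 l n →L[ℂ] L2 l n} (hT : HasKernel T ρ k)
    (hρ : BoundedMeasurable ρ) (hσ : BoundedMeasurable σ) (hk : BoundedMeasurable k)
    (hρσ : ∀ x ∈ Icc 0 l, ρ x * σ x = 1) :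
    ∃ E : (L2 l n →L[ℂ] L2 l n)ˣ, E.val = T ∧
      ∃ j : ℝ × ℝ → Matrix (Fin n) (Fin n) ℂ, BoundedMeasurable j ∧ HasKernel E⁻¹.val σ j := by
  obtain ⟨S, j, hj, hS, hTS⟩ := hT.exists_right_inverse hσ hk hρσ
  obtain ⟨U, _, _, _, hSU⟩ := hS.exists_right_inverse hρ hj
    fun x hx => mul_eq_one_comm.1 (hρσ x hx)
  -- S has T as a left inverse and U as a right inverse, so they coincide and S is a two-sided
  -- inverse of T.
  have hTU : T = U := left_inv_eq_right_inv hTS hSU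
  exact ⟨⟨T, S, hTS, hTU ▸ hSU⟩, rfl, j, hj, hS⟩

/-- Triangular operators preserve essential boundedness. -/
lemma HasKernel.exists_bound {T : L2 l n →L[ℂ] L2 l n} (hT : HasKernel T ρ k)
    (hρ : BoundedMeasurable ρ) (hk : BoundedMeasurable k) {f : L2 l n}
    (hf : ∃ C : ℝ, ∀ᵐ x ∂vol l, ‖f x‖ ≤ C) : ∃ C : ℝ, ∀ᵐ x ∂vol l, ‖T f x‖ ≤ C := by
  obtain ⟨C, hC0, hC⟩ := hρ.bdd
  obtain ⟨D, hD0, hD⟩ := hk.bdd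
  obtain ⟨M, hM⟩ := hf
  have hM' : ∀ᵐ x, x ∈ Ioc 0 l → ‖f x‖ ≤ M := (ae_restrict_iff' measurableSet_Ioc).1 hM
  refine ⟨C * |M| + D * |M| * l, ?_⟩
  filter_upwards [hT f, hM, ae_vol_mem] with x h1 h2 hx
  rw [h1]
  refine norm_add_le_of_le ?_ ?_
  · refine (Matrix.l2_opNorm_mulVec (ρ x) (f x)).trans ?_
    gcongr
    exacts [hC x, h2.trans (le_abs_self M)]
  · have h3 : ‖∫ t in (0 : ℝ)..x, mulVecL (k (x, t)) (f t)‖ ≤ D * |M| * |x - 0| := by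
      refine intervalIntegral.norm_integral_le_of_norm_le_const_ae ?_
      filter_upwards [hM'] with t ht ht'
      rw [uIoc_of_le hx.1.le] at ht'
      refine (Matrix.l2_opNorm_mulVec (k (x, t)) (f t)).trans ?_
      gcongr
      exacts [hD _, (ht ⟨ht'.1, ht'.2.trans hx.2⟩).trans (le_abs_self M)]
    refine h3.trans ?_
    rw [sub_zero, abs_of_pos hx.1]
    gcongr
    exact hx.2

lemma toLp_intervalIntegral {κ : Type*} [Fintype κ] (f : ℝ → κ → ℂ) (a b : ℝ) :
    (WithLp.toLp 2 (∫ t in a..b, f t) : EuclideanSpace ℂ κ) =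
      ∫ t in a..b, (WithLp.toLp 2 (f t) : EuclideanSpace ℂ κ) := by
  simp only [intervalIntegral]
  rw [WithLp.toLp_sub]
  congr 1
  · exact ((PiLp.continuousLinearEquiv 2 ℂ fun _ : κ => ℂ).symm.integral_comp_comm f).symm
  · exact ((PiLp.continuousLinearEquiv 2 ℂ fun _ : κ => ℂ).symm.integral_comp_comm f).symm

lemma HasKernel.isTriangular {T : L2 l n →L[ℂ] L2 l n} (hT : HasKernel T ρ k)
    (hk : BoundedMeasurable k) : IsTriangular T ρ := by
  obtain ⟨D, hD0, hD⟩ := hk.bdd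
  refine ⟨fun x t => k (x, t), fun i j => ?_, ⟨D, fun x t => hD _⟩, fun f => ?_⟩
  · have h : Continuous fun M : Matrix (Fin n) (Fin n) ℂ => M i j :=
      continuous_id.matrix_elem i j
    exact (h.comp_stronglyMeasurable hk.sm).measurable
  · filter_upwards [hT f] with x hx
    rw [hx, WithLp.toLp_add, toLp_intervalIntegral]
    rfl

end Triangular

/-! ### Linear differential equations and the Goursat problem. -/

section LinearSystems

variable {p q : Type*} [Fintype p] [Fintype q] [DecidableEq p] [DecidableEq q]

/-- Linear matrix differential equations with bounded measurable coefficients. -/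
lemma exists_linear_solution (l : ℝ) {A : ℝ → Matrix p p ℂ} (hA : BoundedMeasurable A)
    (Y₀ : Matrix p q ℂ) :
    ∃ Y : ℝ → Matrix p q ℂ, BoundedMeasurable Y ∧
      ∀ x ∈ Icc 0 l, Y x = Y₀ + ∫ s in (0 : ℝ)..x, A s * Y s := by
  let Lm : LinearCLM (Matrix p p ℂ) (LinearCLM (Matrix p q ℂ) (Matrix p q ℂ)) := mulL
  obtain ⟨Y, hY, hYe⟩ := exists_bounded_volterra_solution (ι := ℝ) (V := Matrix p q ℂ) (J := Unit)
    (fun x => max x 0) (by fun_prop) (fun p => le_max_right _ _)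
    (a := fun _ _ => 0) (b := fun _ x => x) (by fun_prop) (by fun_prop)
    (φ := fun _ r => r.2) (by fun_prop)
    (fun _ x s hs => by
      simp only [max_eq_left hs.1.le, max_eq_left (hs.1.le.trans hs.2)]
      linarith)
    (C := fun _ r => Lm (A r.2)) (fun _ => (hA.comp measurable_snd).clm Lm)
    (BoundedMeasurable.const Y₀) l
  refine ⟨Y, hY, fun x hx => ?_⟩
  have e := hYe x (by simpa [hx.1] using hx.2)
  simp only [Finset.univ_unique, Finset.sum_singleton] at e
  rw [e, intervalIntegral.integral_of_le hx.1]
  rfl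

/-- A Goursat problem: `e` is transported along the diagonals `x - t = const`, `z` along the lines
`t = const`. -/
theorem exists_goursat_solution (l : ℝ)
    {p₁ : ℝ → Matrix p p ℂ} {p₂ : ℝ → Matrix p q ℂ} {q₁ : ℝ → Matrix q p ℂ} {q₂ : ℝ → Matrix q q ℂ}
    (hp₁ : BoundedMeasurable p₁) (hp₂ : BoundedMeasurable p₂) (hq₁ : BoundedMeasurable q₁)
    (hq₂ : BoundedMeasurable q₂) {e₀ : ℝ → Matrix p p ℂ} {z₀ : ℝ → Matrix q p ℂ}
    (he₀ : BoundedMeasurable e₀) (hz₀ : BoundedMeasurable z₀) :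
    ∃ (e : ℝ × ℝ → Matrix p p ℂ) (z : ℝ × ℝ → Matrix q p ℂ),
      BoundedMeasurable e ∧ BoundedMeasurable z ∧
      (∀ x t, 0 ≤ t → t ≤ x → x ≤ l → e (x, t) = e₀ (x - t) + ∫ s in (0 : ℝ)..t,
        (p₁ (x - t + s) * e (x - t + s, s) + p₂ (x - t + s) * z (x - t + s, s))) ∧
      (∀ x t, 0 ≤ t → t ≤ x → x ≤ l → z (x, t) = z₀ t + ∫ s in t..x,
        (q₁ s * e (s, t) + q₂ s * z (s, t))) := by
  let V₁ := Matrix p p ℂ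
  let V₂ := Matrix q p ℂ
  let V := V₁ × V₂
  let L₁₁ : LinearCLM (Matrix p p ℂ) (LinearCLM V V) :=
    ((ContinuousLinearMap.compL ℝ V V₁ V (ContinuousLinearMap.inl ℝ V₁ V₂)).comp
      ((ContinuousLinearMap.compL ℝ V V₁ V₁).flip (ContinuousLinearMap.fst ℝ V₁ V₂))).comp mulL
  let L₁₂ : LinearCLM (Matrix p q ℂ) (LinearCLM V V) :=
    ((ContinuousLinearMap.compL ℝ V V₁ V (ContinuousLinearMap.inl ℝ V₁ V₂)).comp
      ((ContinuousLinearMap.compL ℝ V V₂ V₁).flip (ContinuousLinearMap.snd ℝ V₁ V₂))).comp mulL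
  let L₂₁ : LinearCLM (Matrix q p ℂ) (LinearCLM V V) :=
    ((ContinuousLinearMap.compL ℝ V V₂ V (ContinuousLinearMap.inr ℝ V₁ V₂)).comp
      ((ContinuousLinearMap.compL ℝ V V₁ V₂).flip (ContinuousLinearMap.fst ℝ V₁ V₂))).comp mulL
  let L₂₂ : LinearCLM (Matrix q q ℂ) (LinearCLM V V) :=
    ((ContinuousLinearMap.compL ℝ V V₂ V (ContinuousLinearMap.inr ℝ V₁ V₂)).comp
      ((ContinuousLinearMap.compL ℝ V V₂ V₂).flip (ContinuousLinearMap.snd ℝ V₁ V₂))).comp mulL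
  have hd : Measurable fun r : (ℝ × ℝ) × ℝ => r.1.1 - r.1.2 + r.2 := by fun_prop
  have hs : Measurable fun r : (ℝ × ℝ) × ℝ => r.2 := by fun_prop
  have hC₁ : BoundedMeasurable fun r : (ℝ × ℝ) × ℝ =>
      L₁₁ (p₁ (r.1.1 - r.1.2 + r.2)) + L₁₂ (p₂ (r.1.1 - r.1.2 + r.2)) :=
    ((hp₁.comp hd).clm L₁₁).add ((hp₂.comp hd).clm L₁₂)
  have hC₂ : BoundedMeasurable fun r : (ℝ × ℝ) × ℝ => L₂₁ (q₁ r.2) + L₂₂ (q₂ r.2) :=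
    ((hq₁.comp hs).clm L₂₁).add ((hq₂.comp hs).clm L₂₂)
  have hg : BoundedMeasurable fun r : ℝ × ℝ => ContinuousLinearMap.inl ℝ V₁ V₂ (e₀ (r.1 - r.2)) +
      ContinuousLinearMap.inr ℝ V₁ V₂ (z₀ r.2) :=
    ((he₀.comp (g := fun r : ℝ × ℝ => r.1 - r.2) (by fun_prop)).clm
      (ContinuousLinearMap.inl ℝ V₁ V₂)).add
    ((hz₀.comp (g := fun r : ℝ × ℝ => r.2) (by fun_prop)).clm (ContinuousLinearMap.inr ℝ V₁ V₂))
  obtain ⟨u, hu, hue⟩ := exists_bounded_volterra_solution (ι := ℝ × ℝ) (V := V) (J := Bool)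
    (fun r => max r.1 0) (by fun_prop) (fun p => le_max_right _ _)
    -- Both paths are needed for all pairs, not only those in the triangle. The cut-offs keep the
    -- first coordinate nonnegative along them, so that the height max x 0 drops at unit speed; for
    -- 0 ≤ t ≤ x the lower limits are 0 on the diagonal path and t on the vertical one.
    (a := fun i r => bif i then max 0 (r.2 - r.1) else max r.2 0)
    (b := fun i r => bif i then r.2 else r.1)
    (by rintro (_ | _) <;> simp only [cond_true, cond_false] <;> fun_prop)
    (by rintro (_ | _) <;> simp only [cond_true, cond_false] <;> fun_prop)
    (φ := fun i r => bif i then (r.1.1 - r.1.2 + r.2, r.2) else (r.2, r.1.2))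
    (by rintro (_ | _) <;> simp only [cond_true, cond_false] <;> fun_prop)
    (by
      rintro (_ | _) r s ⟨h1, h2⟩
      · simp only [cond_false] at h1 h2 ⊢
        have h3 : 0 < s := lt_of_le_of_lt (le_max_right _ _) h1
        rw [max_eq_left h3.le, max_eq_left (h3.le.trans h2)]
        linarith
      · simp only [cond_true] at h1 h2 ⊢
        have h3 : r.2 - r.1 < s := lt_of_le_of_lt (le_max_right _ _) h1
        have h4 := le_max_left r.1 0
        rw [max_eq_left (by linarith)]
        linarith)
    (C := fun i r => bif i then L₁₁ (p₁ (r.1.1 - r.1.2 + r.2)) + L₁₂ (p₂ (r.1.1 - r.1.2 + r.2))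
      else L₂₁ (q₁ r.2) + L₂₂ (q₂ r.2))
    (by
      rintro (_ | _)
      · exact hC₂
      · exact hC₁) hg l
  have hu1 : BoundedMeasurable fun r => (u r).1 := hu.clm (ContinuousLinearMap.fst ℝ V₁ V₂)
  have hu2 : BoundedMeasurable fun r => (u r).2 := hu.clm (ContinuousLinearMap.snd ℝ V₁ V₂)
  have key : ∀ x t, 0 ≤ t → t ≤ x → x ≤ l → u (x, t) = (e₀ (x - t) + ∫ s in (0 : ℝ)..t,
        (p₁ (x - t + s) * (u (x - t + s, s)).1 + p₂ (x - t + s) * (u (x - t + s, s)).2),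
      z₀ t + ∫ s in t..x, (q₁ s * (u (s, t)).1 + q₂ s * (u (s, t)).2)) := by
    intro x t ht htx hxl
    have e := hue (x, t) (by simpa [ht.trans htx] using hxl)
    simp only [Fintype.sum_bool, cond_true, cond_false, max_eq_left ht,
      max_eq_left (sub_nonpos.2 htx)] at e
    have hm1 : Measurable fun s : ℝ => x - t + s := by fun_prop
    have hm2 : Measurable fun s : ℝ => (x - t + s, s) := by fun_prop
    have hm3 : Measurable fun s : ℝ => (s, t) := by fun_prop
    have i1 : BoundedMeasurable fun s =>
        p₁ (x - t + s) * (u (x - t + s, s)).1 + p₂ (x - t + s) * (u (x - t + s, s)).2 :=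
      ((hp₁.comp hm1).matrix_mul (hu1.comp hm2)).add ((hp₂.comp hm1).matrix_mul (hu2.comp hm2))
    have i2 : BoundedMeasurable fun s => q₁ s * (u (s, t)).1 + q₂ s * (u (s, t)).2 :=
      (hq₁.matrix_mul (hu1.comp hm3)).add (hq₂.matrix_mul (hu2.comp hm3))
    have e1 := ContinuousLinearMap.intervalIntegral_comp_comm (ContinuousLinearMap.inl ℝ V₁ V₂)
      (i1.intervalIntegrable 0 t)
    have e2 := ContinuousLinearMap.intervalIntegral_comp_comm (ContinuousLinearMap.inr ℝ V₁ V₂)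
      (i2.intervalIntegrable t x)
    have c1 : ∀ s, (L₁₁ (p₁ (x - t + s)) + L₁₂ (p₂ (x - t + s))) (u (x - t + s, s)) =
        ContinuousLinearMap.inl ℝ V₁ V₂
          (p₁ (x - t + s) * (u (x - t + s, s)).1 + p₂ (x - t + s) * (u (x - t + s, s)).2) :=
      fun s => by rw [map_add]; rfl
    have c2 : ∀ s, (L₂₁ (q₁ s) + L₂₂ (q₂ s)) (u (s, t)) =
        ContinuousLinearMap.inr ℝ V₁ V₂ (q₁ s * (u (s, t)).1 + q₂ s * (u (s, t)).2) :=
      fun s => by rw [map_add]; rfl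
    simp only [c1, c2] at e
    rw [← intervalIntegral.integral_of_le ht, ← intervalIntegral.integral_of_le htx, e1, e2] at e
    rw [e]
    simp only [ContinuousLinearMap.inl_apply, ContinuousLinearMap.inr_apply, Prod.mk_add_mk,
      add_zero, zero_add]
    exact Prod.ext (congrArg (e₀ (x - t) + ·) (add_zero _)) (congrArg (z₀ t + ·) (zero_add _))
  exact ⟨fun r => (u r).1, fun r => (u r).2, hu1, hu2,
    fun x t h0 h1 h2 => congrArg Prod.fst (key x t h0 h1 h2),
    fun x t h0 h1 h2 => congrArg Prod.snd (key x t h0 h1 h2)⟩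

end LinearSystems

/-! ### Integrating solutions of transport equations over t. -/

section Transport

variable {V : Type*} [NormedAddCommGroup V] [NormedSpace ℝ V]

lemma BoundedMeasurable.integral_Ioc {α : Type*} [MeasurableSpace α] {f : α × ℝ → V}
    (hf : BoundedMeasurable f) {a b : α → ℝ} (ha : Measurable a) (hb : Measurable b) {D : ℝ}
    (hD : ∀ x, b x - a x ≤ D) : BoundedMeasurable fun x => ∫ s in Ioc (a x) (b x), f (x, s) := by
  obtain ⟨C, hC0, hC⟩ := hf.bdd
  refine ⟨stronglyMeasurable_setIntegral_Ioc hf.sm ha hb, C * |D|, by positivity, fun x => ?_⟩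
  refine (norm_setIntegral_le_of_norm_le_const (C := C) (by simp) fun s _ => hC _).trans ?_
  rw [Real.volume_real_Ioc]
  gcongr
  exact max_le ((hD x).trans (le_abs_self _)) (abs_nonneg _)

/-- Without the truncation at d the integral could grow linearly in x; for x ≤ d the truncation has
no effect. -/
lemma BoundedMeasurable.integral_section {f : ℝ × ℝ → V} (hf : BoundedMeasurable f) (c d : ℝ) :
    BoundedMeasurable fun x => ∫ s in Ioc c (min x d), f (x, s) :=
  hf.integral_Ioc (a := fun _ => c) (b := fun x => min x d) (by fun_prop) (by fun_prop)
    fun x => sub_le_sub_right (min_le_right x d) c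

lemma BoundedMeasurable.intervalIntegrable_section {f : ℝ × ℝ → V} (hf : BoundedMeasurable f)
    {c x : ℝ} (hcx : c ≤ x) : IntervalIntegrable (fun s => ∫ r in c..s, f (s, r)) volume c x := by
  refine ((hf.integral_section c x).intervalIntegrable c x).congr fun s hs => ?_
  rw [uIoc_of_le hcx] at hs
  simp only [min_eq_left hs.2]
  rw [intervalIntegral.integral_of_le hs.1.le]

/-- Integration of a function given along the diagonals. -/
lemma integral_of_diagonal {l : ℝ} {e h : ℝ × ℝ → V} {e₀ : ℝ → V} (he : BoundedMeasurable e)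
    (hh : BoundedMeasurable h)
    (heq : ∀ x t, 0 ≤ t → t ≤ x → x ≤ l →
      e (x, t) = e₀ (x - t) + ∫ s in (0 : ℝ)..t, h (x - t + s, s))
    {c x : ℝ} (hc : 0 ≤ c) (hcx : c ≤ x) (hxl : x ≤ l) :
    ∫ s in c..x, e (x, s) = ∫ r in c..x, (e (r, c) + ∫ s in c..r, h (r, s)) := by
  -- The diagonal through (x, s) meets the line t = c at (x + c - s, c); the equation is restarted
  -- from there.
  have h1 : ∀ s ∈ uIcc c x, e (x, s) = e (x + c - s, c) + ∫ r in c..s, h (x - s + r, r) := by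
    intro s hs
    rw [uIcc_of_le hcx] at hs
    have hm : BoundedMeasurable fun r => h (x - s + r, r) :=
      hh.comp (g := fun r => (x - s + r, r)) (by fun_prop)
    rw [heq x s (hc.trans hs.1) hs.2 hxl, heq (x + c - s) c hc (by linarith [hs.2])
      (by linarith [hs.1]), show x + c - s - c = x - s by ring, add_assoc,
      intervalIntegral.integral_add_adjacent_intervals (hm.intervalIntegrable _ _)
        (hm.intervalIntegrable _ _)]
  have hH : BoundedMeasurable fun q : ℝ × ℝ => h (x - q.1 + q.2, q.2) :=
    hh.comp (g := fun q : ℝ × ℝ => (x - q.1 + q.2, q.2)) (by fun_prop)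
  have hi1 : BoundedMeasurable fun s => e (x + c - s, c) :=
    he.comp (g := fun s => (x + c - s, c)) (by fun_prop)
  have hi2 : BoundedMeasurable fun s => e (s, c) := he.comp (g := fun s => (s, c)) (by fun_prop)
  rw [intervalIntegral.integral_congr h1, intervalIntegral.integral_add
    (hi1.intervalIntegrable _ _) (hH.intervalIntegrable_section hcx), intervalIntegral.integral_add
    (hi2.intervalIntegrable _ _) (hh.intervalIntegrable_section hcx)]
  congr 1
  · rw [intervalIntegral.integral_comp_sub_left (fun s => e (s, c))]
    congr 1 <;> ring
  -- After exchanging the order of integration the two inner integrals differ only by the reflection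
  -- s ↦ x + r - s, which preserves [r, x].
  · rw [hH.integral_triangle_swap hcx, hh.integral_triangle_swap hcx]
    refine intervalIntegral.integral_congr fun r _ => ?_
    have h2 : ∀ s, h (x - s + r, r) = (fun y => h (y, r)) (x + r - s) := fun s => by
      simp only
      congr 2
      ring
    simp only [h2]
    rw [intervalIntegral.integral_comp_sub_left (fun y => h (y, r))]
    congr 1 <;> ring

/-- Integration of a function given along the lines `t = const`. -/
lemma integral_of_vertical {l : ℝ} {z w : ℝ × ℝ → V} {z₀ : ℝ → V} (hz₀ : BoundedMeasurable z₀)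
    (hw : BoundedMeasurable w)
    (heq : ∀ x t, 0 ≤ t → t ≤ x → x ≤ l → z (x, t) = z₀ t + ∫ s in t..x, w (s, t))
    {c x : ℝ} (hc : 0 ≤ c) (hcx : c ≤ x) (hxl : x ≤ l) :
    ∫ s in c..x, z (x, s) = ∫ r in c..x, (z₀ r + ∫ s in c..r, w (r, s)) := by
  have h1 : ∀ s ∈ uIcc c x, z (x, s) = z₀ s + ∫ r in s..x, w (r, s) := by
    intro s hs
    rw [uIcc_of_le hcx] at hs
    exact heq x s (hc.trans hs.1) hs.2 hxl
  have hi : IntervalIntegrable (fun s => ∫ r in s..x, w (r, s)) volume c x := by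
    have hw' : BoundedMeasurable fun q : ℝ × ℝ => w (q.2, q.1) :=
      hw.comp (g := fun q : ℝ × ℝ => (q.2, q.1)) (by fun_prop)
    have h := hw'.integral_Ioc (a := fun s => max s c) (b := fun _ => x) (by fun_prop) (by fun_prop)
      (D := x - c) fun s => sub_le_sub_left (le_max_right s c) x
    refine (h.intervalIntegrable c x).congr fun s hs => ?_
    rw [uIoc_of_le hcx] at hs
    simp only [max_eq_left hs.1.le]
    rw [intervalIntegral.integral_of_le hs.2]
  rw [intervalIntegral.integral_congr h1, intervalIntegral.integral_add
    (hz₀.intervalIntegrable _ _) hi, intervalIntegral.integral_add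
    (hz₀.intervalIntegrable _ _) (hw.intervalIntegrable_section hcx), hw.integral_triangle_swap hcx]

end Transport

lemma matrix_mul_eq_add_integral {p q r : Type*} [Fintype p] [Fintype q] [Fintype r]
    [DecidableEq q] [DecidableEq r] {u α : ℝ → Matrix p q ℂ} {v β : ℝ → Matrix q r ℂ} {a b : ℝ}
    (hab : a ≤ b) (hα : BoundedMeasurable α) (hβ : BoundedMeasurable β)
    (hu : ∀ x ∈ Icc a b, u x = u a + ∫ s in a..x, α s)
    (hv : ∀ x ∈ Icc a b, v x = v a + ∫ s in a..x, β s) :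
    u b * v b = u a * v a + ∫ s in a..b, (α s * v s + u s * β s) :=
  bilin_eq_add_integral (u := u) (v := v) (α := α) (β := β) mulL hab hα hβ hu hv

section Primitive

variable {V : Type*} [NormedAddCommGroup V] [NormedSpace ℝ V]

lemma primitive_shift {u α : ℝ → V} {l c : ℝ} (hα : BoundedMeasurable α)
    (hu : ∀ x ∈ Icc 0 l, u x = u 0 + ∫ s in (0 : ℝ)..x, α s) (hc : 0 ≤ c) :
    ∀ x ∈ Icc c l, u x = u c + ∫ s in c..x, α s := by
  intro x hx
  rw [hu x ⟨hc.trans hx.1, hx.2⟩, hu c ⟨hc, hx.1.trans hx.2⟩, add_assoc,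
    intervalIntegral.integral_add_adjacent_intervals (hα.intervalIntegrable _ _)
      (hα.intervalIntegrable _ _)]

lemma primitive_clm {W : Type*} [NormedAddCommGroup W] [NormedSpace ℝ W] [CompleteSpace V]
    [CompleteSpace W] (L : V →L[ℝ] W)
    {u α : ℝ → V} {l c : ℝ} (hα : BoundedMeasurable α)
    (hu : ∀ x ∈ Icc c l, u x = u c + ∫ s in c..x, α s) :
    ∀ x ∈ Icc c l, L (u x) = L (u c) + ∫ s in c..x, L (α s) := by
  intro x hx
  rw [hu x hx, map_add, L.intervalIntegral_comp_comm (hα.intervalIntegrable _ _)]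

end Primitive

lemma BoundedMeasurable.integral_matrix_mul {p q r : Type*} [Fintype p] [Fintype q] [Fintype r]
    [DecidableEq q] [DecidableEq r] (M : Matrix p q ℂ) {f : ℝ → Matrix q r ℂ}
    (hf : BoundedMeasurable f) (c d : ℝ) : ∫ s in c..d, M * f s = M * ∫ s in c..d, f s :=
  ContinuousLinearMap.intervalIntegral_comp_comm (mulL M) (hf.intervalIntegrable c d)

/-! ### The kernel identity and the normalized kernel. -/

section Frame

variable {n κ : Type*} [Fintype n] [DecidableEq n] [Fintype κ] [DecidableEq κ]

/-- A matrix function `G` with orthonormal rows on `[0, l]` which is the primitive of `a`. -/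
structure IsFrame (l : ℝ) (G a : ℝ → Matrix n κ ℂ) : Prop where
  bm : BoundedMeasurable G
  bm_deriv : BoundedMeasurable a
  prim : ∀ x ∈ Icc 0 l, G x = G 0 + ∫ s in (0 : ℝ)..x, a s
  orth : ∀ x ∈ Icc 0 l, G x * (G x)ᴴ = 1

variable {l : ℝ} {G a : ℝ → Matrix n κ ℂ}

lemma IsFrame.prim_conj (hG : IsFrame l G a) {c : ℝ} (hc : 0 ≤ c) :
    ∀ x ∈ Icc c l, (G x)ᴴ = (G c)ᴴ + ∫ s in c..x, (a s)ᴴ :=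
  primitive_clm (u := G) (α := a) conjTransposeL hG.bm_deriv
    (primitive_shift hG.bm_deriv hG.prim hc)

/-- The kernel identity that expresses the similarity of `K` and `A`. -/
theorem IsFrame.kernel_identity (hG : IsFrame l G a) {ρ e₀ : ℝ → Matrix n n ℂ}
    (hρ : BoundedMeasurable ρ)
    (hρe : ∀ x ∈ Icc 0 l, ρ x = ρ 0 + ∫ s in (0 : ℝ)..x, a s * (G s)ᴴ * ρ s)
    {e : ℝ × ℝ → Matrix n n ℂ} {z : ℝ × ℝ → Matrix κ n ℂ}
    (he : BoundedMeasurable e) (hz : BoundedMeasurable z)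
    (hee : ∀ x t, 0 ≤ t → t ≤ x → x ≤ l → e (x, t) = e₀ (x - t) + ∫ s in (0 : ℝ)..t,
        (a (x - t + s) * (G (x - t + s))ᴴ * e (x - t + s, s) + a (x - t + s) * z (x - t + s, s)))
    (hze : ∀ x t, 0 ≤ t → t ≤ x → x ≤ l →
      z (x, t) = -((a t)ᴴ + (G t)ᴴ * a t * (G t)ᴴ) * ρ t + ∫ s in t..x,
        (-((a s)ᴴ + (G s)ᴴ * a s * (G s)ᴴ) * e (s, t) + -((G s)ᴴ * a s) * z (s, t)))
    {c : ℝ} (hc : 0 ≤ c) {x : ℝ} (hcx : c ≤ x) (hxl : x ≤ l) :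
    ρ x + ∫ s in c..x, e (x, s) = G x * ((G c)ᴴ * ρ c + ∫ s in c..x, (G s)ᴴ * e (s, c)) := by
  have hm := hG.bm
  have hmc := hG.bm.conjTranspose
  have hd := hG.bm_deriv
  have hdc := hG.bm_deriv.conjTranspose
  have hq₁ : BoundedMeasurable fun s => -((a s)ᴴ + (G s)ᴴ * a s * (G s)ᴴ) :=
    (hdc.add ((hmc.matrix_mul hd).matrix_mul hmc)).neg
  have hq₂ : BoundedMeasurable fun s => -((G s)ᴴ * a s) := (hmc.matrix_mul hd).neg
  have hp₁ : BoundedMeasurable fun s => a s * (G s)ᴴ := hd.matrix_mul hmc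
  have hec : BoundedMeasurable fun s => e (s, c) := he.comp (g := fun s => (s, c)) (by fun_prop)
  -- For fixed c, integrating the transport equations over s in [c, y] turns the Goursat system into
  -- ordinary integral equations in y for ε and ζ.
  set ε : ℝ → Matrix n n ℂ := fun y => ∫ s in Ioc c (min y l), e (y, s) with hε_def
  set ζ : ℝ → Matrix κ n ℂ := fun y => ∫ s in Ioc c (min y l), z (y, s) with hζ_def
  have hε : BoundedMeasurable ε := he.integral_section c l
  have hζ : BoundedMeasurable ζ := hz.integral_section c l
  have hεe : ∀ y ∈ Icc c l, ε y = ∫ s in c..y, e (y, s) := fun y hy => by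
    rw [hε_def, intervalIntegral.integral_of_le hy.1]
    simp only [min_eq_left hy.2]
  have hζe : ∀ y ∈ Icc c l, ζ y = ∫ s in c..y, z (y, s) := fun y hy => by
    rw [hζ_def, intervalIntegral.integral_of_le hy.1]
    simp only [min_eq_left hy.2]
  have hem : ∀ r, BoundedMeasurable fun s => e (r, s) := fun r =>
    he.comp (g := fun s => (r, s)) (by fun_prop)
  have hzm : ∀ r, BoundedMeasurable fun s => z (r, s) := fun r =>
    hz.comp (g := fun s => (r, s)) (by fun_prop)
  have hεy : ∀ y ∈ Icc c l, ε y = ∫ r in c..y,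
      (e (r, c) + (a r * (G r)ᴴ * ε r + a r * ζ r)) := by
    intro y hy
    have hh : BoundedMeasurable fun q : ℝ × ℝ => a q.1 * (G q.1)ᴴ * e q + a q.1 * z q :=
      ((hp₁.comp measurable_fst).matrix_mul he).add ((hd.comp measurable_fst).matrix_mul hz)
    rw [hεe y hy, integral_of_diagonal he hh hee hc hy.1 hy.2]
    refine intervalIntegral.integral_congr fun r hr => ?_
    rw [uIcc_of_le hy.1] at hr
    have hr' : r ∈ Icc c l := ⟨hr.1, hr.2.trans hy.2⟩
    simp only
    rw [intervalIntegral.integral_add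
      (((BoundedMeasurable.const _).matrix_mul (hem r)).intervalIntegrable _ _)
      (((BoundedMeasurable.const _).matrix_mul (hzm r)).intervalIntegrable _ _),
      (hem r).integral_matrix_mul, (hzm r).integral_matrix_mul, hεe r hr', hζe r hr']
  have hζy : ∀ y ∈ Icc c l, ζ y = ∫ r in c..y,
      (-((a r)ᴴ + (G r)ᴴ * a r * (G r)ᴴ) * (ρ r + ε r) + -((G r)ᴴ * a r) * ζ r) := by
    intro y hy
    have hw : BoundedMeasurable fun q : ℝ × ℝ =>
        -((a q.1)ᴴ + (G q.1)ᴴ * a q.1 * (G q.1)ᴴ) * e q + -((G q.1)ᴴ * a q.1) * z q :=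
      ((hq₁.comp measurable_fst).matrix_mul he).add ((hq₂.comp measurable_fst).matrix_mul hz)
    rw [hζe y hy, integral_of_vertical (hq₁.matrix_mul hρ) hw hze hc hy.1 hy.2]
    refine intervalIntegral.integral_congr fun r hr => ?_
    rw [uIcc_of_le hy.1] at hr
    have hr' : r ∈ Icc c l := ⟨hr.1, hr.2.trans hy.2⟩
    simp only
    rw [intervalIntegral.integral_add
      (((BoundedMeasurable.const _).matrix_mul (hem r)).intervalIntegrable _ _)
      (((BoundedMeasurable.const _).matrix_mul (hzm r)).intervalIntegrable _ _),
      (hem r).integral_matrix_mul, (hzm r).integral_matrix_mul, hεe r hr', hζe r hr',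
      Matrix.mul_add, add_assoc]
  have hcl : c ≤ l := hcx.trans hxl
  have hεc : ε c = 0 := by rw [hεe c ⟨le_rfl, hcl⟩, intervalIntegral.integral_same]
  have hζc : ζ c = 0 := by rw [hζe c ⟨le_rfl, hcl⟩, intervalIntegral.integral_same]
  -- M is the left side of the identity; μ and ν are the derivatives of M and ζ. The equation for ρ
  -- has the same coefficient aG* as the one for ε, so the two combine.
  set M : ℝ → Matrix n n ℂ := fun y => ρ y + ε y with hM_def
  set μ : ℝ → Matrix n n ℂ := fun r => e (r, c) + (a r * (G r)ᴴ * M r + a r * ζ r) with hμ_def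
  set ν : ℝ → Matrix κ n ℂ := fun r =>
    -((a r)ᴴ + (G r)ᴴ * a r * (G r)ᴴ) * M r + -((G r)ᴴ * a r) * ζ r with hν_def
  have hM : BoundedMeasurable M := hρ.add hε
  have hμ : BoundedMeasurable μ := hec.add ((hp₁.matrix_mul hM).add (hd.matrix_mul hζ))
  have hν : BoundedMeasurable ν := (hq₁.matrix_mul hM).add (hq₂.matrix_mul hζ)
  have hMc : M c = ρ c := by simp only [hM_def, hεc, add_zero]
  have hMp : ∀ y ∈ Icc c l, M y = M c + ∫ r in c..y, μ r := by
    intro y hy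
    rw [hMc, hM_def]
    simp only
    rw [primitive_shift (hp₁.matrix_mul hρ) hρe hc y hy, hεy y hy, add_assoc,
      ← intervalIntegral.integral_add ((hp₁.matrix_mul hρ).intervalIntegrable _ _)
        ((hec.add ((hp₁.matrix_mul hε).add (hd.matrix_mul hζ))).intervalIntegrable _ _)]
    congr 1
    refine intervalIntegral.integral_congr fun r _ => ?_
    simp only [hμ_def, hM_def, Matrix.mul_add]
    abel
  have hprod : BoundedMeasurable fun s => (a s)ᴴ * M s + (G s)ᴴ * μ s :=
    (hdc.matrix_mul hM).add (hmc.matrix_mul hμ)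
  -- The coefficients of the z-equation are chosen so that everything in v' = a*M + G*μ + ν cancels
  -- except G*e(·, c); thus v is the bracket on the right side.
  set v : ℝ → Matrix κ n ℂ := fun y => (G y)ᴴ * M y + ζ y with hv_def
  have hvc : v c = (G c)ᴴ * ρ c := by simp only [hv_def, hζc, hMc, add_zero]
  have hvp : ∀ y ∈ Icc c l, v y = v c + ∫ r in c..y, (G r)ᴴ * e (r, c) := by
    intro y hy
    have h1 := matrix_mul_eq_add_integral (u := fun s => (G s)ᴴ) (v := M) hy.1 hdc hμ
      (fun x hx => hG.prim_conj hc x ⟨hx.1, hx.2.trans hy.2⟩)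
      (fun x hx => hMp x ⟨hx.1, hx.2.trans hy.2⟩)
    rw [hvc, hv_def]
    simp only at h1 ⊢
    rw [h1, hζy y hy, hMc, add_assoc, ← intervalIntegral.integral_add
      (hprod.intervalIntegrable _ _) (hν.intervalIntegrable _ _)]
    congr 1
    refine intervalIntegral.integral_congr fun r _ => ?_
    simp only [hμ_def, hν_def, Matrix.mul_add, Matrix.add_mul, Matrix.neg_mul, Matrix.mul_assoc]
    abel
  -- Since GG* = I, (Gv)' = av + e(·, c) = μ = M', and Gv = M at c; hence Gv = M.
  have h2 := matrix_mul_eq_add_integral (u := G) (v := v) hcx hd (hmc.matrix_mul hec)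
    (fun y hy => primitive_shift hd hG.prim hc y ⟨hy.1, hy.2.trans hxl⟩)
    (fun y hy => hvp y ⟨hy.1, hy.2.trans hxl⟩)
  have h3 : ∫ r in c..x, (a r * v r + G r * ((G r)ᴴ * e (r, c))) = ∫ r in c..x, μ r := by
    refine intervalIntegral.integral_congr fun r hr => ?_
    rw [uIcc_of_le hcx] at hr
    rw [← Matrix.mul_assoc, hG.orth r ⟨hc.trans hr.1, hr.2.trans hxl⟩, Matrix.one_mul]
    simp only [hμ_def, hv_def, Matrix.mul_add, Matrix.mul_assoc]
    abel
  rw [h3, hvc, ← Matrix.mul_assoc, hG.orth c ⟨hc, hcl⟩, Matrix.one_mul, ← hMc,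
    ← hMp x ⟨hcx, hxl⟩] at h2
  rw [← hεe x ⟨hcx, hxl⟩, ← hvc, ← hvp x ⟨hcx, hxl⟩, h2]

/-- The diagonal part `ρ` of the similarity and its inverse. -/
lemma exists_linear_solution_inverse (l : ℝ) {P : ℝ → Matrix n n ℂ} (hP : BoundedMeasurable P)
    {Y₀ : Matrix n n ℂ} (hY₀ : IsUnit Y₀.det) :
    ∃ ρ σ : ℝ → Matrix n n ℂ, BoundedMeasurable ρ ∧ BoundedMeasurable σ ∧
      (∀ x ∈ Icc 0 l, ρ x = Y₀ + ∫ s in (0 : ℝ)..x, P s * ρ s) ∧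
      ∀ x ∈ Icc 0 l, σ x * ρ x = 1 := by
  obtain ⟨ρ, hρ, hρe⟩ := exists_linear_solution l hP Y₀
  -- Y solves the adjoint equation Y' = -P*Y, so Y*ρ is constant, and this initial value makes the
  -- constant the identity.
  obtain ⟨Y, hY, hYe⟩ := exists_linear_solution l hP.conjTranspose.neg (Y₀⁻¹)ᴴ
  refine ⟨ρ, fun x => (Y x)ᴴ, hρ, hY.conjTranspose, hρe, fun x hx => ?_⟩
  have h00 : (0 : ℝ) ∈ Icc 0 l := ⟨le_rfl, hx.1.trans hx.2⟩
  have hρ0 : ρ 0 = Y₀ := by simpa using hρe 0 h00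
  have hY0 : Y 0 = (Y₀⁻¹)ᴴ := by simpa using hYe 0 h00
  have hβ : BoundedMeasurable fun s => -(P s)ᴴ * Y s := hP.conjTranspose.neg.matrix_mul hY
  have h1 := matrix_mul_eq_add_integral (u := fun s => (Y s)ᴴ) (v := ρ) hx.1 hβ.conjTranspose
    (hP.matrix_mul hρ)
    (fun y hy => primitive_clm (u := Y) conjTransposeL hβ
      (by rw [hY0]; exact hYe) y ⟨hy.1, hy.2.trans hx.2⟩)
    (fun y hy => by rw [hρ0]; exact hρe y ⟨hy.1, hy.2.trans hx.2⟩)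
  have h2 : ∀ s, (-(P s)ᴴ * Y s)ᴴ * ρ s + (Y s)ᴴ * (P s * ρ s) = 0 := fun s => by
    simp [Matrix.conjTranspose_mul, Matrix.mul_assoc]
  simp only [h2, intervalIntegral.integral_zero, add_zero] at h1
  rw [h1, hρ0, hY0, Matrix.conjTranspose_conjTranspose, Matrix.nonsing_inv_mul _ hY₀]

/-- The kernel of the normalized similarity. -/
theorem IsFrame.exists_kernel (hG : IsFrame l G a) (hl : 0 ≤ l) (J : Matrix κ n ℂ)
    {ρ : ℝ → Matrix n n ℂ} (hρ : BoundedMeasurable ρ)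
    (hρe : ∀ x ∈ Icc 0 l, ρ x = G 0 * J + ∫ s in (0 : ℝ)..x, a s * (G s)ᴴ * ρ s) :
    ∃ e : ℝ × ℝ → Matrix n n ℂ, BoundedMeasurable e ∧
      (∀ x t, 0 ≤ t → t ≤ x → x ≤ l →
        ρ x + ∫ s in t..x, e (x, s) = G x * ((G t)ᴴ * ρ t + ∫ s in t..x, (G s)ᴴ * e (s, t))) ∧
      ∀ x ∈ Icc 0 l, ρ x + ∫ s in (0 : ℝ)..x, e (x, s) = G x * J := by
  have hm := hG.bm
  have hmc := hG.bm.conjTranspose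
  have hd := hG.bm_deriv
  have hdc := hG.bm_deriv.conjTranspose
  have hq₂ : BoundedMeasurable fun s => -((G s)ᴴ * a s) := (hmc.matrix_mul hd).neg
  have hq₁ : BoundedMeasurable fun s => -((a s)ᴴ + (G s)ᴴ * a s * (G s)ᴴ) :=
    (hdc.add ((hmc.matrix_mul hd).matrix_mul hmc)).neg
  have hp₁ : BoundedMeasurable fun s => a s * (G s)ᴴ := hd.matrix_mul hmc
  -- With e(x, 0) = aτ the bracket G(0)*ρ(0) + ∫ G*aτ equals J - τ(x), because τ' = -G*aτ and ρ(0) =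
  -- G(0)J.
  obtain ⟨τ, hτ, hτe⟩ := exists_linear_solution l hq₂ (J - (G 0)ᴴ * (G 0 * J))
  obtain ⟨e, z, he, hz, hee, hze⟩ := exists_goursat_solution l hp₁ hd hq₁ hq₂
    (hd.matrix_mul hτ) (hq₁.matrix_mul hρ)
  have h00 : (0 : ℝ) ∈ Icc 0 l := ⟨le_rfl, hl⟩
  have hρ0 : ρ 0 = G 0 * J := by simpa using hρe 0 h00
  have hτ0 : τ 0 = J - (G 0)ᴴ * (G 0 * J) := by simpa using hτe 0 h00
  have hid := fun {x t : ℝ} (h0 : 0 ≤ t) (h1 : t ≤ x) (h2 : x ≤ l) =>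
    hG.kernel_identity (e₀ := fun s => a s * τ s) hρ (by rwa [hρ0]) he hz hee hze h0 h1 h2
  refine ⟨e, he, fun x t h0 h1 h2 => hid h0 h1 h2, fun x hx => ?_⟩
  rw [hid le_rfl hx.1 hx.2]
  -- GG* = I gives (Gτ)' = aτ - aτ = 0, and G(0)τ(0) = 0 by the choice of the initial value; so the
  -- term τ disappears after multiplication by G.
  have hGτ : G x * τ x = 0 := by
    have h1 := matrix_mul_eq_add_integral (u := G) (v := τ) hx.1 hd (hq₂.matrix_mul hτ)
      (fun y hy => hG.prim y ⟨hy.1, hy.2.trans hx.2⟩)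
      (fun y hy => by rw [hτ0]; exact hτe y ⟨hy.1, hy.2.trans hx.2⟩)
    have h2 : ∫ s in (0 : ℝ)..x, (a s * τ s + G s * (-((G s)ᴴ * a s) * τ s)) = 0 := by
      refine (intervalIntegral.integral_congr fun s hs => ?_).trans
        intervalIntegral.integral_zero
      rw [uIcc_of_le hx.1] at hs
      simp only [Matrix.neg_mul, Matrix.mul_neg]
      rw [Matrix.mul_assoc, ← Matrix.mul_assoc (G s), hG.orth s ⟨hs.1, hs.2.trans hx.2⟩,
        Matrix.one_mul, add_neg_cancel]
    rw [h1, h2, hτ0, Matrix.mul_sub, ← Matrix.mul_assoc (G 0), hG.orth 0 h00, Matrix.one_mul,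
      sub_self, add_zero]
  have h3 : ∫ s in (0 : ℝ)..x, (G s)ᴴ * e (s, 0) = -∫ s in (0 : ℝ)..x, -((G s)ᴴ * a s) * τ s := by
    rw [← intervalIntegral.integral_neg]
    refine intervalIntegral.integral_congr fun s hs => ?_
    rw [uIcc_of_le hx.1] at hs
    rw [hee s 0 le_rfl hs.1 (hs.2.trans hx.2), intervalIntegral.integral_same, sub_zero, add_zero]
    simp only [Matrix.neg_mul, neg_neg, Matrix.mul_assoc]
  have h4 : (G 0)ᴴ * ρ 0 + ∫ s in (0 : ℝ)..x, (G s)ᴴ * e (s, 0) = J - τ x := by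
    rw [h3, hτe x hx, hρ0]
    abel
  rw [h4, Matrix.mul_sub, hGτ, sub_zero]

end Frame

/-! ### Boundedly differentiable elements of L² as primitives. -/

section Functions

variable {l : ℝ} {n : ℕ}

/-- An essentially bounded element of `L²` has a bounded measurable representative. -/
lemma exists_boundedMeasurable {f : L2 l n} (hf : ∃ C : ℝ, ∀ᵐ x ∂vol l, ‖f x‖ ≤ C) :
    ∃ u : ℝ → EuclideanSpace ℂ (Fin n), BoundedMeasurable u ∧ f =ᵐ[vol l] u := by
  obtain ⟨C, hC⟩ := hf
  have hm := Lp.stronglyMeasurable f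
  have hs : MeasurableSet {x | ‖f x‖ ≤ C} := hm.norm.measurable measurableSet_Iic
  refine ⟨{x | ‖f x‖ ≤ C}.indicator f, ⟨hm.indicator hs, |C|, abs_nonneg _, fun x => ?_⟩, ?_⟩
  · by_cases hx : x ∈ {x | ‖f x‖ ≤ C}
    · rw [indicator_of_mem hx]
      exact le_trans hx (le_abs_self _)
    · simp [indicator_of_notMem hx]
  · filter_upwards [hC] with x hx
    rw [indicator_of_mem (show x ∈ {x | ‖f x‖ ≤ C} from hx)]

lemma BoundedMeasurable.memLp {u : ℝ → EuclideanSpace ℂ (Fin n)} (hu : BoundedMeasurable u)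
    (l : ℝ) : MemLp u 2 (vol l) := by
  obtain ⟨C, hC0, hC⟩ := hu.bdd
  exact MemLp.of_bound hu.sm.aestronglyMeasurable C (ae_of_all _ hC)

lemma BoundedMeasurable.exists_L2 {u : ℝ → EuclideanSpace ℂ (Fin n)} (hu : BoundedMeasurable u)
    (l : ℝ) : ∃ f : L2 l n, f =ᵐ[vol l] u ∧ ∃ C : ℝ, ∀ᵐ x ∂vol l, ‖f x‖ ≤ C := by
  obtain ⟨C, hC0, hC⟩ := hu.bdd
  refine ⟨(hu.memLp l).toLp, (hu.memLp l).coeFn_toLp, C, ?_⟩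
  filter_upwards [(hu.memLp l).coeFn_toLp] with x hx
  rw [hx]
  exact hC x

lemma const_ae_eq (v : EuclideanSpace ℂ (Fin n)) : const l v =ᵐ[vol l] fun _ => v :=
  Lp.coeFn_const _ _ _

lemma I_smul_opA_ae_eq (q : L2 l n) :
    (Complex.I • opA l n q : L2 l n) =ᵐ[vol l] fun x => ∫ t in (0 : ℝ)..x, q t := by
  filter_upwards [Lp.coeFn_smul Complex.I (opA l n q),
    (memLp_primitive q).coeFn_toLp] with x h1 h2
  rw [h1, Pi.smul_apply]
  change Complex.I • ((memLp_primitive q).toLp _ : L2 l n) x = _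
  rw [h2, smul_smul]
  simp

lemma const_add_opA_ae_eq (v : EuclideanSpace ℂ (Fin n)) (q : L2 l n) :
    (const l v + Complex.I • opA l n q : L2 l n) =ᵐ[vol l]
      fun x => v + ∫ t in (0 : ℝ)..x, q t := by
  filter_upwards [Lp.coeFn_add (const l v) (Complex.I • opA l n q), const_ae_eq v,
    I_smul_opA_ae_eq q] with x h1 h2 h3
  rw [h1, Pi.add_apply, h2, h3]

/-- Boundedly differentiable functions are the primitives of essentially bounded functions. -/
lemma hasBoundedDerivative_iff (hl : 0 ≤ l) (f : L2 l n) :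
    HasBoundedDerivative f ↔ ∃ (v : EuclideanSpace ℂ (Fin n)) (q : L2 l n),
      (∃ C : ℝ, ∀ᵐ x ∂vol l, ‖q x‖ ≤ C) ∧ f = const l v + Complex.I • opA l n q := by
  constructor
  · rintro ⟨g, hg, hfg⟩
    obtain ⟨u, hu, hgu, -⟩ := hg.exists_primitive hl
    obtain ⟨q, hq, hqb⟩ := hu.exists_L2 l
    refine ⟨g 0, q, hqb, Lp.ext ?_⟩
    filter_upwards [hfg, const_add_opA_ae_eq (g 0) q, ae_vol_mem] with x h1 h2 hx
    have hx' := Ioc_subset_Icc_self hx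
    rw [h1, h2, hgu x hx', integral_congr_ae_vol hq hx']
  · rintro ⟨v, q, hq, rfl⟩
    obtain ⟨u, hu, hqu⟩ := exists_boundedMeasurable hq
    obtain ⟨K, hK⟩ := hu.exists_lipschitzWith_integral 0
    refine ⟨fun x => v + ∫ t in (0 : ℝ)..x, u t, boundedlyDifferentiableOn_of_lipschitzOnWith hl
      (K := K) ?_, ?_⟩
    · have := ((LipschitzWith.const v).add hK).lipschitzOnWith (s := Icc 0 l)
      simpa using this
    · filter_upwards [const_add_opA_ae_eq v q, ae_vol_mem] with x h1 hx
      rw [h1, integral_congr_ae_vol hqu (Ioc_subset_Icc_self hx)]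

end Functions

/-! ### The frame obtained from γ and the operator K. -/

section Frame

variable {l : ℝ} {n : ℕ} {κ : Type*} [Fintype κ] [DecidableEq κ]
  {G a : ℝ → Matrix (Fin n) κ ℂ}

/-- A boundedly differentiable function with orthonormal rows, restricted to the interval and
extended by constants. -/
lemma exists_frame (hl : 0 ≤ l) {γ : ℝ → Matrix (Fin n) κ ℂ} (hγ : BoundedlyDifferentiableOn l γ)
    (hγγ : ∀ x ∈ Icc 0 l, γ x * (γ x)ᴴ = 1) :
    ∃ G a : ℝ → Matrix (Fin n) κ ℂ, IsFrame l G a ∧ Continuous G ∧ (∀ x ∈ Icc 0 l, γ x = G x) ∧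
      ∀ᵐ x ∂vol l, HasDerivAt γ (a x) x := by
  obtain ⟨a, ha, hγa, hder⟩ := hγ.exists_primitive hl
  have hc := hγ.1.continuousOn
  rw [uIcc_of_le hl] at hc
  obtain ⟨C, hC⟩ := isCompact_Icc.exists_bound_of_continuousOn hc
  have hm : ∀ x : ℝ, max 0 (min x l) ∈ Icc 0 l := fun x =>
    ⟨le_max_left _ _, max_le hl (min_le_right _ _)⟩
  have he : ∀ x ∈ Icc 0 l, max 0 (min x l) = x := fun x hx => by
    rw [min_eq_left hx.2, max_eq_right hx.1]
  have hG : Continuous fun x => γ (max 0 (min x l)) :=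
    hc.comp_continuous (by fun_prop) hm
  refine ⟨fun x => γ (max 0 (min x l)), a, ⟨⟨hG.stronglyMeasurable, |C|, abs_nonneg _,
    fun x => (hC _ (hm x)).trans (le_abs_self _)⟩, ha, fun x hx => ?_, fun x _ => hγγ _ (hm x)⟩,
    hG, fun x hx => ?_, hder⟩
  · simp only [he x hx, he 0 ⟨le_rfl, hl⟩]
    exact hγa x hx
  · simp only [he x hx]

/-- The kernel of the operator `K`. -/
noncomputable def kernelK (G : ℝ → Matrix (Fin n) κ ℂ) (p : ℝ × ℝ) : Matrix (Fin n) (Fin n) ℂ :=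
  -Complex.I • (G p.1 * (G p.2)ᴴ)

lemma IsFrame.kernelK_bm (hG : IsFrame l G a) : BoundedMeasurable (kernelK G) :=
  ((hG.bm.comp measurable_fst).matrix_mul (hG.bm.conjTranspose.comp measurable_snd)).smul _

lemma integrable_mulVecL' {p q : Type*} [Fintype p] [Fintype q] [DecidableEq q]
    {M : ℝ → Matrix p q ℂ} (hM : BoundedMeasurable M)
    {f : ℝ → EuclideanSpace ℂ q} {μ : Measure ℝ} (hf : Integrable f μ) :
    Integrable (fun t => mulVecL (M t) (f t)) μ :=
  BoundedMeasurable.integrable_bilin (K := M) (f := f) mulVecL hM hf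

lemma IsFrame.intervalIntegrable (hG : IsFrame l G a) (f : L2 l n) {x : ℝ} (hx : x ∈ Icc 0 l) :
    IntervalIntegrable (fun t => mulVecL (G t)ᴴ (f t)) volume 0 x :=
  intervalIntegrable_of_integrable_vol
    (integrable_mulVecL' hG.bm.conjTranspose (integrableOn_coeFn f)) hx

lemma IsFrame.opK_ae_eq (hG : IsFrame l G a) {K : L2 l n →L[ℂ] L2 l n}
    (hK : HasKernel K (fun _ => 0) (kernelK G)) (f : L2 l n) :
    K f =ᵐ[vol l] fun x => -Complex.I • mulVecL (G x)
      (∫ t in (0 : ℝ)..x, mulVecL (G t)ᴴ (f t)) := by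
  filter_upwards [hK f, ae_vol_mem] with x h1 hx
  rw [h1, map_zero, zero_apply, zero_add]
  simp only [kernelK, mulVecL_smul, intervalIntegral.integral_smul, mulVecL_mul]
  rw [ContinuousLinearMap.intervalIntegral_comp_comm (mulVecL (G x))
    (hG.intervalIntegrable f (Ioc_subset_Icc_self hx))]

/-- The functions `γ(x) (v + ∫₀ˣ γ(t)* q(t) dt)` are boundedly differentiable. -/
lemma IsFrame.hasBoundedDerivative (hG : IsFrame l G a) (hl : 0 ≤ l) (v : EuclideanSpace ℂ κ)
    {q : L2 l n} (hq : ∃ C : ℝ, ∀ᵐ x ∂vol l, ‖q x‖ ≤ C) {f : L2 l n}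
    (hf : f =ᵐ[vol l] fun x => mulVecL (G x) (v + ∫ t in (0 : ℝ)..x, mulVecL (G t)ᴴ (q t))) :
    HasBoundedDerivative f := by
  obtain ⟨u, hu, hqu⟩ := exists_boundedMeasurable hq
  have hGu : BoundedMeasurable fun t => mulVecL (G t)ᴴ (u t) :=
    BoundedMeasurable.bilin (f := fun t => (G t)ᴴ) (g := u) mulVecL hG.bm.conjTranspose hu
  obtain ⟨K, hK⟩ := hGu.exists_lipschitzWith_integral 0
  obtain ⟨L, hL⟩ := hG.bm_deriv.exists_lipschitzWith_integral 0
  have h1 : LipschitzOnWith (0 + L) G (Icc 0 l) := by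
    have h0 := ((LipschitzWith.const (G 0)).add hL).lipschitzOnWith (s := Icc 0 l)
    intro x hx y hy
    rw [hG.prim x hx, hG.prim y hy]
    exact h0 hx hy
  have h2 := ((LipschitzWith.const v).add hK).lipschitzOnWith (s := Icc 0 l)
  obtain ⟨C, -, hC⟩ := hG.bm.bdd
  obtain ⟨D, hD⟩ := isCompact_Icc.exists_bound_of_continuousOn h2.continuousOn
  obtain ⟨M, hM⟩ := exists_lipschitzOnWith_bilin (u := G)
    (v := fun x => v + ∫ t in (0 : ℝ)..x, mulVecL (G t)ᴴ (u t)) mulVecL h1 h2 (fun x _ => hC x) hD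
  refine ⟨_, boundedlyDifferentiableOn_of_lipschitzOnWith hl hM, ?_⟩
  filter_upwards [hf, ae_vol_mem] with x h1 hx
  rw [h1]
  congr 2
  refine integral_congr_ae_vol ?_ (Ioc_subset_Icc_self hx)
  filter_upwards [hqu] with t ht
  rw [ht]

end Frame

/-! ### The factorization of K and the similarity at the level of operators. -/

section Existence

variable {l : ℝ} {n : ℕ} {κ : Type*} [Fintype κ] [DecidableEq κ]
  {G a : ℝ → Matrix (Fin n) κ ℂ}

lemma IsFrame.exists_opK (hG : IsFrame l G a) :
    ∃ K : L2 l n →L[ℂ] L2 l n, HasKernel K (fun _ => 0) (kernelK G) :=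
  exists_hasKernel l (BoundedMeasurable.const 0) hG.kernelK_bm

/-- The factorization `K = A (I + N)`. -/
lemma IsFrame.exists_factorization (hG : IsFrame l G a) {K : L2 l n →L[ℂ] L2 l n}
    (hK : HasKernel K (fun _ => 0) (kernelK G)) :
    ∃ (R : (L2 l n →L[ℂ] L2 l n)ˣ) (j : ℝ × ℝ → Matrix (Fin n) (Fin n) ℂ),
      BoundedMeasurable j ∧ HasKernel R⁻¹.val (fun _ => 1) j ∧ K = opA l n * R.val := by
  -- This is the x-derivative of G(x)G(t)*; as that function equals I on the diagonal, integrating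
  -- in x recovers it from I and its derivative, which is K = A(I + N).
  have hk : BoundedMeasurable fun p : ℝ × ℝ => a p.1 * (G p.2)ᴴ :=
    (hG.bm_deriv.comp measurable_fst).matrix_mul (hG.bm.conjTranspose.comp measurable_snd)
  have h1 : BoundedMeasurable fun _ : ℝ => (1 : Matrix (Fin n) (Fin n) ℂ) := .const 1
  obtain ⟨T, hT⟩ := exists_hasKernel l h1 hk
  obtain ⟨R, hR, j, hj, hRj⟩ := hT.exists_unit h1 h1 hk fun x _ => one_mul 1
  refine ⟨R, j, hj, hRj, ?_⟩
  have hA : HasKernel (opA l n) (fun _ => 0) (fun _ => -Complex.I • 1) := hasKernel_opA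
  have hAT := hA.comp hT h1 (.const _) hk
  rw [hR]
  refine HasKernel.unique hK (hAT.congr (fun x _ => (zero_mul _).symm) fun x t h0 htx hxl => ?_)
  have hGt : G x = G t + ∫ s in t..x, a s :=
    primitive_shift hG.bm_deriv hG.prim h0 x ⟨htx, hxl⟩
  have hi : ∫ s in t..x, (-Complex.I • (1 : Matrix (Fin n) (Fin n) ℂ)) * (a s * (G t)ᴴ) =
      -Complex.I • ((G x - G t) * (G t)ᴴ) := by
    simp only [Matrix.smul_mul, Matrix.one_mul]
    rw [intervalIntegral.integral_smul, hGt, add_sub_cancel_left]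
    congr 1
    exact ContinuousLinearMap.intervalIntegral_comp_comm
      ((ContinuousLinearMap.flip mulL) (G t)ᴴ : LinearCLM (Matrix (Fin n) κ ℂ) _)
      (hG.bm_deriv.intervalIntegrable t x)
  rw [hi, kernelK, Matrix.sub_mul, hG.orth t ⟨h0, htx.trans hxl⟩, zero_mul, zero_add, mul_one,
    ← smul_add, add_sub_cancel]

/-- Existence of the normalized similarity, in terms of kernels. -/
theorem IsFrame.exists_similarity (hG : IsFrame l G a) (hl : 0 ≤ l) {J : Matrix κ (Fin n) ℂ}
    (hJ : IsUnit (G 0 * J).det) {K : L2 l n →L[ℂ] L2 l n}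
    (hK : HasKernel K (fun _ => 0) (kernelK G)) :
    ∃ (E : (L2 l n →L[ℂ] L2 l n)ˣ) (ρ σ : ℝ → Matrix (Fin n) (Fin n) ℂ)
      (e j : ℝ × ℝ → Matrix (Fin n) (Fin n) ℂ),
      BoundedMeasurable ρ ∧ BoundedMeasurable σ ∧ BoundedMeasurable e ∧ BoundedMeasurable j ∧
      (∀ x ∈ Icc 0 l, ρ x = G 0 * J + ∫ s in (0 : ℝ)..x, a s * (G s)ᴴ * ρ s) ∧
      (∀ x ∈ Icc 0 l, σ x * ρ x = 1) ∧ HasKernel E.val ρ e ∧ HasKernel E⁻¹.val σ j ∧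
      K * E.val = E.val * opA l n ∧
      ∀ v, E.val (const l v) =ᵐ[vol l] fun x => mulVecL (G x * J) v := by
  obtain ⟨ρ, σ, hρ, hσ, hρe, hσρ⟩ := exists_linear_solution_inverse l
    (hG.bm_deriv.matrix_mul hG.bm.conjTranspose) hJ
  obtain ⟨e, he, hid, hJe⟩ := hG.exists_kernel hl J hρ hρe
  obtain ⟨T, hT⟩ := exists_hasKernel l hρ he
  obtain ⟨E, rfl, j, hj, hEj⟩ := hT.exists_unit hρ hσ he fun x hx => mul_eq_one_comm.1 (hσρ x hx)
  refine ⟨E, ρ, σ, e, j, hρ, hσ, he, hj, hρe, hσρ, hT, hEj, ?_, fun v => ?_⟩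
  · have hA : HasKernel (opA l n) (fun _ => 0) (fun _ => -Complex.I • 1) := hasKernel_opA
    -- KE and EA both have zero diagonal part, and their kernels are -i times the two sides of the
    -- kernel identity.
    refine HasKernel.unique (hK.comp hT hρ hG.kernelK_bm he)
      ((hT.comp hA (.const 0) he (.const _)).congr (fun x _ => ?_) fun x t h0 htx hxl => ?_)
    · rw [zero_mul, mul_zero]
    · have h1 : ∫ s in t..x, kernelK G (x, s) * e (s, t) =
          -Complex.I • (G x * ∫ s in t..x, (G s)ᴴ * e (s, t)) := by
        have hb : BoundedMeasurable fun s => (G s)ᴴ * e (s, t) :=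
          hG.bm.conjTranspose.matrix_mul (he.comp (g := fun s => (s, t)) (by fun_prop))
        rw [← hb.integral_matrix_mul, ← intervalIntegral.integral_smul]
        simp only [kernelK, Matrix.smul_mul, Matrix.mul_assoc]
      have h2 : ∫ s in t..x, e (x, s) * (-Complex.I • (1 : Matrix (Fin n) (Fin n) ℂ)) =
          -Complex.I • ∫ s in t..x, e (x, s) := by
        rw [← intervalIntegral.integral_smul]
        simp only [Matrix.mul_smul, Matrix.mul_one]
      simp only [zero_mul, zero_add, mul_zero, add_zero]
      rw [h1, h2, kernelK, Matrix.smul_mul, ← smul_add, Matrix.mul_assoc, ← Matrix.mul_add,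
        ← hid x t h0 htx hxl, Matrix.mul_smul, Matrix.mul_one, smul_add]
  · filter_upwards [hT (const l v), const_ae_eq (l := l) v, ae_vol_mem] with x h1 h2 hx
    have hx' := Ioc_subset_Icc_self hx
    have h3 : ∫ t in (0 : ℝ)..x, mulVecL (e (x, t)) ((const l v : L2 l n) t) =
        mulVecL (∫ t in (0 : ℝ)..x, e (x, t)) v := by
      have h4 : (fun t => mulVecL (e (x, t)) ((const l v : L2 l n) t)) =ᵐ[vol l]
          fun t => mulVecL (e (x, t)) v := by
        filter_upwards [const_ae_eq (l := l) v] with t ht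
        rw [ht]
      rw [integral_congr_ae_vol h4 hx']
      exact ContinuousLinearMap.intervalIntegral_comp_comm (mulVecL.flip v)
        ((he.comp (g := fun s => (x, s)) (by fun_prop)).intervalIntegrable 0 x)
    rw [h1, h2, h3, ← add_apply, ← map_add, hJe x hx']

/-- `K` in the form used in the definition of similarity. -/
lemma IsFrame.opK_ae_eq_toLp (hG : IsFrame l G a) {γ : ℝ → Matrix (Fin n) κ ℂ}
    (hγ : ∀ x ∈ Icc 0 l, γ x = G x) {K : L2 l n →L[ℂ] L2 l n}
    (hK : HasKernel K (fun _ => 0) (kernelK G)) (f : L2 l n) :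
    K f =ᵐ[vol l] fun x => WithLp.toLp 2 (γ x *ᵥ
      ∫ t in (0 : ℝ)..x, (-Complex.I • (γ t)ᴴ) *ᵥ (f t).ofLp) := by
  filter_upwards [hG.opK_ae_eq hK f, ae_vol_mem] with x h1 hx
  rw [h1, ← mulVecL_smul_right, ← intervalIntegral.integral_smul, mulVecL_apply]
  congr 2
  · exact (hγ x (Ioc_subset_Icc_self hx)).symm
  · have h2 := toLp_intervalIntegral (fun t => (-Complex.I • (γ t)ᴴ) *ᵥ (f t).ofLp) 0 x
    have h3 : ∫ t in (0 : ℝ)..x, -Complex.I • mulVecL (G t)ᴴ (f t) =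
        ∫ t in (0 : ℝ)..x, (WithLp.toLp 2 ((-Complex.I • (γ t)ᴴ) *ᵥ (f t).ofLp) :
          EuclideanSpace ℂ κ) := by
      refine intervalIntegral.integral_congr fun t ht => ?_
      rw [uIcc_of_le hx.1.le] at ht
      simp only [hγ t ⟨ht.1, ht.2.trans hx.2⟩]
      rw [← mulVecL_smul]
      rfl
    rw [h3, ← h2]

lemma column_ae_eq {γ : ℝ → Matrix (Fin n) κ ℂ} (hγ : BoundedlyDifferentiableOn l γ) (i : κ) :
    column γ hγ i =ᵐ[vol l] fun x => mulVecL (γ x) (EuclideanSpace.single i 1) := by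
  have h : column γ hγ i =ᵐ[vol l] fun x => WithLp.toLp 2 fun r => γ x r i := by
    unfold column ofContinuousOn
    exact MemLp.coeFn_toLp _
  refine h.trans (Filter.Eventually.of_forall fun x => ?_)
  simp only [mulVecL_apply]
  congr 1
  ext r
  simp

end Existence

/-! ### Existence of the normalized similarity. -/

section Main

variable {l : ℝ} {m₁ m₂ : ℕ}

/-- The kernel construction provides the similarity and the normalization. Preservation of bounded
differentiability is proved with operators: such functions are const v + iAq with q essentially
bounded, and E and E⁻¹ exchange A with K. -/
theorem exists_isNormalizedSimilarity (hl : 0 < l)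
    {γ : ℝ → Matrix (Fin m₂) (Fin m₁ ⊕ Fin m₂) ℂ} (hγ : BoundedlyDifferentiableOn l γ)
    (hγγ : ∀ x ∈ Icc 0 l, γ x * (γ x)ᴴ = 1) (hγ₂ : ((γ 0).toCols₂).det ≠ 0) :
    ∃ E : (L2 l m₂ →L[ℂ] L2 l m₂)ˣ, IsNormalizedSimilarity γ hγ E := by
  obtain ⟨G, a, hG, -, hγG, hder⟩ := exists_frame hl.le hγ hγγ
  -- Right multiplication by J picks out γ₂, so G(0)J is invertible by hypothesis.
  set J : Matrix (Fin m₁ ⊕ Fin m₂) (Fin m₂) ℂ := Matrix.fromRows 0 1 with hJ_def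
  have hMJ : ∀ M : Matrix (Fin m₂) (Fin m₁ ⊕ Fin m₂) ℂ, M * J = M.toCols₂ := fun M => by
    conv_lhs => rw [← Matrix.fromCols_toCols M]
    rw [hJ_def, Matrix.fromCols_mul_fromRows, Matrix.mul_zero, zero_add, Matrix.mul_one]
  have h00 : (0 : ℝ) ∈ Icc 0 l := ⟨le_rfl, hl.le⟩
  have hdet : IsUnit (G 0 * J).det := by
    rw [hMJ, ← hγG 0 h00]
    exact isUnit_iff_ne_zero.2 hγ₂
  obtain ⟨K, hK⟩ := hG.exists_opK
  obtain ⟨R, jR, hjR, hRj, hKR⟩ := hG.exists_factorization hK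
  obtain ⟨E, ρ, σ, e, j, hρ, hσ, he, hj, hρe, hσρ, hEk, hEj, hKE, hEc⟩ :=
    hG.exists_similarity hl.le hdet hK
  have hρ0 : ρ 0 = G 0 * J := by simpa using hρe 0 h00
  have hP : BoundedMeasurable fun s => a s * (G s)ᴴ * ρ s :=
    (hG.bm_deriv.matrix_mul hG.bm.conjTranspose).matrix_mul hρ
  have hEA : E.val * opA l m₂ * E⁻¹.val = K := by
    rw [← hKE, mul_assoc, Units.mul_inv, mul_one]
  have hAE : E⁻¹.val * K = opA l m₂ * E⁻¹.val := by
    rw [← hEA, ← mul_assoc, ← mul_assoc, Units.inv_mul, one_mul]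
  refine ⟨E, ⟨⟨fun f => ?_, ⟨ρ, ?_, ?_, ?_, hEk.isTriangular he, ?_⟩, fun f hf => ?_,
    fun f hf => ?_⟩, fun i => ?_⟩⟩
  · rw [hEA]
    exact hG.opK_ae_eq_toLp hγG hK f
  · obtain ⟨L, hL⟩ := hP.exists_lipschitzWith_integral 0
    refine LipschitzOnWith.absolutelyContinuousOnInterval (K := 0 + L) ?_
    rw [uIcc_of_le hl.le]
    have h0 := ((LipschitzWith.const (G 0 * J)).add hL).lipschitzOnWith (s := Icc 0 l)
    intro x hx y hy
    rw [hρe x hx, hρe y hy]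
    exact h0 hx hy
  · rw [hρ0]
    exact hdet.ne_zero
  · have hne : ∀ᵐ x : ℝ, x ≠ l := by simp [ae_iff, measure_singleton]
    filter_upwards [hder, ae_restrict_of_ae hP.ae_hasDerivAt_integral, ae_restrict_of_ae hne,
      ae_vol_mem] with x h1 h2 h3 hx
    have h4 : HasDerivAt ρ (a x * (G x)ᴴ * ρ x) x := by
      refine ((h2 0).const_add (G 0 * J)).congr_of_eventuallyEq ?_
      filter_upwards [Icc_mem_nhds hx.1 (lt_of_le_of_ne hx.2 h3)] with y hy
      exact hρe y hy
    convert h4 using 1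
    rw [h1.deriv, hγG x (Ioc_subset_Icc_self hx)]
    simp [Matrix.mul_smul, smul_smul]
  · refine (hEj.congr (fun x hx => ?_) fun _ _ _ _ _ => rfl).isTriangular hj
    exact Matrix.inv_eq_left_inv (hσρ x (Ioc_subset_Icc_self hx))
  -- From EA = KE, Ef = GJv + iKEq = G(Jv + ∫ G*Eq), a product of Lipschitz functions because Eq is
  -- again essentially bounded.
  · obtain ⟨v, q, hq, rfl⟩ := (hasBoundedDerivative_iff hl.le f).1 hf
    have hEq := hEk.exists_bound hρ he hq
    refine hG.hasBoundedDerivative hl.le (mulVecL J v) hEq ?_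
    have h1 : E.val (const l v + Complex.I • opA l m₂ q) =
        E.val (const l v) + Complex.I • K (E.val q) := by
      rw [map_add, map_smul]
      congr 2
      exact (DFunLike.congr_fun hKE q).symm
    rw [h1]
    filter_upwards [Lp.coeFn_add (E.val (const l v)) (Complex.I • K (E.val q)), hEc v,
      Lp.coeFn_smul Complex.I (K (E.val q)), hG.opK_ae_eq hK (E.val q)] with x h2 h3 h4 h5
    rw [h2, Pi.add_apply, h3, h4, Pi.smul_apply, h5, smul_smul, map_add, mulVecL_mul]
    simp
  · obtain ⟨v, q, hq, rfl⟩ := (hasBoundedDerivative_iff hl.le f).1 hf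
    -- With this c the function E(const c) = GJc has the value v at 0, so f - E(const c) = iA(q - p)
    -- with p = aJc. The factorization rewrites A(q - p) as K R⁻¹(q - p), and E⁻¹K = AE⁻¹ makes E⁻¹f
    -- a constant plus a primitive.
    set c := mulVecL (G 0 * J)⁻¹ v with hc_def
    have hb : BoundedMeasurable fun s => mulVecL (a s * J) c :=
      (hG.bm_deriv.matrix_mul (.const J)).clm (mulVecL.flip c)
    obtain ⟨p, hp, hpb⟩ := hb.exists_L2 l
    have hqp : ∃ C : ℝ, ∀ᵐ x ∂vol l, ‖(q - p) x‖ ≤ C := by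
      obtain ⟨C, hC⟩ := hq
      obtain ⟨D, hD⟩ := hpb
      refine ⟨C + D, ?_⟩
      filter_upwards [hC, hD, Lp.coeFn_sub q p] with x h1 h2 h3
      rw [h3, Pi.sub_apply]
      exact (norm_sub_le _ _).trans (add_le_add h1 h2)
    have h1 : (const l v + Complex.I • opA l m₂ q : L2 l m₂) =
        E.val (const l c) + Complex.I • opA l m₂ (q - p) := by
      refine Lp.ext ?_
      filter_upwards [const_add_opA_ae_eq v q, hEc c, I_smul_opA_ae_eq q, I_smul_opA_ae_eq p,
        Lp.coeFn_add (E.val (const l c)) (Complex.I • opA l m₂ (q - p)),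
        Lp.coeFn_sub (Complex.I • opA l m₂ q) (Complex.I • opA l m₂ p), ae_vol_mem]
        with x h1 h2 h3 h4 h5 h6 hx
      have hx' := Ioc_subset_Icc_self hx
      rw [h1, h5, Pi.add_apply, h2, map_sub, smul_sub, h6, Pi.sub_apply, h3, h4,
        integral_congr_ae_vol hp hx', hG.prim x hx', Matrix.add_mul, map_add, add_apply]
      have h7 : ∫ t in (0 : ℝ)..x, mulVecL (a t * J) c =
          mulVecL ((∫ t in (0 : ℝ)..x, a t) * J) c :=
        ContinuousLinearMap.intervalIntegral_comp_comm
          ((ContinuousLinearMap.flip mulVecL c : LinearCLM (Matrix (Fin m₂) (Fin m₂) ℂ) _).comp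
            (ContinuousLinearMap.flip mulL J :
              LinearCLM (Matrix (Fin m₂) (Fin m₁ ⊕ Fin m₂) ℂ) (Matrix (Fin m₂) (Fin m₂) ℂ)))
          (hG.bm_deriv.intervalIntegrable 0 x)
      rw [h7, hc_def, ← mulVecL_mul (G 0 * J), Matrix.mul_nonsing_inv _ hdet, mulVecL_one]
      abel
    have hAR : opA l m₂ (q - p) = K (R⁻¹.val (q - p)) := by
      rw [hKR]
      change _ = opA l m₂ ((R.val * R⁻¹.val) (q - p))
      rw [Units.mul_inv]
      rfl
    refine (hasBoundedDerivative_iff hl.le _).2 ⟨c, E⁻¹.val (R⁻¹.val (q - p)),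
      hEj.exists_bound hσ hj (hRj.exists_bound (.const 1) hjR hqp), ?_⟩
    rw [h1, map_add, map_smul, hAR]
    congr 1
    · change (E⁻¹.val * E.val) (const l c) = _
      rw [Units.inv_mul]
      rfl
    · congr 1
      exact DFunLike.congr_fun hAE (R⁻¹.val (q - p))
  · have h1 : column γ hγ (Sum.inr i) = E.val (const l (EuclideanSpace.single i 1)) := by
      refine Lp.ext ?_
      filter_upwards [column_ae_eq hγ (Sum.inr i), hEc (EuclideanSpace.single i 1), ae_vol_mem]
        with x h1 h2 hx
      rw [h1, h2, hMJ, hγG x (Ioc_subset_Icc_self hx), mulVecL_apply, mulVecL_apply]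
      congr 1
      ext r
      simp [Matrix.toCols₂]
    rw [h1]
    change (E⁻¹.val * E.val) _ = _
    rw [Units.inv_mul]
    rfl

end Main

/-! ### Restriction, extension by zero and compressions. -/

section Restriction

variable {r l : ℝ} {n : ℕ}

lemma restr_ae_eq (h : r ≤ l) (f : L2 l n) : restr n h f =ᵐ[vol r] f :=
  ((Lp.memLp f).mono_measure
    (Measure.restrict_mono (Ioc_subset_Ioc_right h) le_rfl)).coeFn_toLp

lemma restr_eq_iff (h : r ≤ l) (f g : L2 l n) :
    restr n h f = restr n h g ↔ f =ᵐ[vol r] g := by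
  constructor
  · intro hfg
    refine (restr_ae_eq h f).symm.trans ?_
    rw [hfg]
    exact restr_ae_eq h g
  · intro hfg
    exact Lp.ext (((restr_ae_eq h f).trans hfg).trans (restr_ae_eq h g).symm)

lemma restr_adjoint_ae_eq (h : r ≤ l) (f : L2 r n) :
    (restr n h).adjoint f =ᵐ[vol l] (Ioc 0 r).indicator f := by
  have hv : (vol l).restrict (Ioc 0 r) = vol r := by
    rw [Measure.restrict_restrict measurableSet_Ioc,
      inter_eq_self_of_subset_left (Ioc_subset_Ioc_right h)]
  have hm : MemLp ((Ioc 0 r).indicator f) 2 (vol l) := by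
    rw [memLp_indicator_iff_restrict measurableSet_Ioc, hv]
    exact Lp.memLp f
  have he : (restr n h).adjoint f = hm.toLp := by
    refine ext_inner_right ℂ fun g => ?_
    rw [ContinuousLinearMap.adjoint_inner_left, L2.inner_def, L2.inner_def]
    have h1 : ∫ x, inner ℂ ((hm.toLp : L2 l n) x) (g x) ∂vol l =
        ∫ x, (Ioc 0 r).indicator (fun x => inner ℂ (f x) (g x)) x ∂vol l := by
      refine integral_congr_ae ?_
      filter_upwards [hm.coeFn_toLp] with x hx
      rw [hx]
      by_cases hxr : x ∈ Ioc 0 r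
      · rw [indicator_of_mem hxr, indicator_of_mem hxr]
      · rw [indicator_of_notMem hxr, indicator_of_notMem hxr, inner_zero_left]
    rw [h1, integral_indicator measurableSet_Ioc, hv]
    refine integral_congr_ae ?_
    filter_upwards [restr_ae_eq h g] with x hx
    rw [hx]
  rw [he]
  exact hm.coeFn_toLp

lemma restr_comp_adjoint (h : r ≤ l) :
    restr n h ∘L (restr n h).adjoint = 1 := by
  refine ContinuousLinearMap.ext fun f => Lp.ext ?_
  have h1 : (restr n h).adjoint f =ᵐ[vol r] (Ioc 0 r).indicator f :=
    ae_mono (Measure.restrict_mono (Ioc_subset_Ioc_right h) le_rfl) (restr_adjoint_ae_eq h f)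
  refine (restr_ae_eq h _).trans (h1.trans ?_)
  filter_upwards [ae_vol_mem] with x hx
  rw [indicator_of_mem hx]
  rfl

/-- A triangular operator commutes with restriction. -/
lemma IsTriangular.restr_comp {T : L2 l n →L[ℂ] L2 l n} {ρ : ℝ → Matrix (Fin n) (Fin n) ℂ}
    (hT : IsTriangular T ρ) (h : r ≤ l) : restr n h ∘L T = compr h T ∘L restr n h := by
  obtain ⟨k, -, -, hk⟩ := hT
  refine ContinuousLinearMap.ext fun f => ?_
  refine (restr_eq_iff h _ _).2 ?_
  -- g agrees with f on (0, r), and at x ≤ r a triangular operator sees only these values.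
  set g := (restr n h).adjoint (restr n h f) with hg_def
  have hfg : f =ᵐ[vol r] g := by
    refine (restr_eq_iff h _ _).1 ?_
    exact (DFunLike.congr_fun (restr_comp_adjoint h) (restr n h f)).symm
  have hle : vol r ≤ vol l := Measure.restrict_mono (Ioc_subset_Ioc_right h) le_rfl
  change T f =ᵐ[vol r] T g
  filter_upwards [ae_mono hle (hk f), ae_mono hle (hk g), hfg, ae_vol_mem] with x h1 h2 h3 hx
  rw [h1, h2, h3]
  congr 2
  refine integral_congr_ae_vol (l := r) ?_ (Ioc_subset_Icc_self hx)
  filter_upwards [hfg] with t ht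
  rw [ht]

/-- Compression is not multiplicative in general; it suffices that the left factor is causal, and
nothing is asked of S, which allows S to be the adjoint of a triangular operator. -/
lemma compr_mul (h : r ≤ l) {T : L2 l n →L[ℂ] L2 l n}
    (hT : restr n h ∘L T = compr h T ∘L restr n h) (S : L2 l n →L[ℂ] L2 l n) :
    compr h (T * S) = compr h T * compr h S := by
  rw [ContinuousLinearMap.mul_def, ContinuousLinearMap.mul_def]
  calc restr n h ∘L (T ∘L S) ∘L (restr n h).adjoint
      = (restr n h ∘L T) ∘L S ∘L (restr n h).adjoint := by
        simp only [ContinuousLinearMap.comp_assoc]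
    _ = compr h T ∘L compr h S := by rw [hT, ContinuousLinearMap.comp_assoc]; rfl

lemma compr_one (h : r ≤ l) : compr h (1 : L2 l n →L[ℂ] L2 l n) = 1 := by
  rw [compr, ContinuousLinearMap.one_def, ContinuousLinearMap.id_comp, restr_comp_adjoint]

lemma compr_adjoint (h : r ≤ l) (T : L2 l n →L[ℂ] L2 l n) :
    compr h (star T) = star (compr h T) := by
  rw [ContinuousLinearMap.star_eq_adjoint, ContinuousLinearMap.star_eq_adjoint,
    ContinuousLinearMap.eq_adjoint_iff]
  intro f g
  change inner ℂ (restr n h (T.adjoint ((restr n h).adjoint f))) g =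
    inner ℂ f (restr n h (T ((restr n h).adjoint g)))
  rw [← ContinuousLinearMap.adjoint_inner_right (restr n h),
    ContinuousLinearMap.adjoint_inner_left, ContinuousLinearMap.adjoint_inner_left (restr n h)]

/-- The compression of an invertible operator that commutes with the restriction together with its
inverse. -/
lemma exists_compr_unit (h : r ≤ l) {U : (L2 l n →L[ℂ] L2 l n)ˣ}
    (hU : restr n h ∘L U.val = compr h U.val ∘L restr n h)
    (hU' : restr n h ∘L U⁻¹.val = compr h U⁻¹.val ∘L restr n h) :
    ∃ V : (L2 r n →L[ℂ] L2 r n)ˣ, V.val = compr h U.val ∧ V⁻¹.val = compr h U⁻¹.val :=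
  ⟨⟨compr h U.val, compr h U⁻¹.val,
    by rw [← compr_mul h hU, Units.mul_inv, compr_one],
    by rw [← compr_mul h hU', Units.inv_mul, compr_one]⟩, rfl, rfl⟩

end Restriction

/-! ### The operator identity and the imaginary part of K. -/

section SNode

/-- The operator identity for an operator similar to one with imaginary part `-½ Γ Γ*`. -/
lemma isSNode_of_similar {H : Type*} [NormedAddCommGroup H] [InnerProductSpace ℂ H]
    [CompleteSpace H] {κ : Type*} [Fintype κ] {A K : H →L[ℂ] H} {E : (H →L[ℂ] H)ˣ}
    {Γ : EuclideanSpace ℂ κ →L[ℂ] H} (hEA : E.val * A * E⁻¹.val = K)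
    (hK : K.adjoint = K + Complex.I • (Γ ∘L Γ.adjoint)) :
    IsSNode A (E⁻¹ * (star E)⁻¹).val (E⁻¹.val ∘L Γ) := by
  have hAE : A * E⁻¹.val = E⁻¹.val * K := by
    rw [← hEA, ← mul_assoc, ← mul_assoc, Units.inv_mul, one_mul]
  have hs : ((star E)⁻¹).val = E⁻¹.val.adjoint := by
    rw [← ContinuousLinearMap.star_eq_adjoint]
    rfl
  have hEA' : E⁻¹.val.adjoint * A.adjoint = K.adjoint * E⁻¹.val.adjoint := by
    have := congrArg ContinuousLinearMap.adjoint hAE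
    simpa only [ContinuousLinearMap.mul_def, ContinuousLinearMap.adjoint_comp] using this
  unfold IsSNode
  rw [Units.val_mul, hs, ContinuousLinearMap.adjoint_comp]
  have h1 : A ∘L (E⁻¹.val * E⁻¹.val.adjoint) = E⁻¹.val * K * E⁻¹.val.adjoint := by
    rw [← hAE]
    rfl
  have h2 : (E⁻¹.val * E⁻¹.val.adjoint) ∘L A.adjoint = E⁻¹.val * K.adjoint * E⁻¹.val.adjoint := by
    rw [mul_assoc, ← hEA']
    rfl
  rw [h1, h2, ← sub_mul, ← mul_sub, hK, sub_add_cancel_left]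
  refine ContinuousLinearMap.ext fun f => ?_
  simp

end SNode

section Frame

variable {l : ℝ} {n : ℕ} {κ : Type*} [Fintype κ] [DecidableEq κ]
  {G a : ℝ → Matrix (Fin n) κ ℂ}

lemma inner_mulVecL {p q : Type*} [Fintype p] [Fintype q] [DecidableEq p] [DecidableEq q]
    (M : Matrix p q ℂ) (v : EuclideanSpace ℂ q) (w : EuclideanSpace ℂ p) :
    inner ℂ (mulVecL M v) w = inner ℂ v (mulVecL Mᴴ w) := by
  simp only [mulVecL_apply, EuclideanSpace.inner_eq_star_dotProduct]
  rw [Matrix.star_mulVec, dotProduct_comm, ← Matrix.dotProduct_mulVec, dotProduct_comm]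

lemma adjoint_apply_of_ae_eq (hl : 0 ≤ l) (hG : BoundedMeasurable G)
    {Γ : EuclideanSpace ℂ κ →L[ℂ] L2 l n}
    (hΓ : ∀ g, Γ g =ᵐ[vol l] fun x => mulVecL (G x) g) (f : L2 l n) :
    Γ.adjoint f = ∫ t in (0 : ℝ)..l, mulVecL (G t)ᴴ (f t) := by
  refine ext_inner_left ℂ fun g => ?_
  rw [ContinuousLinearMap.adjoint_inner_right, L2.inner_def,
    intervalIntegral.integral_of_le hl, ← integral_inner
      (integrable_mulVecL' hG.conjTranspose (integrableOn_coeFn f))]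
  refine integral_congr_ae ?_
  filter_upwards [hΓ g] with x hx
  rw [hx, inner_mulVecL]

/-- Integration by parts in sesquilinear form. -/
lemma integral_inner_primitive {F : Type*} [NormedAddCommGroup F] [InnerProductSpace ℂ F]
    [CompleteSpace F] (hl : 0 ≤ l) {p q : ℝ → F} (hp : Integrable p (vol l))
    (hq : Integrable q (vol l)) :
    ∫ x in (0 : ℝ)..l, inner ℂ (p x) (∫ t in (0 : ℝ)..x, q t) =
      ∫ x in (0 : ℝ)..l, inner ℂ ((∫ t in (0 : ℝ)..l, p t) - ∫ t in (0 : ℝ)..x, p t) (q x) := by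
  have hp' : ∀ x ∈ Icc 0 l, IntervalIntegrable p volume 0 x := fun x hx =>
    intervalIntegrable_of_integrable_vol hp hx
  have hq' : ∀ x ∈ Icc 0 l, IntervalIntegrable q volume 0 x := fun x hx =>
    intervalIntegrable_of_integrable_vol hq hx
  have hl' : l ∈ Icc 0 l := ⟨hl, le_rfl⟩
  have hH : Integrable (Function.uncurry fun s t => (inner ℂ (p s) (q t) : ℂ))
      ((vol l).prod (vol l)) := by
    refine (hp.norm.mul_prod hq.norm).mono' ?_ (ae_of_all _ fun z => norm_inner_le_norm _ _)
    exact (hp.1.comp_fst).inner (hq.1.comp_snd)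
  calc ∫ x in (0 : ℝ)..l, inner ℂ (p x) (∫ t in (0 : ℝ)..x, q t)
      = ∫ s in (0 : ℝ)..l, ∫ t in (0 : ℝ)..s, inner ℂ (p s) (q t) := by
        refine intervalIntegral.integral_congr fun s hs => ?_
        rw [uIcc_of_le hl] at hs
        exact ((innerSL ℂ (p s)).intervalIntegral_comp_comm (hq' s hs)).symm
    _ = ∫ t in (0 : ℝ)..l, ∫ s in t..l, inner ℂ (p s) (q t) := integral_triangle_swap hl hH
    _ = _ := by
        refine intervalIntegral.integral_congr fun t ht => ?_
        rw [uIcc_of_le hl] at ht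
        have ht' : IntervalIntegrable p volume t l := (hp' t ht).symm.trans (hp' l hl')
        rw [intervalIntegral.integral_interval_sub_left (hp' l hl') (hp' t ht), ← inner_conj_symm,
          ← innerSL_apply_apply ℂ (q t), ← (innerSL ℂ (q t)).intervalIntegral_comp_comm ht',
          intervalIntegral.integral_of_le ht.2, intervalIntegral.integral_of_le ht.2,
          ← integral_conj]
        simp only [innerSL_apply_apply, inner_conj_symm]

/-- The imaginary part of `K`. -/
lemma IsFrame.adjoint_opK (hG : IsFrame l G a) (hl : 0 ≤ l) {K : L2 l n →L[ℂ] L2 l n}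
    (hK : HasKernel K (fun _ => 0) (kernelK G)) {Γ : EuclideanSpace ℂ κ →L[ℂ] L2 l n}
    (hΓ : ∀ g, Γ g =ᵐ[vol l] fun x => mulVecL (G x) g) :
    K.adjoint = K + Complex.I • (Γ ∘L Γ.adjoint) := by
  symm
  rw [ContinuousLinearMap.eq_adjoint_iff]
  intro u f
  have hint : ∀ v : L2 l n, Integrable (fun t => mulVecL (G t)ᴴ (v t)) (vol l) := fun v =>
    integrable_mulVecL' hG.bm.conjTranspose (integrableOn_coeFn v)
  -- Integration by parts gives K*u = iG(x) ∫_x^l G*u; splitting the integral as ∫_0^l - ∫_0^x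
  -- produces iΓΓ*u + Ku.
  have key := congrArg (fun c => -Complex.I * c) (integral_inner_primitive hl (hint u) (hint f))
  simp only [← intervalIntegral.integral_const_mul] at key
  rw [intervalIntegral.integral_of_le hl, intervalIntegral.integral_of_le hl] at key
  rw [L2.inner_def, L2.inner_def]
  refine Eq.trans ?_ (key.symm.trans ?_)
  · refine integral_congr_ae ?_
    filter_upwards [Lp.coeFn_add (K u) (Complex.I • Γ (Γ.adjoint u)),
      Lp.coeFn_smul Complex.I (Γ (Γ.adjoint u)), hG.opK_ae_eq hK u, hΓ (Γ.adjoint u)]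
      with x h1 h2 h3 h4
    have h5 : ((K + Complex.I • (Γ ∘L Γ.adjoint)) u : L2 l n) x =
        Complex.I • mulVecL (G x) ((∫ t in (0 : ℝ)..l, mulVecL (G t)ᴴ (u t)) -
          ∫ t in (0 : ℝ)..x, mulVecL (G t)ᴴ (u t)) := by
      refine h1.trans ?_
      rw [Pi.add_apply, h2, Pi.smul_apply, h3, h4, adjoint_apply_of_ae_eq hl hG.bm hΓ, map_sub,
        smul_sub, neg_smul]
      abel
    rw [h5, inner_smul_left, inner_mulVecL, Complex.conj_I]
  · refine integral_congr_ae ?_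
    filter_upwards [hG.opK_ae_eq hK f] with x h1
    rw [h1, inner_smul_right, inner_mulVecL, Matrix.conjTranspose_conjTranspose]

end Frame

lemma continuousOn_bilin {U V W : Type*} [NormedAddCommGroup U] [NormedAddCommGroup V]
    [NormedAddCommGroup W] [NormedSpace ℝ U] [NormedSpace ℝ V] [NormedSpace ℝ W]
    (B : U →L[ℝ] V →L[ℝ] W) {f : ℝ → U} {g : ℝ → V} {s : Set ℝ} (hf : ContinuousOn f s)
    (hg : ContinuousOn g s) : ContinuousOn (fun t => B (f t) (g t)) s :=
  B.continuous₂.comp_continuousOn (hf.prodMk hg)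

lemma continuousOn_mulVecL {p q : Type*} [Fintype p] [Fintype q] [DecidableEq q]
    {M : ℝ → Matrix p q ℂ} {v : ℝ → EuclideanSpace ℂ q} {s : Set ℝ} (hM : ContinuousOn M s)
    (hv : ContinuousOn v s) : ContinuousOn (fun t => mulVecL (M t) (v t)) s :=
  continuousOn_bilin (f := M) (g := v) mulVecL hM hv

/-! ### The differential system. -/

section FundamentalSolution

variable {l : ℝ} {n : ℕ} {κ : Type*} [Fintype κ] [DecidableEq κ]
  {γ G a : ℝ → Matrix (Fin n) κ ℂ}

/-- Because G is continuous, a bounded measurable solution of the integral equation can be improved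
to one that is differentiable at every point. -/
theorem IsFrame.exists_isFundamentalSolution (hG : IsFrame l G a) (hGc : Continuous G)
    (hγ : ∀ x ∈ Icc 0 l, γ x = G x) (z : ℂ) :
    ∃ w : ℝ → Matrix κ κ ℂ, IsFundamentalSolution l γ z w := by
  set A : ℝ → Matrix κ κ ℂ := fun x => -(Complex.I * z) • ((G x)ᴴ * G x) with hA_def
  have hA : BoundedMeasurable A := (hG.bm.conjTranspose.matrix_mul hG.bm).smul _
  have hAc : Continuous A :=
    (continuous_const_smul _).comp (hGc.matrix_conjTranspose.matrix_mul hGc)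
  obtain ⟨Y, hY, hYe⟩ := exists_linear_solution l hA (1 : Matrix κ κ ℂ)
  -- Y is only measurable as a function on the line. W agrees with it on [0, l] and is continuous,
  -- so the fundamental theorem of calculus applies once more, also at the endpoints.
  set W : ℝ → Matrix κ κ ℂ := fun x => 1 + ∫ s in (0 : ℝ)..x, A s * Y s with hW_def
  have hWc : Continuous W := continuous_const.add ((hA.matrix_mul hY).continuous_integral 0)
  have hAW : Continuous fun s => A s * W s := hAc.matrix_mul hWc
  have hV : ∀ x ∈ Icc 0 l, W x = 1 + ∫ s in (0 : ℝ)..x, A s * W s := by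
    intro x hx
    simp only [hW_def]
    congr 1
    refine intervalIntegral.integral_congr fun s hs => ?_
    rw [uIcc_of_le hx.1] at hs
    rw [← hYe s ⟨hs.1, hs.2.trans hx.2⟩]
  refine ⟨fun x => 1 + ∫ s in (0 : ℝ)..x, A s * W s, by simp, fun x hx => ?_⟩
  have h1 : HasDerivAt (fun x => 1 + ∫ s in (0 : ℝ)..x, A s * W s) (A x * W x) x :=
    (intervalIntegral.integral_hasDerivAt_right (hAW.intervalIntegrable _ _)
      (hAW.stronglyMeasurableAtFilter _ _) hAW.continuousAt).const_add _
  have h2 : -(Complex.I * z) • ((γ x)ᴴ * γ x * (1 + ∫ s in (0 : ℝ)..x, A s * W s)) =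
      A x * W x := by
    rw [← hV x hx, hγ x hx, hA_def, Matrix.smul_mul]
  rw [h2]
  exact h1.hasDerivWithinAt

/-- The differential equation is used only in this integrated form, so the transfer formula holds
for every solution without a uniqueness theorem. -/
lemma IsFundamentalSolution.mulVecL_eq {w : ℝ → Matrix κ κ ℂ} {z : ℂ}
    (hw : IsFundamentalSolution l γ z w) (hGc : Continuous G) (hγ : ∀ x ∈ Icc 0 l, γ x = G x)
    (g : EuclideanSpace ℂ κ) {x : ℝ} (hx : x ∈ Icc 0 l) :
    mulVecL (w x) g = g - (Complex.I * z) •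
      ∫ t in (0 : ℝ)..x, mulVecL (G t)ᴴ (mulVecL (G t) (mulVecL (w t) g)) := by
  have hsub : Icc 0 x ⊆ Icc 0 l := Icc_subset_Icc_right hx.2
  have hd : ∀ t ∈ Icc 0 l, HasDerivWithinAt (fun t => mulVecL (w t) g)
      (-(Complex.I * z) • mulVecL (G t)ᴴ (mulVecL (G t) (mulVecL (w t) g))) (Icc 0 l) t := by
    intro t ht
    have h1 := (ContinuousLinearMap.flip mulVecL g :
      LinearCLM (Matrix κ κ ℂ) (EuclideanSpace ℂ κ)).hasFDerivAt.comp_hasDerivWithinAt t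
        (hw.2 t ht)
    rw [hγ t ht, ContinuousLinearMap.flip_apply, mulVecL_smul, mulVecL_mul, mulVecL_mul] at h1
    exact h1
  have hc : ContinuousOn (fun t => mulVecL (w t) g) (Icc 0 x) :=
    fun t ht => ((hd t (hsub ht)).continuousWithinAt).mono hsub
  have hi : ContinuousOn (fun t => -(Complex.I * z) •
      mulVecL (G t)ᴴ (mulVecL (G t) (mulVecL (w t) g))) (Icc 0 x) := by
    have h1 : ContinuousOn (fun t => mulVecL (G t) (mulVecL (w t) g)) (Icc 0 x) :=
      continuousOn_mulVecL hGc.continuousOn hc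
    exact (continuous_const_smul _).comp_continuousOn
      (continuousOn_mulVecL hGc.matrix_conjTranspose.continuousOn h1)
  have h := intervalIntegral.integral_eq_sub_of_hasDerivAt_of_le hx.1 hc
    (fun t ht => (hd t (hsub (Ioo_subset_Icc_self ht))).hasDerivAt
      (Icc_mem_nhds ht.1 (ht.2.trans_le hx.2)))
    (hi.intervalIntegrable_of_Icc hx.1)
  rw [intervalIntegral.integral_smul, hw.1, mulVecL_one] at h
  rw [sub_eq_add_neg, ← neg_smul, h]
  abel

end FundamentalSolution

/-! ### The transfer matrix function. -/

section Transfer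

variable {r l : ℝ} {n : ℕ}

lemma compr_one_sub_smul (h : r ≤ l) (z : ℂ) (T : L2 l n →L[ℂ] L2 l n) :
    compr h (1 - z • T) = 1 - z • compr h T := by
  rw [← compr_one h]
  refine ContinuousLinearMap.ext fun f => ?_
  change restr n h ((restr n h).adjoint f - z • T ((restr n h).adjoint f)) =
    restr n h ((restr n h).adjoint f) - z • restr n h (T ((restr n h).adjoint f))
  rw [map_sub, map_smul]

/-- I - zA is triangular with diagonal part I, hence invertible for every z with triangular inverse;
both commute with restriction, so the compression is invertible too. -/
lemma exists_one_sub_smul_opA_unit (h : r ≤ l) (z : ℂ) :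
    ∃ V : (L2 r n →L[ℂ] L2 r n)ˣ, V.val = 1 - z • compr h (opA l n) ∧
      ∀ f, restr n h ((1 - z • opA l n) f) = V.val (restr n h f) := by
  have hk : BoundedMeasurable fun _ : ℝ × ℝ =>
      (0 : Matrix (Fin n) (Fin n) ℂ) + (-z) • (-Complex.I • (1 : Matrix (Fin n) (Fin n) ℂ)) :=
    .const _
  have hT : HasKernel (1 - z • opA l n) (fun _ => 1)
      fun _ => 0 + (-z) • (-Complex.I • (1 : Matrix (Fin n) (Fin n) ℂ)) := by
    rw [sub_eq_add_neg, ← neg_smul]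
    refine (hasKernel_one.add (hasKernel_opA.smul (-z)) (.const 0)
      (BoundedMeasurable.const _)).congr (fun _ _ => ?_) fun _ _ _ _ _ => rfl
    simp
  obtain ⟨U, hU, j, hj, hUj⟩ := hT.exists_unit (.const 1) (.const 1) hk fun _ _ => one_mul _
  have h1 : restr n h ∘L U.val = compr h U.val ∘L restr n h := by
    rw [hU]
    exact (hT.isTriangular hk).restr_comp h
  obtain ⟨V, hV, -⟩ := exists_compr_unit h h1 ((hUj.isTriangular hj).restr_comp h)
  refine ⟨V, by rw [hV, hU, compr_one_sub_smul], fun f => ?_⟩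
  rw [hV, ← hU]
  exact DFunLike.congr_fun h1 f

variable {κ : Type*} [Fintype κ] [DecidableEq κ] {γ G a : ℝ → Matrix (Fin n) κ ℂ}

lemma transferMatrix_eq_of_forall (h : r ≤ l) {A S : L2 l n →L[ℂ] L2 l n}
    {P : EuclideanSpace ℂ κ →L[ℂ] L2 l n} {z : ℂ} {M : Matrix κ κ ℂ}
    (hM : ∀ g, mulVecL M g = g - (Complex.I * z) • P.adjoint ((restr n h).adjoint
      (Ring.inverse (compr h S) (Ring.inverse (1 - z • compr h A) (restr n h (P g)))))) :
    M = transferMatrix h A S P z := by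
  rw [transferMatrix, eq_comm, StarAlgEquiv.symm_apply_eq]
  refine ContinuousLinearMap.ext fun g => ?_
  exact (hM g).symm

/-- The transfer matrix function of the node generated by a triangular similarity of `K` to `A`
is the fundamental solution. -/
theorem IsFrame.isUnit_and_transferMatrix (hG : IsFrame l G a) (hGc : Continuous G)
    (hγ : ∀ x ∈ Icc 0 l, γ x = G x) {K : L2 l n →L[ℂ] L2 l n}
    (hK : HasKernel K (fun _ => 0) (kernelK G)) {Γ : EuclideanSpace ℂ κ →L[ℂ] L2 l n}
    (hΓ : ∀ g, Γ g =ᵐ[vol l] fun x => mulVecL (G x) g) {E : (L2 l n →L[ℂ] L2 l n)ˣ}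
    (hEA : E.val * opA l n * E⁻¹.val = K) {ρ σ : ℝ → Matrix (Fin n) (Fin n) ℂ}
    (hE : IsTriangular E.val ρ) (hE' : IsTriangular E⁻¹.val σ) {z : ℂ} {w : ℝ → Matrix κ κ ℂ}
    (hw : IsFundamentalSolution l γ z w) (hr : 0 < r) (h : r ≤ l) :
    IsUnit (compr h (opS E)) ∧ IsUnit (1 - z • compr h (opA l n)) ∧
      w r = transferMatrix h (opA l n) (opS E) (E⁻¹.val ∘L Γ) z := by
  have hle : vol r ≤ vol l := Measure.restrict_mono (Ioc_subset_Ioc_right h) le_rfl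
  obtain ⟨V, hV, hVP⟩ := exists_one_sub_smul_opA_unit (n := n) h z
  obtain ⟨F, hF, hF'⟩ := exists_compr_unit h (hE.restr_comp h) (hE'.restr_comp h)
  have hS : compr h (opS E) = (F⁻¹ * (star F)⁻¹).val := by
    have h1 : opS E = E⁻¹.val * star E⁻¹.val := rfl
    rw [h1, compr_mul h (hE'.restr_comp h), compr_adjoint, ← hF']
    rfl
  have hFP : ∀ f, restr n h (E⁻¹.val f) = F⁻¹.val (restr n h f) := fun f => by
    rw [hF']
    exact DFunLike.congr_fun (hE'.restr_comp h) f
  have hΓr : ∀ g, (restr n h ∘L Γ) g =ᵐ[vol r] fun x => mulVecL (G x) g := fun g =>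
    (restr_ae_eq h (Γ g)).trans (ae_mono hle (hΓ g))
  refine ⟨hS ▸ Units.isUnit _, hV ▸ V.isUnit, transferMatrix_eq_of_forall h fun g => ?_⟩
  have hwc : ContinuousOn (fun t => mulVecL (G t) (mulVecL (w t) g)) (Icc 0 l) := by
    have h1 : ContinuousOn w (Icc 0 l) := fun t ht => (hw.2 t ht).continuousWithinAt
    exact continuousOn_mulVecL hGc.continuousOn (continuousOn_mulVecL h1 continuousOn_const)
  have hl : 0 ≤ l := hr.le.trans h
  rw [← uIcc_of_le hl] at hwc
  -- Multiplying the integrated equation for wg by G identifies Y = Gwg as the solution of (I - zK)Y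
  -- = Γg.
  set Y : L2 l n := ofContinuousOn _ hwc with hY_def
  have hY : Y =ᵐ[vol l] fun t => mulVecL (G t) (mulVecL (w t) g) := by
    rw [hY_def]
    unfold ofContinuousOn
    exact MemLp.coeFn_toLp _
  have hKY : Y - z • K Y = Γ g := by
    refine Lp.ext ?_
    filter_upwards [Lp.coeFn_sub Y (z • K Y), Lp.coeFn_smul z (K Y), hG.opK_ae_eq hK Y, hΓ g, hY,
      ae_vol_mem] with x h1 h2 h3 h4 h5 hx
    have hx' := Ioc_subset_Icc_self hx
    have h6 : ∫ t in (0 : ℝ)..x, mulVecL (G t)ᴴ (Y t) =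
        ∫ t in (0 : ℝ)..x, mulVecL (G t)ᴴ (mulVecL (G t) (mulVecL (w t) g)) := by
      refine integral_congr_ae_vol (l := l) ?_ hx'
      filter_upwards [hY] with t ht
      rw [ht]
    rw [h1, Pi.sub_apply, h2, Pi.smul_apply, h3, h4, h5, h6, hw.mulVecL_eq hGc hγ g hx', map_sub,
      mulVecL_smul_right, smul_smul]
    module
  have hAY : (1 - z • opA l n) (E⁻¹.val Y) = E⁻¹.val (Γ g) := by
    have h1 : opA l n (E⁻¹.val Y) = E⁻¹.val (K Y) := by
      have h2 : opA l n * E⁻¹.val = E⁻¹.val * K := by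
        rw [← hEA, ← mul_assoc, ← mul_assoc, Units.inv_mul, one_mul]
      exact DFunLike.congr_fun h2 Y
    rw [← hKY, map_sub, map_smul, ← h1]
    rfl
  -- The similarity moves the resolvent of A_r onto Y, so it never has to be computed.
  have hVY : V⁻¹.val (restr n h (E⁻¹.val (Γ g))) = F⁻¹.val (restr n h Y) := by
    rw [← hAY, hVP, hFP]
    exact DFunLike.congr_fun V.inv_mul _
  have hadj : ∀ f, (E⁻¹.val ∘L Γ).adjoint ((restr n h).adjoint ((star F).val f)) =
      (restr n h ∘L Γ).adjoint f := by
    intro f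
    refine ext_inner_left ℂ fun u => ?_
    have h1 : (star F).val = F.val.adjoint := rfl
    rw [ContinuousLinearMap.adjoint_inner_right, ContinuousLinearMap.adjoint_inner_right,
      ContinuousLinearMap.adjoint_inner_right, h1, ContinuousLinearMap.adjoint_inner_right]
    congr 1
    rw [ContinuousLinearMap.comp_apply, hFP]
    exact DFunLike.congr_fun F.mul_inv _
  -- S_r⁻¹ = F*F, so F* remains, and it cancels against the F⁻¹ hidden in P_rΠ.
  have hSY : Ring.inverse (compr h (opS E)) (F⁻¹.val (restr n h Y)) =
      (star F).val (restr n h Y) := by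
    rw [hS, Ring.inverse_unit, mul_inv_rev, inv_inv, inv_inv, Units.val_mul]
    exact congrArg (star F).val (DFunLike.congr_fun F.mul_inv (restr n h Y))
  rw [← hV, Ring.inverse_unit, ContinuousLinearMap.comp_apply, hVY, hSY, hadj,
    adjoint_apply_of_ae_eq hr.le hG.bm hΓr, hw.mulVecL_eq hGc hγ g ⟨hr.le, h⟩]
  congr 2
  refine integral_congr_ae_vol (l := r) ?_ ⟨hr.le, le_rfl⟩
  filter_upwards [restr_ae_eq h Y, ae_mono hle hY] with t h1 h2
  rw [h1, h2]

end Transfer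

/-! ### What the normalization contributes. -/

section Normalized

variable {l : ℝ} {m₁ m₂ : ℕ}
  {γ : ℝ → Matrix (Fin m₂) (Fin m₁ ⊕ Fin m₂) ℂ} {hγ : BoundedlyDifferentiableOn l γ}
  {E : (L2 l m₂ →L[ℂ] L2 l m₂)ˣ}

lemma sum_smul_column_ae_eq {n : ℕ} {κ : Type*} [Fintype κ] [DecidableEq κ]
    {γ : ℝ → Matrix (Fin n) κ ℂ} (hγ : BoundedlyDifferentiableOn l γ) (g : EuclideanSpace ℂ κ)
    (s : Finset κ) : ((∑ i ∈ s, g i • column γ hγ i : L2 l n) : ℝ → EuclideanSpace ℂ (Fin n))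
      =ᵐ[vol l] fun x => mulVecL (γ x) (∑ i ∈ s, g i • EuclideanSpace.single i 1) := by
  induction s using Finset.induction_on with
  | empty =>
    simp only [Finset.sum_empty, map_zero]
    exact Lp.coeFn_zero _ _ _
  | insert i s hi ih =>
    simp only [Finset.sum_insert hi]
    filter_upwards [ih, Lp.coeFn_add (g i • column γ hγ i) (∑ i ∈ s, g i • column γ hγ i),
      Lp.coeFn_smul (g i) (column γ hγ i), column_ae_eq hγ i] with x h1 h2 h3 h4
    rw [h2, Pi.add_apply, h1, h3, Pi.smul_apply, h4, map_add, mulVecL_smul_right]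

lemma sum_smul_single {κ : Type*} [Fintype κ] [DecidableEq κ] (g : EuclideanSpace ℂ κ) :
    ∑ i, g i • EuclideanSpace.single i (1 : ℂ) = g := by
  ext j
  simp [Finset.sum_apply, Pi.single_apply]

lemma const_eq_sum (v : EuclideanSpace ℂ (Fin m₂)) :
    const l v = ∑ i, v i • const l (EuclideanSpace.single i 1) := by
  conv_lhs => rw [← sum_smul_single v]
  simp only [const, map_sum]
  rfl

/-- `E Π g = γ(x) g`. -/
lemma IsNormalizedSimilarity.map_opPi_ae_eq (hE : IsNormalizedSimilarity γ hγ E)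
    (g : EuclideanSpace ℂ (Fin m₁ ⊕ Fin m₂)) :
    (E.val ∘L opPi γ hγ E) g =ᵐ[vol l] fun x => mulVecL (γ x) g := by
  have h0 : ∀ f, E.val (E⁻¹.val f) = f := fun f => DFunLike.congr_fun E.mul_inv f
  have h1 : (E.val ∘L opPi γ hγ E) g = ∑ i, g i • column γ hγ i := by
    change E.val ((∑ j : Fin m₁, g (Sum.inl j) • E⁻¹.val (column γ hγ (Sum.inl j))) +
          const l (WithLp.toLp 2 fun i => g (Sum.inr i))) = _
    rw [const_eq_sum, map_add, map_sum, map_sum, Fintype.sum_sum_type]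
    -- The normalization rewrites constants as combinations of E⁻¹ applied to the columns of γ₂, so
    -- E acts alike on both blocks of Π.
    simp only [← hE.normalized, map_smul, h0]
  rw [h1]
  have h2 := sum_smul_column_ae_eq hγ g Finset.univ
  rwa [sum_smul_single] at h2

end Normalized

end SkewDirac

open SkewDirac

theorem mainTheorem8 (m₁ m₂ : ℕ) (l : ℝ) (hl : 0 < l)
    (γ : ℝ → Matrix (Fin m₂) (Fin m₁ ⊕ Fin m₂) ℂ)
    (hγ : BoundedlyDifferentiableOn l γ)
    (hγγ : ∀ x ∈ Icc 0 l, γ x * (γ x)ᴴ = 1)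
    (hγ₂ : ((γ 0).toCols₂).det ≠ 0) :
    (∃ E : (L2 l m₂ →L[ℂ] L2 l m₂)ˣ, IsNormalizedSimilarity γ hγ E) ∧
    (∀ z : ℂ, ∃ w : ℝ → Matrix (Fin m₁ ⊕ Fin m₂) (Fin m₁ ⊕ Fin m₂) ℂ,
      IsFundamentalSolution l γ z w) ∧
    ∀ E : (L2 l m₂ →L[ℂ] L2 l m₂)ˣ, IsNormalizedSimilarity γ hγ E →
      IsSNode (opA l m₂) (opS E) (opPi γ hγ E) ∧
      ∀ (z : ℂ) (w : ℝ → Matrix (Fin m₁ ⊕ Fin m₂) (Fin m₁ ⊕ Fin m₂) ℂ),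
        IsFundamentalSolution l γ z w →
        ∀ (r : ℝ) (_ : 0 < r) (hrl : r ≤ l),
          IsUnit (compr hrl (opS E)) ∧ IsUnit (1 - z • compr hrl (opA l m₂)) ∧
          w r = transferMatrix hrl (opA l m₂) (opS E) (opPi γ hγ E) z := by
  obtain ⟨G, a, hG, hGc, hγG, -⟩ := exists_frame hl.le hγ hγγ
  obtain ⟨K, hK⟩ := hG.exists_opK
  refine ⟨exists_isNormalizedSimilarity hl hγ hγγ hγ₂,
    fun z => hG.exists_isFundamentalSolution hGc hγG z, fun E hE => ?_⟩
  have hEA : E.val * opA l m₂ * E⁻¹.val = K :=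
    ContinuousLinearMap.ext fun f =>
      Lp.ext ((hE.similar f).trans (hG.opK_ae_eq_toLp hγG hK f).symm)
  have hΓ : ∀ g, (E.val ∘L opPi γ hγ E) g =ᵐ[vol l] fun x => mulVecL (G x) g := by
    intro g
    filter_upwards [hE.map_opPi_ae_eq g, ae_vol_mem] with x h1 hx
    rw [h1, hγG x (Ioc_subset_Icc_self hx)]
  -- EΠ plays the role of Γ, so no separate operator of multiplication by γ is constructed.
  have hPi : opPi γ hγ E = E⁻¹.val ∘L (E.val ∘L opPi γ hγ E) :=
    ContinuousLinearMap.ext fun g => (DFunLike.congr_fun E.inv_mul (opPi γ hγ E g)).symm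
  obtain ⟨ρ, -, -, -, hE₁, hE₂⟩ := hE.triangular
  constructor
  · rw [hPi]
    exact isSNode_of_similar hEA (hG.adjoint_opK hl.le hK hΓ)
  · intro z w hw r hr hrl
    have h := hG.isUnit_and_transferMatrix hGc hγG hK hΓ hEA hE₁ hE₂ hw hr hrl
    rwa [← hPi] at h
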